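/- **Notation.** Let $n\ge 1$ and let $d\gamma(x)=\pi^{-n/2}e^{-|x|^2}\,dx$ be the Gauss measure on $\mathbb R^n$; $B(x,r)$ is the open ball with centre $x$ and radius $r$. Put $m(x)=\min\{1,1/|x|\}$ (so $m(0)=1$) and $V(x,y)=\gamma(B(x,|x-y|))$. For $f\in L^1(\gamma)$ let $$\|f\|_*=\sup_B\frac1{\gamma(B)}\int_B|f-f_B|\,d\gamma,\qquad f_B=\frac1{\gamma(B)}\int_B f\,d\gamma,$$ the supremum being over all balls $B=B(c,r)$ with $0<r\le m(c)$. One says $f\in\mathrm{BMO}(\gamma)$ if $f\in L^1(\gamma)$ and $\|f\|_*<\infty$, and sets $\|f\|_{\mathrm{BMO}(\gamma)}=\|f\|_*+\|f\|_{L^1(\gamma)}$. Let $L_c^\infty(\gamma)$ be the set of functions in $L^\infty(\gamma)$ with compact support. All functions $b,f$ take values in a fixed field $\mathbb K\in\{\mathbb R,\mathbb C\}$. For $a>0$, $\beta\in(0,1)$ and $f\in L_c^\infty(\gamma)$ define $$\widetilde{[b,I_a^\beta]}(f)(x)=\int_{B(x,am(x))}\frac{|b(x)-b(y)|\,|f(y)|}{V(x,y)^{1-\beta}}\,d\gamma(y),\qquad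 \widetilde I_a^\beta(f)(x)=\int_{B(x,am(x))}\frac{f(y)}{(e^{-|x|^2}|x-y|^n)^{1-\beta}}\,d\gamma(y),$$ $$[b,\widetilde I_a^\beta](f)=b\,\widetilde I_a^\beta(f)-\widetilde I_a^\beta(bf)$$ (the last one for $b\in L^1(\gamma)$, almost everywhere, by the same integral for $bf$). **Theorem 1.1.** Let $a\in(0,\infty)$, $\beta\in(0,1)$, $1<p<q<\infty$ and $1/q=1/p-\beta$. There is a constant $C>0$, depending only on $n,a,p,q$ (and the choice of $\mathbb K$), such that the following hold. (i) If $b\in\mathrm{BMO}(\gamma)$, then for all $f\in L_c^\infty(\gamma)$ the function $\widetilde{[b,I_a^\beta]}(f)$ is measurable (up to a null set) and $$\big\|\widetilde{[b,I_a^\beta]}(f)\big\|_{L^q(\gamma)}\le C\,\|b\|_*\,\|f\|_{L^p(\gamma)}.$$ Moreover $\widetilde{[b,I_a^\beta]}$ extends to a continuous operator $T:L^p(\gamma)\to L^q(\gamma)$ that is nonnegative and sublinear ($Tf\ge0$, $T(f+g)\le Tf+Tg$, $T(cf)=|c|\,Tf$) and satisfies $\|Tf\|_{L^q(\gamma)}\le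 C\|b\|_*\|f\|_{L^p(\gamma)}$ for all $f\in L^p(\gamma)$. This extension is unique, both among the bounded nonnegative sublinear operators and among all continuous maps from $L^p(\gamma)$ to $L^q(\gamma)$ that extend $\widetilde{[b,I_a^\beta]}$. (ii) Conversely, if $b\in L^1(\gamma)$ and $[b,\widetilde I_a^\beta]$ is bounded from $L^p(\gamma)\cap L_c^\infty(\gamma)$ (with the $L^p(\gamma)$ norm) to $L^q(\gamma)$, then $b\in\mathrm{BMO}(\gamma)$ and $$\|b\|_{\mathrm{BMO}(\gamma)}\le\|b\|_{L^1(\gamma)}+C\,\big\|[b,\widetilde I_a^\beta]\big\|_{L^p(\gamma)\to L^q(\gamma)},$$ where the last norm is $\sup\{\|[b,\widetilde I_a^\beta](f)\|_{L^q(\gamma)}: f\in L_c^\infty(\gamma),\ \|f\|_{L^p(\gamma)}=1\}$. -/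

import Mathlib

open MeasureTheory
open scoped ENNReal NNReal

noncomputable section

namespace GaussBMO

/-- The Gauss measure `dγ(x) = π^{-n/2} e^{-|x|²} dx` on `ℝⁿ`. -/
def gaussMeasure (n : ℕ) : Measure (EuclideanSpace ℝ (Fin n)) :=
  volume.withDensity fun x =>
    ENNReal.ofReal (Real.pi ^ (-(n : ℝ) / 2) * Real.exp (-‖x‖ ^ 2))

variable {n : ℕ} {𝕜 : Type*} [RCLike 𝕜]

/-- `m(x) = min {1, 1/|x|}`, with the convention `1/0 = ∞` (so `m(0) = 1`). -/
def admScale (x : EuclideanSpace ℝ (Fin n)) : ℝ := (max 1 ‖x‖)⁻¹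

/-- The ball with centre `c` and radius `r` belongs to the admissible class `𝓑_a`. -/
def IsAdmissible (a : ℝ) (c : EuclideanSpace ℝ (Fin n)) (r : ℝ) : Prop :=
  0 < r ∧ r ≤ a * admScale c

/-- `‖f‖_*`: the supremum over `B ∈ 𝓑₁` of `γ(B)⁻¹ ∫_B |f - f_B| dγ`, in `[0, ∞]`. -/
def bmoSeminorm (f : EuclideanSpace ℝ (Fin n) → 𝕜) : ℝ≥0∞ :=
  ⨆ (c : EuclideanSpace ℝ (Fin n)) (r : ℝ) (_ : IsAdmissible 1 c r),
    (gaussMeasure n (Metric.ball c r))⁻¹ *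
      ∫⁻ x in Metric.ball c r,
        ‖f x - ⨍ y in Metric.ball c r, f y ∂(gaussMeasure n)‖ₑ ∂(gaussMeasure n)

/-- `f ∈ BMO(γ)`. -/
def IsBMO (f : EuclideanSpace ℝ (Fin n) → 𝕜) : Prop :=
  Integrable f (gaussMeasure n) ∧ bmoSeminorm f < ∞

/-- `‖f‖_{BMO(γ)} = ‖f‖_* + ‖f‖_{L¹(γ)}`, in `[0, ∞]`. -/
def bmoNorm (f : EuclideanSpace ℝ (Fin n) → 𝕜) : ℝ≥0∞ :=
  bmoSeminorm f + eLpNorm f 1 (gaussMeasure n)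

/-- `f ∈ L_c^∞(γ)`: essentially bounded (and a.e. measurable) with compact support. -/
def IsLcInfty (f : EuclideanSpace ℝ (Fin n) → 𝕜) : Prop :=
  MemLp f ∞ (gaussMeasure n) ∧ HasCompactSupport f

/-- The sublinear commutator
`∫_{B(x, a m(x))} |b(x) - b(y)| |f(y)| / V(x, y)^{1-β} dγ(y)`, `V(x, y) = γ(B(x, |x - y|))`,
as a function with values in `[0, ∞]`. -/
def sublinComm (a β : ℝ) (b f : EuclideanSpace ℝ (Fin n) → 𝕜)
    (x : EuclideanSpace ℝ (Fin n)) : ℝ≥0∞ :=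
  ∫⁻ y in Metric.ball x (a * admScale x),
    ‖b x - b y‖ₑ * ‖f y‖ₑ / (gaussMeasure n (Metric.ball x ‖x - y‖)) ^ (1 - β)
      ∂(gaussMeasure n)

/-- The local fractional integral
`Ĩ_a^β f(x) = ∫_{B(x, a m(x))} f(y) / (e^{-|x|²} |x - y|ⁿ)^{1-β} dγ(y)`. -/
def fracInt (a β : ℝ) (f : EuclideanSpace ℝ (Fin n) → 𝕜)
    (x : EuclideanSpace ℝ (Fin n)) : 𝕜 :=
  ∫ y in Metric.ball x (a * admScale x),
    ((Real.exp (-‖x‖ ^ 2) * ‖x - y‖ ^ n) ^ (1 - β))⁻¹ • f y ∂(gaussMeasure n)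

/-- The commutator `[b, Ĩ_a^β] f = b Ĩ_a^β f - Ĩ_a^β (b f)`. For `b ∈ L¹(γ)` and `f ∈ L_c^∞(γ)`
both integrals converge absolutely at almost every point. -/
def fracComm (a β : ℝ) (b f : EuclideanSpace ℝ (Fin n) → 𝕜)
    (x : EuclideanSpace ℝ (Fin n)) : 𝕜 :=
  b x * fracInt a β f x - fracInt a β (fun y => b y * f y) x

/-- `[b, Ĩ_a^β]` is bounded from `L^p(γ) ∩ L_c^∞(γ)` to `L^q(γ)`. -/
def FracCommBounded (a β : ℝ) (p q : ℝ≥0∞) (b : EuclideanSpace ℝ (Fin n) → 𝕜) : Prop :=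
  ∃ K : ℝ≥0, ∀ f : EuclideanSpace ℝ (Fin n) → 𝕜, IsLcInfty f →
    MemLp (fracComm a β b f) q (gaussMeasure n) ∧
      eLpNorm (fracComm a β b f) q (gaussMeasure n) ≤ K * eLpNorm f p (gaussMeasure n)

/-- The operator norm
`sup {‖[b, Ĩ_a^β] f‖_{L^q(γ)} : f ∈ L_c^∞(γ), ‖f‖_{L^p(γ)} = 1}`, in `[0, ∞]`. -/
def fracCommNorm (a β : ℝ) (p q : ℝ≥0∞) (b : EuclideanSpace ℝ (Fin n) → 𝕜) : ℝ≥0∞ :=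
  ⨆ (f : EuclideanSpace ℝ (Fin n) → 𝕜) (_ : IsLcInfty f)
    (_ : eLpNorm f p (gaussMeasure n) = 1), eLpNorm (fracComm a β b f) q (gaussMeasure n)

/-- A (nonnegative) sublinear operator from `L^p(γ)` to `L^q(γ)`. -/
structure IsSublinear {p q : ℝ≥0∞}
    (T : Lp 𝕜 p (gaussMeasure n) → Lp ℝ q (gaussMeasure n)) : Prop where
  nonneg : ∀ f, 0 ≤ T f
  add_le : ∀ f g, T (f + g) ≤ T f + T g
  smul : ∀ (c : 𝕜) f, T (c • f) = ‖c‖ • T f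

/-- `T : L^p(γ) → L^q(γ)` extends the sublinear commutator from `L_c^∞(γ)`. -/
def ExtendsSublinComm (a β : ℝ) {p q : ℝ≥0∞} (b : EuclideanSpace ℝ (Fin n) → 𝕜)
    (T : Lp 𝕜 p (gaussMeasure n) → Lp ℝ q (gaussMeasure n)) : Prop :=
  ∀ (g : Lp 𝕜 p (gaussMeasure n)) (f : EuclideanSpace ℝ (Fin n) → 𝕜), IsLcInfty f →
    g =ᵐ[gaussMeasure n] f →
      T g =ᵐ[gaussMeasure n] fun x => (sublinComm a β b f x).toReal

end GaussBMO

end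

namespace GaussBMO

open Metric

variable {n : ℕ} {𝕜 : Type*} [RCLike 𝕜]

/-! ### Geometry of the Gauss measure at the admissible scale -/

/-! Everything rests on one fact: within distance A·m(x) of x the number |x|² changes by at most 2A
+ A². At that scale γ is therefore e^{-|x|²} times Lebesgue measure up to constants, and it is
doubling, so Euclidean arguments run locally with uniform constants. The parameter a is arbitrary
while ‖b‖_* only sees radii up to m, so oscillation has to be carried from small radii to larger
ones; this is `exists_lintegral_sub_ballAvg_le`, and it is why averages are taken over balls of
radius δρ with δ small.

Upper bound. Let ρ = 2⁻ᵏa be comparable to |x - y|. Then b(x) - b(y) is the sum of b(x) -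
b_{B(y,δρ)}, of -(b(y) - b_{B(x,δρ)}), and of a difference of two averages, which a chain of small
balls bounds by a multiple of ‖b‖_*. In the first two terms the value and the average belong to
opposite variables, so the commutator kernel is dominated by `oscKernel` plus its transpose
(`exists_commKernel_le`). For `oscKernel` the oscillation sits in the variable of integration:
John–Nirenberg (`exists_johnNirenberg`) controls all its power means, and Hölder bounds the
contribution of scale ρ, up to a constant times ‖b‖_*, both by w^β M(x) and by w^{-1/q} N. Here w is
the weight of the ball, M a local maximal function of exponent s in (1, p), and N the L^p norm of f.
Summing the smaller of the two is Hedberg's trick (`exists_tsum_min_le`) and gives M^{p/q}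
N^{1-p/q}, whose q-th power is integrated by the maximal theorem. The transpose follows by duality
from the same estimate for the exponents q' < p', since 1/p' = 1/q' - β.

Extension. The bound makes the defining integral finite almost everywhere for every f in L^p, so the
formula itself defines T. A bounded nonnegative sublinear operator is Lipschitz, and L_c^∞ is dense,
whence uniqueness.

Converse. Given a small ball B, take a ball B' of the same radius three radii away. Let m be a
median on B' of the real or imaginary part of b, and let F be the half of B' where this part is at
most m. At points of B where it exceeds m, the positive kernel of the commutator applied to the
indicator of F sees differences of one sign only, so the commutator bounds the excess over m from
above; the other half of B' handles the deficit (`exists_lintegral_ofReal_sub_le`). This controls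
oscillation on small balls, and the passage between scales yields all of 𝓑₁. -/

lemma admScale_pos (x : EuclideanSpace ℝ (Fin n)) : 0 < admScale x := by
  unfold admScale; positivity

lemma admScale_le_one (x : EuclideanSpace ℝ (Fin n)) : admScale x ≤ 1 :=
  inv_le_one_of_one_le₀ (le_max_left _ _)

lemma admScale_mul_norm_le (x : EuclideanSpace ℝ (Fin n)) : admScale x * ‖x‖ ≤ 1 := by
  unfold admScale
  rw [inv_mul_le_iff₀ (by positivity), mul_one]
  exact le_max_right _ _

lemma measurable_admScale : Measurable (admScale : EuclideanSpace ℝ (Fin n) → ℝ) := by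
  unfold admScale
  exact (measurable_const.max measurable_norm).inv

/-- Moving by at most A enlarges max(1, |x|) by a factor at most 1 + A. This transfers admissibility
from one centre to a nearby one. -/
lemma admScale_le_mul_of_dist_le {A : ℝ} (hA : 0 ≤ A) {x y : EuclideanSpace ℝ (Fin n)}
    (h : dist x y ≤ A * admScale x) : admScale x ≤ (1 + A) * admScale y := by
  have h1 : ‖y‖ ≤ ‖x‖ + dist x y := by
    rw [dist_eq_norm]; linarith [norm_sub_norm_le y x, norm_sub_rev x y]
  have h2 := admScale_le_one x
  have h3 : max 1 ‖y‖ ≤ (1 + A) * max 1 ‖x‖ := by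
    have h4 := le_max_left 1 ‖x‖
    have h5 := le_max_right 1 ‖x‖
    have h6 : A * admScale x ≤ A := mul_le_of_le_one_right hA h2
    apply max_le <;> nlinarith
  unfold admScale
  rw [← div_eq_mul_inv, le_div_iff₀ (by positivity), inv_mul_le_iff₀ (by positivity), mul_comm]
  exact h3

/-- Factor the difference of squares: one factor is at most A·m(x), the other at most 2|x| + A·m(x),
and both m(x)|x| and m(x) are at most 1. This is the reason for the choice of m. -/
lemma abs_sq_norm_sub_le {A : ℝ} (hA : 0 ≤ A) {x y : EuclideanSpace ℝ (Fin n)}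
    (h : dist x y ≤ A * admScale x) : |‖x‖ ^ 2 - ‖y‖ ^ 2| ≤ 2 * A + A ^ 2 := by
  have h1 : |‖x‖ - ‖y‖| ≤ dist x y := by rw [dist_eq_norm]; exact abs_norm_sub_norm_le x y
  have h2 := admScale_le_one x
  have h3 := admScale_mul_norm_le x
  have h4 := admScale_pos x
  have h5 : ‖y‖ ≤ ‖x‖ + A * admScale x := by linarith [(abs_le.1 h1).1]
  have : ‖x‖ ^ 2 - ‖y‖ ^ 2 = (‖x‖ - ‖y‖) * (‖x‖ + ‖y‖) := by ring
  rw [this, abs_mul, abs_of_nonneg (by positivity : 0 ≤ ‖x‖ + ‖y‖)]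
  calc |‖x‖ - ‖y‖| * (‖x‖ + ‖y‖)
      ≤ (A * admScale x) * (2 * ‖x‖ + A * admScale x) := by
        refine mul_le_mul (h1.trans h) (by linarith) (by positivity) (by positivity)
    _ = 2 * A * (admScale x * ‖x‖) + A ^ 2 * admScale x ^ 2 := by ring
    _ ≤ 2 * A * 1 + A ^ 2 * 1 := by
        gcongr
        exact pow_le_one₀ h4.le h2
    _ = _ := by ring

/-- `e^{-|x|²} rⁿ`, which is comparable to `γ(B(x, r))` when `r ≲ m(x)`. -/
noncomputable def weight (x : EuclideanSpace ℝ (Fin n)) (r : ℝ) : ℝ≥0∞ :=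
  ENNReal.ofReal (Real.exp (-‖x‖ ^ 2) * r ^ n)

lemma weight_pos (x : EuclideanSpace ℝ (Fin n)) {r : ℝ} (hr : 0 < r) : 0 < weight x r := by
  unfold weight; rw [ENNReal.ofReal_pos]; positivity

lemma weight_ne_top (x : EuclideanSpace ℝ (Fin n)) (r : ℝ) : weight x r ≠ ∞ :=
  ENNReal.ofReal_ne_top

lemma weight_mul (x : EuclideanSpace ℝ (Fin n)) {t : ℝ} (ht : 0 ≤ t) (r : ℝ) :
    weight x (t * r) = ENNReal.ofReal (t ^ n) * weight x r := by
  unfold weight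
  rw [← ENNReal.ofReal_mul (by positivity)]
  congr 1; ring

lemma weight_mono (x : EuclideanSpace ℝ (Fin n)) {r s : ℝ} (hr : 0 ≤ r) (h : r ≤ s) :
    weight x r ≤ weight x s := by
  unfold weight
  gcongr

lemma measurable_weight (r : ℝ) : Measurable fun x : EuclideanSpace ℝ (Fin n) => weight x r := by
  unfold weight; fun_prop

lemma exp_neg_sq_le {A : ℝ} (hA : 0 ≤ A) {x y : EuclideanSpace ℝ (Fin n)}
    (h : dist x y ≤ A * admScale x) :
    Real.exp (-‖x‖ ^ 2) ≤ Real.exp (2 * A + A ^ 2) * Real.exp (-‖y‖ ^ 2) := by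
  rw [← Real.exp_add, Real.exp_le_exp]
  linarith [(abs_le.1 (abs_sq_norm_sub_le hA h)).1]

lemma exp_neg_sq_le' {A : ℝ} (hA : 0 ≤ A) {x y : EuclideanSpace ℝ (Fin n)}
    (h : dist x y ≤ A * admScale x) :
    Real.exp (-‖y‖ ^ 2) ≤ Real.exp (2 * A + A ^ 2) * Real.exp (-‖x‖ ^ 2) := by
  rw [← Real.exp_add, Real.exp_le_exp]
  linarith [(abs_le.1 (abs_sq_norm_sub_le hA h)).2]

lemma weight_le_mul_weight {A : ℝ} (hA : 0 ≤ A) {x y : EuclideanSpace ℝ (Fin n)}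
    (h : dist x y ≤ A * admScale x) {r : ℝ} (hr : 0 ≤ r) :
    weight x r ≤ ENNReal.ofReal (Real.exp (2 * A + A ^ 2)) * weight y r := by
  unfold weight
  rw [← ENNReal.ofReal_mul (by positivity), ← mul_assoc]
  gcongr
  exact exp_neg_sq_le hA h

lemma weight_le_mul_weight' {A : ℝ} (hA : 0 ≤ A) {x y : EuclideanSpace ℝ (Fin n)}
    (h : dist x y ≤ A * admScale x) {r : ℝ} (hr : 0 ≤ r) :
    weight y r ≤ ENNReal.ofReal (Real.exp (2 * A + A ^ 2)) * weight x r := by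
  unfold weight
  rw [← ENNReal.ofReal_mul (by positivity), ← mul_assoc]
  gcongr
  exact exp_neg_sq_le' hA h

lemma measurable_gauss_density : Measurable fun x : EuclideanSpace ℝ (Fin n) =>
    ENNReal.ofReal (Real.pi ^ (-(n : ℝ) / 2) * Real.exp (-‖x‖ ^ 2)) := by fun_prop

lemma gaussMeasure_apply {s : Set (EuclideanSpace ℝ (Fin n))} (hs : MeasurableSet s) :
    gaussMeasure n s = ∫⁻ x in s,
      ENNReal.ofReal (Real.pi ^ (-(n : ℝ) / 2) * Real.exp (-‖x‖ ^ 2)) := by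
  rw [gaussMeasure, withDensity_apply _ hs]

lemma gaussMeasure_absolutelyContinuous :
    gaussMeasure n ≪ (volume : Measure (EuclideanSpace ℝ (Fin n))) :=
  withDensity_absolutelyContinuous _ _

instance : IsFiniteMeasure (gaussMeasure n) := by
  refine isFiniteMeasure_withDensity_ofReal (Integrable.hasFiniteIntegral ?_)
  have := (GaussianFourier.integrable_cexp_neg_mul_sq_norm_add (V := EuclideanSpace ℝ (Fin n))
    (b := 1) (by simp) 0 0).norm
  refine Integrable.const_mul (this.congr (Filter.Eventually.of_forall fun x => ?_)) _
  simp only [Complex.norm_exp]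
  congr 1
  simp [← Complex.ofReal_pow]

/-- The Gauss measure of a ball of radius `≲ m(x)` is comparable to its weight. -/
theorem exists_gaussMeasure_ball_comparable (n : ℕ) {A : ℝ} (hA : 0 ≤ A) :
    ∃ C : ℝ≥0, 0 < C ∧ ∀ (x : EuclideanSpace ℝ (Fin n)) (r : ℝ), 0 < r → r ≤ A * admScale x →
      gaussMeasure n (ball x r) ≤ C * weight x r ∧
      weight x r ≤ C * gaussMeasure n (ball x r) := by
  set K := Real.exp (2 * A + A ^ 2)
  set P := Real.pi ^ (-(n : ℝ) / 2)
  set v := volume (ball (0 : EuclideanSpace ℝ (Fin n)) 1)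
  have hP : 0 < P := by positivity
  have hK : 0 < K := by positivity
  have hv : 0 < v := measure_ball_pos _ _ one_pos
  have hvt : v ≠ ∞ := measure_ball_lt_top.ne
  -- On the ball the density lies between P K⁻¹ e^{-|x|²} and P K e^{-|x|²}; the two constants come
  -- from integrating these bounds.
  set C₁ : ℝ≥0∞ := ENNReal.ofReal (P * K) * v
  set C₂ : ℝ≥0∞ := (ENNReal.ofReal (P * K⁻¹) * v)⁻¹
  have hvol : ∀ (x : EuclideanSpace ℝ (Fin n)) (r : ℝ), 0 < r →
      volume (ball x r) = ENNReal.ofReal (r ^ n) * v := by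
    intro x r hr
    have := Measure.addHaar_ball_mul_of_pos
      (volume : Measure (EuclideanSpace ℝ (Fin n))) x hr 1
    rwa [mul_one, finrank_euclideanSpace_fin] at this
  have hC₁ : C₁ ≠ ∞ := by finiteness
  have hC₂ : C₂ ≠ ∞ := by
    simp only [C₂, ne_eq, ENNReal.inv_eq_top, mul_eq_zero, ENNReal.ofReal_eq_zero, not_or, not_le]
    exact ⟨by positivity, hv.ne'⟩
  have key : ∀ C : ℝ≥0∞, C ≠ ∞ → C ≤ ((C.toNNReal + 1 : ℝ≥0) : ℝ≥0∞) := by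
    intro C hC
    rw [ENNReal.coe_add, ENNReal.coe_toNNReal hC]; exact le_self_add
  refine ⟨C₁.toNNReal + 1 + (C₂.toNNReal + 1), by positivity, fun x r hr hrA => ⟨?_, ?_⟩⟩
  · refine le_trans (b := C₁ * weight x r) ?_ ?_
    · rw [gaussMeasure_apply measurableSet_ball]
      calc _ ≤ ∫⁻ y in ball x r, ENNReal.ofReal (P * (K * Real.exp (-‖x‖ ^ 2))) := by
            refine setLIntegral_mono measurable_const fun y hy => ?_
            gcongr
            refine exp_neg_sq_le' hA ?_
            rw [dist_comm]; exact (mem_ball.1 hy).le.trans hrA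
        _ = C₁ * weight x r := by
            rw [setLIntegral_const, hvol x r hr]
            simp only [C₁, weight]
            rw [mul_right_comm, ← mul_assoc, ← ENNReal.ofReal_mul (by positivity),
              ← ENNReal.ofReal_mul (by positivity)]
            congr 2; ring
    · gcongr
      refine (key C₁ hC₁).trans ?_
      exact_mod_cast (le_self_add : C₁.toNNReal + 1 ≤ C₁.toNNReal + 1 + (C₂.toNNReal + 1))
  · refine le_trans (b := C₂ * gaussMeasure n (ball x r)) ?_ ?_
    · rw [mul_comm C₂, ← div_eq_mul_inv, ENNReal.le_div_iff_mul_le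
        (Or.inl (by simp only [ne_eq, mul_eq_zero, ENNReal.ofReal_eq_zero, not_or, not_le]
                    exact ⟨by positivity, hv.ne'⟩)) (Or.inl (by finiteness))]
      rw [gaussMeasure_apply measurableSet_ball]
      calc weight x r * (ENNReal.ofReal (P * K⁻¹) * v)
          = ∫⁻ y in ball x r, ENNReal.ofReal (P * (K⁻¹ * Real.exp (-‖x‖ ^ 2))) := by
            rw [setLIntegral_const, hvol x r hr]
            simp only [weight]
            rw [← mul_assoc, ← mul_assoc, ← ENNReal.ofReal_mul (by positivity),
              ← ENNReal.ofReal_mul (by positivity)]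
            congr 2; ring
        _ ≤ _ := by
            refine setLIntegral_mono measurable_gauss_density fun y hy => ?_
            gcongr
            rw [inv_mul_le_iff₀ hK]
            refine exp_neg_sq_le hA ?_
            rw [dist_comm]; exact (mem_ball.1 hy).le.trans hrA
    · gcongr
      refine (key C₂ hC₂).trans ?_
      exact_mod_cast (le_add_self : C₂.toNNReal + 1 ≤ C₁.toNNReal + 1 + (C₂.toNNReal + 1))

lemma gaussMeasure_ball_pos (x : EuclideanSpace ℝ (Fin n)) {r : ℝ} (hr : 0 < r) :
    0 < gaussMeasure n (ball x r) := by
  obtain ⟨C, hC, h⟩ := exists_gaussMeasure_ball_comparable n (A := 1) zero_le_one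
  have hs : 0 < min r (admScale x) := lt_min hr (admScale_pos x)
  have := (h x (min r (admScale x)) hs (by rw [one_mul]; exact min_le_right _ _)).2
  have h2 := (weight_pos x hs).trans_le this
  refine lt_of_lt_of_le (pos_of_ne_zero fun h0 => ?_)
    (measure_mono (ball_subset_ball (min_le_left r (admScale x))))
  rw [h0, mul_zero] at h2; exact lt_irrefl _ h2

/-- Local doubling: balls of radius `≲ m` at distance `≲ m` have comparable Gauss measure when
their radii are comparable. -/
theorem exists_gaussMeasure_ball_le (n : ℕ) {A t : ℝ} (hA : 0 ≤ A) (ht : 0 ≤ t) :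
    ∃ C : ℝ≥0, 0 < C ∧ ∀ (x y : EuclideanSpace ℝ (Fin n)) (r s : ℝ), dist x y ≤ A * admScale x →
      r ≤ A * admScale x → 0 < s → s ≤ A * admScale y → r ≤ t * s →
      gaussMeasure n (ball x r) ≤ C * gaussMeasure n (ball y s) := by
  obtain ⟨C, hC, h⟩ := exists_gaussMeasure_ball_comparable n hA
  refine ⟨C * (Real.exp (2 * A + A ^ 2)).toNNReal * (t ^ n).toNNReal * C + 1, by positivity,
    fun x y r s hxy hr hs hsA hrs => ?_⟩
  rcases le_or_gt r 0 with h0 | h0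
  · rw [ball_eq_empty.2 h0]; simp
  calc gaussMeasure n (ball x r) ≤ C * weight x r := (h x r h0 hr).1
    _ ≤ C * (ENNReal.ofReal (Real.exp (2 * A + A ^ 2)) * weight y r) := by
        gcongr; exact weight_le_mul_weight hA hxy h0.le
    _ ≤ C * (ENNReal.ofReal (Real.exp (2 * A + A ^ 2)) * weight y (t * s)) := by
        gcongr; exact weight_mono y h0.le hrs
    _ = C * (ENNReal.ofReal (Real.exp (2 * A + A ^ 2)) * (ENNReal.ofReal (t ^ n) * weight y s)) := by
        rw [weight_mul y ht]
    _ ≤ C * (ENNReal.ofReal (Real.exp (2 * A + A ^ 2)) * (ENNReal.ofReal (t ^ n) *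
          (C * gaussMeasure n (ball y s)))) := by
        gcongr; exact (h y s hs hsA).2
    _ = ((C * (Real.exp (2 * A + A ^ 2)).toNNReal * (t ^ n).toNNReal * C : ℝ≥0) : ℝ≥0∞)
          * gaussMeasure n (ball y s) := by
        push_cast; rw [ENNReal.ofReal, ENNReal.ofReal]; ring
    _ ≤ _ := by gcongr; exact_mod_cast le_self_add

lemma measurable_gaussMeasure_ball {f : EuclideanSpace ℝ (Fin n) → ℝ} (hf : Measurable f) :
    Measurable fun x => gaussMeasure n (ball x (f x)) := by
  have hs : MeasurableSet {z : EuclideanSpace ℝ (Fin n) × EuclideanSpace ℝ (Fin n) |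
      dist z.2 z.1 < f z.1} :=
    measurableSet_lt (by fun_prop) (by fun_prop)
  exact measurable_measure_prodMk_left hs

end GaussBMO

namespace GaussBMO

open Metric

variable {n : ℕ} {𝕜 : Type*} [RCLike 𝕜]

/-! ### Mean oscillation over balls of radius `≲ m` -/

/-- The Gaussian average of `b` over the ball `B(c, r)`. -/
noncomputable def ballAvg (b : EuclideanSpace ℝ (Fin n) → 𝕜) (c : EuclideanSpace ℝ (Fin n))
    (r : ℝ) : 𝕜 :=
  ⨍ y in ball c r, b y ∂(gaussMeasure n)

/-- The `s`-th power mean oscillation of `b` over the balls of `𝓑_ε` is at most `D`. -/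
def OscBound (b : EuclideanSpace ℝ (Fin n) → 𝕜) (s ε : ℝ) (D : ℝ≥0) : Prop :=
  ∀ c r, IsAdmissible ε c r →
    ∫⁻ x in ball c r, ‖b x - ballAvg b c r‖ₑ ^ s ∂(gaussMeasure n) ≤
      (D : ℝ≥0∞) ^ s * gaussMeasure n (ball c r)

lemma oscBound_one_of_bmoSeminorm_le {b : EuclideanSpace ℝ (Fin n) → 𝕜} {D : ℝ≥0}
    (h : bmoSeminorm b ≤ D) : OscBound b 1 1 D := by
  intro c r hr
  have h1 : (gaussMeasure n (ball c r))⁻¹ *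
      ∫⁻ x in ball c r, ‖b x - ballAvg b c r‖ₑ ∂(gaussMeasure n) ≤ D := by
    simp only [bmoSeminorm, iSup_le_iff] at h
    exact h c r hr
  rw [mul_comm, ← div_eq_mul_inv, ENNReal.div_le_iff (gaussMeasure_ball_pos c hr.1).ne'
    (measure_ne_top _ _)] at h1
  simpa using h1

/-- The triangle inequality for the integral of b - κ, kept in multiplied form so that nothing is
divided in `ℝ≥0∞`. -/
lemma enorm_ballAvg_sub_mul_le {b : EuclideanSpace ℝ (Fin n) → 𝕜}
    (hb : Integrable b (gaussMeasure n)) (c : EuclideanSpace ℝ (Fin n)) (r : ℝ) (κ : 𝕜) :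
    ‖ballAvg b c r - κ‖ₑ * gaussMeasure n (ball c r) ≤
      ∫⁻ y in ball c r, ‖b y - κ‖ₑ ∂(gaussMeasure n) := by
  have h1 := measure_smul_setAverage (μ := gaussMeasure n) b (measure_ne_top _ (ball c r))
  have h2 : (gaussMeasure n).real (ball c r) • (ballAvg b c r - κ) =
      ∫ y in ball c r, (b y - κ) ∂(gaussMeasure n) := by
    rw [integral_sub hb.integrableOn (integrable_const _), setIntegral_const, smul_sub, ballAvg, h1]
  calc _ = ‖(gaussMeasure n).real (ball c r) • (ballAvg b c r - κ)‖ₑ := by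
        rw [enorm_smul, mul_comm, Real.enorm_of_nonneg measureReal_nonneg, Measure.real,
          ENNReal.ofReal_toReal (measure_ne_top _ _)]
    _ ≤ _ := by rw [h2]; exact enorm_integral_le_lintegral_enorm _

/-- The oscillation integral over the small ball is at most the one over the large ball, and passing
from one measure to the other costs the factor C. -/
lemma enorm_ballAvg_sub_le {b : EuclideanSpace ℝ (Fin n) → 𝕜}
    (hb : Integrable b (gaussMeasure n)) {ε : ℝ} {D : ℝ≥0} (hosc : OscBound b 1 ε D)
    {z y : EuclideanSpace ℝ (Fin n)} {R s : ℝ} (hR : IsAdmissible ε z R) (hs : 0 < s)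
    (hsub : ball y s ⊆ ball z R) {C : ℝ≥0}
    (hC : gaussMeasure n (ball z R) ≤ C * gaussMeasure n (ball y s)) :
    ‖ballAvg b y s - ballAvg b z R‖ₑ ≤ C * D := by
  have h0 := gaussMeasure_ball_pos y hs
  rw [← ENNReal.mul_le_mul_iff_left h0.ne' (measure_ne_top _ _)]
  calc _ ≤ _ := enorm_ballAvg_sub_mul_le hb y s _
    _ ≤ ∫⁻ x in ball z R, ‖b x - ballAvg b z R‖ₑ ∂(gaussMeasure n) := lintegral_mono_set hsub
    _ ≤ D * gaussMeasure n (ball z R) := by simpa using hosc z R hR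
    _ ≤ D * (C * gaussMeasure n (ball y s)) := by gcongr
    _ = _ := by ring

lemma measurable_ballAvg {b : EuclideanSpace ℝ (Fin n) → 𝕜} (hb : StronglyMeasurable b)
    (r : ℝ) : Measurable fun y => ballAvg b y r := by
  have hs : MeasurableSet {z : EuclideanSpace ℝ (Fin n) × EuclideanSpace ℝ (Fin n) |
      dist z.2 z.1 < r} := measurableSet_lt (by fun_prop) (by fun_prop)
  have h1 : StronglyMeasurable ({z : EuclideanSpace ℝ (Fin n) × EuclideanSpace ℝ (Fin n) |
      dist z.2 z.1 < r}.indicator fun z => b z.2) :=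
    (hb.comp_measurable measurable_snd).indicator hs
  have h2 := (h1.integral_prod_right' (ν := gaussMeasure n)).measurable
  have h3 : ∀ y, ballAvg b y r = ((gaussMeasure n (ball y r)).toReal)⁻¹ •
      ∫ z, ({z : EuclideanSpace ℝ (Fin n) × EuclideanSpace ℝ (Fin n) |
        dist z.2 z.1 < r}.indicator fun z => b z.2) (y, z) ∂(gaussMeasure n) := by
    intro y
    rw [ballAvg, setAverage_eq, ← integral_indicator measurableSet_ball]
    rfl
  simp_rw [h3]
  exact ((measurable_gaussMeasure_ball measurable_const).ennreal_toReal.inv).smul h2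

/-- One link of the chain: both balls lie in B(z, 2r), which is in 𝓑_ε, so both averages are
compared with the average over it. -/
lemma exists_enorm_ballAvg_sub_le_step (n : ℕ) (𝕜 : Type*) [RCLike 𝕜] : ∃ C : ℝ≥0,
    ∀ (b : EuclideanSpace ℝ (Fin n) → 𝕜), Integrable b (gaussMeasure n) →
    ∀ (ε : ℝ) (D : ℝ≥0), ε ≤ 1 → OscBound b 1 ε D →
    ∀ (z z' : EuclideanSpace ℝ (Fin n)) (r : ℝ), 0 < r → dist z z' ≤ r → 2 * r ≤ ε * admScale z →
      ‖ballAvg b z r - ballAvg b z' r‖ₑ ≤ C * D := by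
  obtain ⟨C, hC, h⟩ := exists_gaussMeasure_ball_le n (A := 2) (t := 2) zero_le_two zero_le_two
  refine ⟨2 * C, fun b hb ε D hε hosc z z' r hr hzz' hrz => ?_⟩
  have hz := admScale_pos z
  have h1 : 2 * r ≤ admScale z := hrz.trans (mul_le_of_le_one_left hz.le hε)
  have h2 : admScale z ≤ (1 + 1) * admScale z' :=
    admScale_le_mul_of_dist_le zero_le_one (by linarith)
  have hadm : IsAdmissible ε z (2 * r) := ⟨by linarith, hrz⟩
  have e1 : ‖ballAvg b z r - ballAvg b z (2 * r)‖ₑ ≤ C * D :=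
    enorm_ballAvg_sub_le hb hosc hadm hr (ball_subset_ball (by linarith))
      (h z z _ _ (by simp; positivity) (by linarith) hr (by linarith) le_rfl)
  have e2 : ‖ballAvg b z' r - ballAvg b z (2 * r)‖ₑ ≤ C * D :=
    enorm_ballAvg_sub_le hb hosc hadm hr
      (ball_subset_ball' (by rw [dist_comm]; linarith))
      (h z z' _ _ (by linarith) (by linarith) hr (by linarith) le_rfl)
  calc _ = ‖(ballAvg b z r - ballAvg b z (2 * r)) - (ballAvg b z' r - ballAvg b z (2 * r))‖ₑ := by
        congr 1; ring
    _ ≤ _ := enorm_sub_le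
    _ ≤ C * D + C * D := add_le_add e1 e2
    _ = _ := by push_cast; ring

/-- Averages over balls of radius `δρ` whose centres are at distance at most `ρ ≲ m` differ by at
most a multiple of the mean oscillation at small scales. -/
theorem exists_enorm_ballAvg_sub_le_chain (n : ℕ) (𝕜 : Type*) [RCLike 𝕜] {A δ : ℝ} (hA : 0 ≤ A)
    (hδ : 0 < δ) : ∃ C : ℝ≥0,
    ∀ (b : EuclideanSpace ℝ (Fin n) → 𝕜), Integrable b (gaussMeasure n) →
    ∀ (ε : ℝ) (D : ℝ≥0), ε ≤ 1 → 2 * δ * A * (1 + A) ≤ ε → OscBound b 1 ε D →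
    ∀ (x y : EuclideanSpace ℝ (Fin n)) (ρ : ℝ), 0 < ρ → ρ ≤ A * admScale x → dist x y ≤ ρ →
      ‖ballAvg b x (δ * ρ) - ballAvg b y (δ * ρ)‖ₑ ≤ C * D := by
  obtain ⟨C, h⟩ := exists_enorm_ballAvg_sub_le_step n 𝕜
  -- The segment from x to y is cut into J equal pieces of length at most δρ; J depends on δ only.
  set J : ℕ := ⌈1 / δ⌉₊ with hJ
  have hJ1 : 1 / δ ≤ J := Nat.le_ceil _
  have hJ0 : (0 : ℝ) < J := lt_of_lt_of_le (by positivity) hJ1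
  refine ⟨J * C, fun b hb ε D hε hδε hosc x y ρ hρ hρA hxy => ?_⟩
  set z : ℕ → EuclideanSpace ℝ (Fin n) := fun i => AffineMap.lineMap x y ((i : ℝ) / J) with hz
  have hstep : ∀ i, dist (z i) (z (i + 1)) ≤ δ * ρ := by
    intro i
    simp only [hz, dist_lineMap_lineMap, Real.dist_eq]
    have : (i : ℝ) / J - ((i + 1 : ℕ) : ℝ) / J = -(1 / J) := by push_cast; ring
    rw [this, abs_neg, abs_of_pos (by positivity)]
    have h2 : 1 / (J : ℝ) ≤ δ := by
      rw [div_le_iff₀ hJ0]; rw [div_le_iff₀ hδ] at hJ1; linarith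
    gcongr
  have hnear : ∀ i ≤ J, dist x (z i) ≤ ρ := by
    intro i hi
    simp only [hz, dist_left_lineMap, Real.norm_eq_abs]
    rw [abs_of_nonneg (by positivity)]
    have : (i : ℝ) / J ≤ 1 := by rw [div_le_one hJ0]; exact_mod_cast hi
    calc _ ≤ 1 * dist x y := by gcongr
      _ ≤ ρ := by linarith
  have hind : ∀ i ≤ J, ‖ballAvg b x (δ * ρ) - ballAvg b (z i) (δ * ρ)‖ₑ ≤ i * (C * D) := by
    intro i
    induction i with
    | zero => intro _; simp [hz]
    | succ i ih =>
      intro hi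
      have hi' : i ≤ J := by omega
      -- The doubled ball B(z i, 2δρ) must belong to 𝓑_ε; comparing m(x) with m(z i) reduces this to
      -- 2δA(1 + A) ≤ ε.
      have hm : admScale x ≤ (1 + A) * admScale (z i) :=
        admScale_le_mul_of_dist_le hA ((hnear i hi').trans hρA)
      have := h b hb ε D hε hosc (z i) (z (i + 1)) (δ * ρ) (by positivity) (hstep i) (by
        calc 2 * (δ * ρ) ≤ 2 * (δ * (A * ((1 + A) * admScale (z i)))) := by
              gcongr; exact hρA.trans (by gcongr)
          _ = (2 * δ * A * (1 + A)) * admScale (z i) := by ring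
          _ ≤ _ := by gcongr; exact (admScale_pos _).le)
      calc _ = ‖(ballAvg b x (δ * ρ) - ballAvg b (z i) (δ * ρ)) +
            (ballAvg b (z i) (δ * ρ) - ballAvg b (z (i + 1)) (δ * ρ))‖ₑ := by congr 1; ring
        _ ≤ _ := enorm_add_le _ _
        _ ≤ i * (C * D) + C * D := add_le_add (ih hi') this
        _ = _ := by push_cast; ring
  have := hind J le_rfl
  have hzJ : z J = y := by simp [hz, div_self hJ0.ne']
  rw [hzJ] at this
  refine this.trans (le_of_eq ?_)
  push_cast; ring

/-- Tonelli on the pairs with y in S and |y - z| < r. The constraint y in S is dropped after the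
exchange, hence an inequality. -/
lemma lintegral_ball_swap_le {G : EuclideanSpace ℝ (Fin n) → EuclideanSpace ℝ (Fin n) → ℝ≥0∞}
    (hG : Measurable (Function.uncurry G)) {S T : Set (EuclideanSpace ℝ (Fin n))}
    (hS : MeasurableSet S) (hT : MeasurableSet T) {r : ℝ}
    (hST : ∀ y ∈ S, ∀ z, dist z y < r → z ∈ T) :
    ∫⁻ y in S, ∫⁻ z in ball y r, G y z ∂(gaussMeasure n) ∂(gaussMeasure n) ≤
      ∫⁻ z in T, ∫⁻ y in ball z r, G y z ∂(gaussMeasure n) ∂(gaussMeasure n) := by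
  have hs : MeasurableSet {p : EuclideanSpace ℝ (Fin n) × EuclideanSpace ℝ (Fin n) |
      p.1 ∈ S ∧ dist p.2 p.1 < r} := by
    have h : MeasurableSet {p : EuclideanSpace ℝ (Fin n) × EuclideanSpace ℝ (Fin n) |
        dist p.2 p.1 < r} := measurableSet_lt (by fun_prop) (by fun_prop)
    exact (hS.preimage measurable_fst).inter h
  have e1 : ∀ y, S.indicator (fun y => ∫⁻ z in ball y r, G y z ∂(gaussMeasure n)) y =
      ∫⁻ z, {p : EuclideanSpace ℝ (Fin n) × EuclideanSpace ℝ (Fin n) |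
        p.1 ∈ S ∧ dist p.2 p.1 < r}.indicator (Function.uncurry G) (y, z) ∂(gaussMeasure n) := by
    intro y
    by_cases hy : y ∈ S
    · rw [Set.indicator_of_mem hy, ← lintegral_indicator measurableSet_ball]
      refine lintegral_congr fun z => ?_
      simp only [Set.indicator, mem_ball, Set.mem_ofPred_eq, hy, true_and, Function.uncurry]
    · rw [Set.indicator_of_notMem hy]
      simp [Set.indicator, hy]
  rw [← lintegral_indicator hS, lintegral_congr e1,
    lintegral_lintegral_swap (f := fun y z =>
      {p : EuclideanSpace ℝ (Fin n) × EuclideanSpace ℝ (Fin n) |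
        p.1 ∈ S ∧ dist p.2 p.1 < r}.indicator (Function.uncurry G) (y, z))
      (hG.indicator hs).aemeasurable, ← lintegral_indicator hT]
  refine lintegral_mono fun z => ?_
  by_cases hz : z ∈ T
  · rw [Set.indicator_of_mem hz, ← lintegral_indicator measurableSet_ball]
    refine lintegral_mono fun y => ?_
    simp only [Set.indicator, mem_ball, Set.mem_ofPred_eq, Function.uncurry]
    by_cases hy : y ∈ S ∧ dist z y < r
    · rw [if_pos hy, if_pos (by rw [dist_comm]; exact hy.2)]
    · rw [if_neg hy]; exact zero_le
  · rw [Set.indicator_of_notMem hz]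
    refine le_of_eq ?_
    rw [← lintegral_zero (μ := gaussMeasure n)]
    refine lintegral_congr fun y => ?_
    refine Set.indicator_of_notMem ?_ _
    rintro ⟨h1, h2⟩
    exact hz (hST y h1 z h2)

/-- Oscillation bounds at small scales give oscillation bounds at all scales `≲ m`. -/
theorem exists_lintegral_sub_ballAvg_le (n : ℕ) (𝕜 : Type*) [RCLike 𝕜] {A δ s : ℝ} (hA : 0 ≤ A)
    (hδ : 0 < δ) (hδ1 : δ ≤ 1) (hs : 1 ≤ s) : ∃ C : ℝ≥0,
    ∀ (b : EuclideanSpace ℝ (Fin n) → 𝕜), Integrable b (gaussMeasure n) → StronglyMeasurable b →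
    ∀ (ε : ℝ) (D : ℝ≥0), ε ≤ 1 → 2 * δ * A * (1 + 2 * A) ≤ ε → OscBound b 1 ε D →
    OscBound b s ε D →
    ∀ (x : EuclideanSpace ℝ (Fin n)) (ρ : ℝ), 0 < ρ → ρ ≤ A * admScale x →
      ∫⁻ y in ball x ρ, ‖b y - ballAvg b x (δ * ρ)‖ₑ ^ s ∂(gaussMeasure n) ≤
        C * (D : ℝ≥0∞) ^ s * gaussMeasure n (ball x ρ) := by
  -- The averages to be compared have centres up to 2ρ apart and radius δρ = (δ/2)(2ρ), hence the
  -- parameters 2A and δ/2.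
  obtain ⟨C₀, h₀⟩ := exists_enorm_ballAvg_sub_le_chain n 𝕜 (A := 2 * A) (δ := δ / 2)
    (by positivity) (by positivity)
  obtain ⟨C₁, hC₁, h₁⟩ := exists_gaussMeasure_ball_le n (A := 2 * A * (1 + 2 * A)) (t := 2 / δ)
    (by positivity) (by positivity)
  refine ⟨C₁ * 2 ^ (s - 1) * (C₁ * C₁ + C₀ ^ s * C₁),
    fun b hb hbm ε D hε hδε hosc₁ hosc x ρ hρ hρA => ?_⟩
  set V := gaussMeasure n (ball x ρ) with hV
  have hV0 : V ≠ 0 := (gaussMeasure_ball_pos x hρ).ne'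
  have hVt : V ≠ ∞ := measure_ne_top _ _
  have hs0 : 0 ≤ s := by linarith
  have hmx := admScale_pos x
  have hδρ : δ * ρ ≤ ρ := mul_le_of_le_one_left hρ.le hδ1
  have hgeom : ∀ z, dist x z ≤ 2 * ρ → admScale x ≤ (1 + 2 * A) * admScale z := fun z hz =>
    admScale_le_mul_of_dist_le (by positivity) (by linarith)
  have hAA : A * admScale x ≤ 2 * A * (1 + 2 * A) * admScale x := by
    gcongr; nlinarith
  have hVz : ∀ z, dist x z ≤ 2 * ρ → gaussMeasure n (ball z (δ * ρ)) ≤ C₁ * V := by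
    intro z hz
    have h1 : 2 * ρ ≤ 2 * A * (1 + 2 * A) * admScale z := by
      calc 2 * ρ ≤ 2 * (A * ((1 + 2 * A) * admScale z)) := by
            gcongr; exact hρA.trans (by gcongr; exact hgeom z hz)
        _ = _ := by ring
    refine h₁ z x _ _ (by rw [dist_comm]; linarith) (by linarith) hρ (hρA.trans hAA) ?_
    rw [div_mul_eq_mul_div, le_div_iff₀ hδ]
    nlinarith
  have hyV : ∀ y ∈ ball x ρ, V ≤ C₁ * gaussMeasure n (ball y (δ * ρ)) := by
    intro y hy
    have hy' : dist x y ≤ ρ := by rw [dist_comm]; exact (mem_ball.1 hy).le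
    have h1 : ρ ≤ 2 * A * (1 + 2 * A) * admScale y := by
      calc ρ ≤ A * ((1 + 2 * A) * admScale y) := by
            exact hρA.trans (by gcongr; exact hgeom y (by linarith))
        _ ≤ 2 * (A * ((1 + 2 * A) * admScale y)) := by
            have := admScale_pos y
            linarith [show 0 ≤ A * ((1 + 2 * A) * admScale y) by positivity]
        _ = _ := by ring
    refine h₁ x y _ _ (by linarith) (hρA.trans hAA) (by positivity) (by linarith) ?_
    field_simp
    linarith
  have hV2 : gaussMeasure n (ball x (2 * ρ)) ≤ C₁ * V := by
    refine h₁ x x _ _ (by simp; positivity) ?_ hρ (hρA.trans hAA) ?_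
    · calc 2 * ρ ≤ 2 * (A * admScale x) := by gcongr
        _ = 2 * A * 1 * admScale x := by ring
        _ ≤ _ := by gcongr; linarith
    · rw [div_mul_eq_mul_div, le_div_iff₀ hδ]
      nlinarith
  set F : EuclideanSpace ℝ (Fin n) → EuclideanSpace ℝ (Fin n) → ℝ≥0∞ :=
    fun y z => ‖b y - ballAvg b z (δ * ρ)‖ₑ ^ s with hF
  have hFm : Measurable (Function.uncurry F) := by
    have h1 : Measurable fun p : EuclideanSpace ℝ (Fin n) × EuclideanSpace ℝ (Fin n) =>
        ballAvg b p.2 (δ * ρ) := (measurable_ballAvg hbm _).comp measurable_snd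
    have h2 : Measurable fun p : EuclideanSpace ℝ (Fin n) × EuclideanSpace ℝ (Fin n) =>
        b p.1 := hbm.measurable.comp measurable_fst
    exact (h2.sub h1).enorm.pow_const s
  -- Instead of covering B(x, ρ) by small balls, b(y) is compared with the averages over B(z, δρ)
  -- and the result is averaged over z in B(y, δρ). The chain bound pays for replacing the centre x
  -- by z.
  have hpt : ∀ y ∈ ball x ρ, ‖b y - ballAvg b x (δ * ρ)‖ₑ ^ s * V ≤
      C₁ * 2 ^ (s - 1) * ((∫⁻ z in ball y (δ * ρ), F y z ∂(gaussMeasure n)) +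
        (C₀ * D) ^ s * (C₁ * V)) := by
    intro y hy
    have hy' : dist x y ≤ ρ := by rw [dist_comm]; exact (mem_ball.1 hy).le
    calc ‖b y - ballAvg b x (δ * ρ)‖ₑ ^ s * V
        ≤ ‖b y - ballAvg b x (δ * ρ)‖ₑ ^ s * (C₁ * gaussMeasure n (ball y (δ * ρ))) := by
          gcongr; exact hyV y hy
      _ = C₁ * ∫⁻ z in ball y (δ * ρ), ‖b y - ballAvg b x (δ * ρ)‖ₑ ^ s ∂(gaussMeasure n) := by
          rw [setLIntegral_const]; ring
      _ ≤ C₁ * ∫⁻ z in ball y (δ * ρ), 2 ^ (s - 1) * (F y z + (C₀ * D) ^ s) ∂(gaussMeasure n) := by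
          gcongr C₁ * ?_
          refine setLIntegral_mono' measurableSet_ball fun z hz => ?_
          have hxz : dist x z ≤ 2 * ρ := by
            have := (mem_ball.1 hz).le
            rw [dist_comm] at this
            linarith [dist_triangle x y z]
          have hch := h₀ b hb ε D hε (by linarith) hosc₁ x z (2 * ρ) (by positivity) (by linarith)
            hxz
          rw [show δ / 2 * (2 * ρ) = δ * ρ by ring] at hch
          calc ‖b y - ballAvg b x (δ * ρ)‖ₑ ^ s
              = ‖(b y - ballAvg b z (δ * ρ)) - (ballAvg b x (δ * ρ) - ballAvg b z (δ * ρ))‖ₑ ^ s := by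
                congr 2; ring
            _ ≤ (‖b y - ballAvg b z (δ * ρ)‖ₑ +
                  ‖ballAvg b x (δ * ρ) - ballAvg b z (δ * ρ)‖ₑ) ^ s := by
                gcongr; exact enorm_sub_le
            _ ≤ _ := ENNReal.rpow_add_le_mul_rpow_add_rpow _ _ hs
            _ ≤ _ := by gcongr
      _ = C₁ * 2 ^ (s - 1) * ((∫⁻ z in ball y (δ * ρ), F y z ∂(gaussMeasure n)) +
          (C₀ * D) ^ s * gaussMeasure n (ball y (δ * ρ))) := by
          rw [lintegral_const_mul' _ _ (by finiteness), lintegral_add_right _ measurable_const,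
            setLIntegral_const]
          ring
      _ ≤ _ := by gcongr; exact hVz y (by linarith)
  -- After the exchange the inner integral is exactly the oscillation over B(z, δρ), a ball of 𝓑_ε.
  have hswap : ∫⁻ y in ball x ρ, ∫⁻ z in ball y (δ * ρ), F y z ∂(gaussMeasure n)
      ∂(gaussMeasure n) ≤ (D : ℝ≥0∞) ^ s * (C₁ * V) * (C₁ * V) := by
    calc _ ≤ ∫⁻ z in ball x (2 * ρ), ∫⁻ y in ball z (δ * ρ), F y z ∂(gaussMeasure n)
          ∂(gaussMeasure n) := by
          refine lintegral_ball_swap_le hFm measurableSet_ball measurableSet_ball ?_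
          intro y hy z hz
          have := mem_ball.1 hy
          rw [mem_ball]
          linarith [dist_triangle z y x]
      _ ≤ ∫⁻ z in ball x (2 * ρ), (D : ℝ≥0∞) ^ s * (C₁ * V) ∂(gaussMeasure n) := by
          refine setLIntegral_mono' measurableSet_ball fun z hz => ?_
          have hz' : dist x z ≤ 2 * ρ := by rw [dist_comm]; exact (mem_ball.1 hz).le
          refine (hosc z (δ * ρ) ⟨by positivity, ?_⟩).trans ?_
          · calc δ * ρ ≤ δ * (A * ((1 + 2 * A) * admScale z)) := by
                  gcongr; exact hρA.trans (by gcongr; exact hgeom z hz')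
              _ ≤ 2 * δ * A * (1 + 2 * A) * admScale z := by
                  have := admScale_pos z
                  linarith [show 0 ≤ δ * (A * ((1 + 2 * A) * admScale z)) by positivity]
              _ ≤ _ := by gcongr; exact (admScale_pos z).le
          · gcongr; exact hVz z hz'
      _ ≤ _ := by rw [setLIntegral_const]; gcongr
  rw [← ENNReal.mul_le_mul_iff_left hV0 hVt]
  calc (∫⁻ y in ball x ρ, ‖b y - ballAvg b x (δ * ρ)‖ₑ ^ s ∂(gaussMeasure n)) * V
      = ∫⁻ y in ball x ρ, ‖b y - ballAvg b x (δ * ρ)‖ₑ ^ s * V ∂(gaussMeasure n) := by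
        rw [lintegral_mul_const' _ _ hVt]
    _ ≤ ∫⁻ y in ball x ρ, C₁ * 2 ^ (s - 1) * ((∫⁻ z in ball y (δ * ρ), F y z ∂(gaussMeasure n)) +
        (C₀ * D) ^ s * (C₁ * V)) ∂(gaussMeasure n) :=
        setLIntegral_mono' measurableSet_ball hpt
    _ = C₁ * 2 ^ (s - 1) * ((∫⁻ y in ball x ρ, ∫⁻ z in ball y (δ * ρ), F y z ∂(gaussMeasure n)
          ∂(gaussMeasure n)) + (C₀ * D) ^ s * (C₁ * V) * V) := by
        rw [lintegral_const_mul' _ _ (by finiteness), lintegral_add_right _ measurable_const,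
          setLIntegral_const]
    _ ≤ C₁ * 2 ^ (s - 1) * ((D : ℝ≥0∞) ^ s * (C₁ * V) * (C₁ * V) +
          (C₀ * D) ^ s * (C₁ * V) * V) := by gcongr
    _ = _ := by
        rw [ENNReal.mul_rpow_of_nonneg _ _ hs0]
        push_cast
        rw [ENNReal.coe_rpow_of_nonneg _ hs0, ENNReal.coe_rpow_of_ne_zero two_ne_zero]
        push_cast
        ring

end GaussBMO

namespace GaussBMO

open Metric

variable {n : ℕ} {𝕜 : Type*} [RCLike 𝕜]

/-! ### Covering arguments and the John–Nirenberg inequality -/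

/-- Vitali's covering lemma. Disjoint nonempty open sets in a separable space are countable in
number. -/
lemma exists_countable_disjoint_ball_cover (S : Set (EuclideanSpace ℝ (Fin n)))
    (r : EuclideanSpace ℝ (Fin n) → ℝ) (R : ℝ) (hr : ∀ x ∈ S, 0 < r x) (hR : ∀ x ∈ S, r x ≤ R) :
    ∃ u ⊆ S, u.Countable ∧ u.PairwiseDisjoint (fun x => ball x (r x)) ∧
      S ⊆ ⋃ x ∈ u, ball x (4 * r x) := by
  obtain ⟨u, huS, hd, hc⟩ := Vitali.exists_disjoint_subfamily_covering_enlargement_ball S id r R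
    hR 4 (by norm_num)
  refine ⟨u, huS, hd.countable_of_isOpen (fun _ _ => isOpen_ball)
    (fun x hx => nonempty_ball.2 (hr x (huS hx))), hd, fun x hx => ?_⟩
  obtain ⟨y, hy, hxy⟩ := hc x hx
  exact Set.mem_biUnion hy (hxy (mem_ball_self (hr x hx)))

lemma closedBall_ae_eq_ball (x : EuclideanSpace ℝ (Fin n)) {r : ℝ} (hr : r ≠ 0) :
    closedBall x r =ᵐ[gaussMeasure n] ball x r := by
  rw [← ball_union_sphere]
  refine union_ae_eq_left_of_ae_eq_empty (ae_eq_empty.2 ?_)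
  exact gaussMeasure_absolutelyContinuous (Measure.addHaar_sphere_of_ne_zero _ x hr)

/-- Lebesgue differentiation along the radii `2⁻ⁱ R`. -/
lemma ae_exists_mul_lt_lintegral_ball {h : EuclideanSpace ℝ (Fin n) → ℝ≥0∞} (hm : Measurable h)
    (hfin : ∫⁻ y, h y ∂(gaussMeasure n) ≠ ∞) {R : ℝ} (hR : 0 < R) :
    ∀ᵐ y ∂(gaussMeasure n), ∀ t < h y, ∃ i : ℕ,
      t * gaussMeasure n (ball y (R * (1 / 2) ^ i)) <
        ∫⁻ z in ball y (R * (1 / 2) ^ i), h z ∂(gaussMeasure n) := by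
  filter_upwards [(Besicovitch.vitaliFamily (gaussMeasure n)).ae_tendsto_lintegral_div
    hm.aemeasurable hfin] with y hy t ht
  have h1 := hy.comp (Besicovitch.tendsto_filterAt (gaussMeasure n) y)
  have h2 : Filter.Tendsto (fun i : ℕ => R * (1 / 2 : ℝ) ^ i) Filter.atTop
      (nhdsWithin 0 (Set.Ioi 0)) := by
    refine tendsto_nhdsWithin_iff.2 ⟨?_, Filter.Eventually.of_forall fun i => ?_⟩
    · simpa using (tendsto_pow_atTop_nhds_zero_of_lt_one (r := (1 / 2 : ℝ)) (by norm_num)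
        (by norm_num)).const_mul R
    · rw [Set.mem_Ioi]; positivity
  obtain ⟨i, hi⟩ := ((h1.comp h2).eventually_const_lt ht).exists
  refine ⟨i, ?_⟩
  have hpos : 0 < R * (1 / 2 : ℝ) ^ i := by positivity
  simp only [Function.comp] at hi
  rw [setLIntegral_congr (closedBall_ae_eq_ball y hpos.ne'),
    measure_congr (closedBall_ae_eq_ball y hpos.ne')] at hi
  exact (ENNReal.lt_div_iff_mul_lt (Or.inl (gaussMeasure_ball_pos y hpos).ne')
    (Or.inl (measure_ne_top _ _))).1 hi

/-- The John–Nirenberg inequality at the admissible scale. -/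
theorem exists_johnNirenberg (n : ℕ) (𝕜 : Type*) [RCLike 𝕜] : ∃ L : ℝ≥0, 0 < L ∧
    ∀ (b : EuclideanSpace ℝ (Fin n) → 𝕜), Integrable b (gaussMeasure n) → StronglyMeasurable b →
    ∀ D : ℝ≥0, 0 < D → OscBound b 1 1 D →
    ∀ (j : ℕ) (c : EuclideanSpace ℝ (Fin n)) (R : ℝ), IsAdmissible (1 / 2) c R →
      gaussMeasure n {y | y ∈ ball c R ∧ j * (L * D : ℝ≥0∞) < ‖b y - ballAvg b c R‖ₑ} ≤
        (1 / 2) ^ j * gaussMeasure n (ball c R) := by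
  obtain ⟨K, hK, hKball⟩ := exists_gaussMeasure_ball_le n (A := 2) (t := 16) zero_le_two
    (by norm_num)
  -- The first summand makes the selected balls small enough to gain the factor 1/2. The second
  -- rules out stopping at radii comparable to R.
  set L : ℝ≥0 := 2 * K * ((1 + K) * K) + K * ((1 + K) * K) with hL
  have hL0 : 0 < L := by positivity
  refine ⟨L, hL0, fun b hb hbm D hD hosc j => ?_⟩
  induction j with
  | zero =>
    intro c R _
    simp only [pow_zero, one_mul]
    exact measure_mono fun y hy => hy.1
  | succ j ih =>
    intro c R hcR
    set l : ℝ≥0∞ := L * D with hl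
    have hl0 : l ≠ 0 := by simp [hl, hL0.ne', hD.ne']
    have hlt : l ≠ ∞ := by finiteness
    set h : EuclideanSpace ℝ (Fin n) → ℝ≥0∞ := fun y => ‖b y - ballAvg b c R‖ₑ with hh
    have hR := hcR.1
    have hRm := hcR.2
    have hmc := admScale_pos c
    have hhm : Measurable h := (hbm.measurable.sub_const _).enorm
    have hgeom : ∀ y ∈ ball c R, admScale c ≤ (1 + 1) * admScale y := fun y hy =>
      admScale_le_mul_of_dist_le zero_le_one
        (by rw [dist_comm]; linarith [mem_ball.1 hy])
    -- The doubled ball contains every ball used below and is still in 𝓑₁; this is why the statement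
    -- is confined to 𝓑_{1/2}.
    have hG : gaussMeasure n (ball c (2 * R)) ≤ K * gaussMeasure n (ball c R) :=
      hKball c c _ _ (by simp; positivity) (by linarith) hR (by linarith) (by linarith)
    have havg : ‖ballAvg b c R - ballAvg b c (2 * R)‖ₑ ≤ K * D :=
      enorm_ballAvg_sub_le hb hosc ⟨by linarith, by linarith⟩ hR
        (ball_subset_ball (by linarith)) hG
    have hGint : ∫⁻ y in ball c (2 * R), h y ∂(gaussMeasure n) ≤
        ((1 + K) * K : ℝ≥0) * D * gaussMeasure n (ball c R) := by
      calc ∫⁻ y in ball c (2 * R), h y ∂(gaussMeasure n)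
          ≤ ∫⁻ y in ball c (2 * R), (‖b y - ballAvg b c (2 * R)‖ₑ + K * D) ∂(gaussMeasure n) := by
            refine lintegral_mono fun y => ?_
            calc h y = ‖(b y - ballAvg b c (2 * R)) -
                  (ballAvg b c R - ballAvg b c (2 * R))‖ₑ := by
                  simp only [hh]; congr 1; ring
              _ ≤ _ := enorm_sub_le
              _ ≤ _ := by gcongr
        _ = (∫⁻ y in ball c (2 * R), ‖b y - ballAvg b c (2 * R)‖ₑ ∂(gaussMeasure n)) +
              K * D * gaussMeasure n (ball c (2 * R)) := by
            rw [lintegral_add_right _ measurable_const, setLIntegral_const]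
        _ ≤ D * gaussMeasure n (ball c (2 * R)) + K * D * gaussMeasure n (ball c (2 * R)) := by
            gcongr
            simpa using hosc c (2 * R) ⟨by linarith, by linarith⟩
        _ = (1 + K) * D * gaussMeasure n (ball c (2 * R)) := by ring
        _ ≤ (1 + K) * D * (K * gaussMeasure n (ball c R)) := by gcongr
        _ = _ := by push_cast; ring
    set E : Set (EuclideanSpace ℝ (Fin n)) :=
      {y | y ∈ ball c R ∧ ((j + 1 : ℕ) : ℝ≥0∞) * l < h y} with hE
    have hleb := ae_exists_mul_lt_lintegral_ball (hhm.indicator (measurableSet_ball (x := c)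
      (ε := 2 * R))) (by
        rw [lintegral_indicator measurableSet_ball]
        exact (hGint.trans_lt (by finiteness)).ne) hR
    set good : Set (EuclideanSpace ℝ (Fin n)) := {y | y ∈ E ∧ ∃ i : ℕ,
      l * gaussMeasure n (ball y (R * (1 / 2) ^ i)) <
        ∫⁻ z in ball y (R * (1 / 2) ^ i), h z ∂(gaussMeasure n)} with hgood
    have hgoodE : E ≤ᵐ[gaussMeasure n] good := by
      filter_upwards [hleb] with y hy hyE
      have hyE' : y ∈ E := hyE
      have hyG : y ∈ ball c (2 * R) := ball_subset_ball (by linarith) hyE'.1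
      have hlh : l < h y := by
        refine lt_of_le_of_lt ?_ hyE'.2
        push_cast
        rw [add_mul, one_mul]; exact le_add_self
      obtain ⟨i, hi⟩ := hy l (by rwa [Set.indicator_of_mem hyG])
      refine ⟨hyE', i, ?_⟩
      refine hi.trans_le (lintegral_mono fun z => Set.indicator_le_self _ _ z)
    have hradius : ∀ y ∈ good, ∃ r : ℝ, 0 < r ∧ 4 * r ≤ R / 4 ∧
        l * gaussMeasure n (ball y r) ≤ ∫⁻ z in ball y r, h z ∂(gaussMeasure n) ∧
        ‖ballAvg b y (4 * r) - ballAvg b c R‖ₑ ≤ l := by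
      rintro y ⟨hyE, hex⟩
      have hyR := mem_ball.1 hyE.1
      classical
      -- Stopping time: the largest radius 2⁻ⁱR at which the mean of h exceeds l.
      set i := Nat.find hex with hi
      have hspec := Nat.find_spec hex
      rw [← hi] at hspec
      -- If i ≤ 3, the ball around y has measure comparable to that of B(c, R), and its mean of h is
      -- at most K(1 + K)K·D ≤ l.
      have hi4 : 4 ≤ i := by
        by_contra! hlt4
        have hpow : (1 / 8 : ℝ) ≤ (1 / 2) ^ i := by
          calc (1 / 8 : ℝ) = (1 / 2) ^ 3 := by norm_num
            _ ≤ _ := pow_le_pow_of_le_one (by norm_num) (by norm_num) (by omega)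
        have hpow1 : (1 / 2 : ℝ) ^ i ≤ 1 := pow_le_one₀ (by norm_num) (by norm_num)
        have hρ1 : R * (1 / 2 : ℝ) ^ i ≤ R := mul_le_of_le_one_right hR.le hpow1
        have hρ8 : R ≤ 8 * (R * (1 / 2 : ℝ) ^ i) := by nlinarith
        have hmy := hgeom y hyE.1
        have hmy' := admScale_pos y
        have hBy : gaussMeasure n (ball c R) ≤ K * gaussMeasure n (ball y (R * (1 / 2) ^ i)) :=
          hKball c y _ _ (by rw [dist_comm]; linarith) (by linarith) (by positivity)
            (by linarith) (by linarith)
        refine absurd hspec (not_lt.2 ?_)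
        calc ∫⁻ z in ball y (R * (1 / 2) ^ i), h z ∂(gaussMeasure n)
            ≤ ∫⁻ z in ball c (2 * R), h z ∂(gaussMeasure n) :=
              lintegral_mono_set (ball_subset_ball' (by linarith))
          _ ≤ _ := hGint
          _ ≤ ((1 + K) * K : ℝ≥0) * D * (K * gaussMeasure n (ball y (R * (1 / 2) ^ i))) := by
              gcongr
          _ = ((K * ((1 + K) * K) : ℝ≥0) : ℝ≥0∞) * D *
                gaussMeasure n (ball y (R * (1 / 2) ^ i)) := by push_cast; ring
          _ ≤ _ := by
              rw [hl]; gcongr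
              rw [hL]; exact le_add_self
      -- Two steps before stopping the radius is four times larger, which is the Vitali enlargement,
      -- and there the mean of h is still at most l.
      have hmin := Nat.find_min hex (m := i - 2) (by omega)
      have hscale : R * (1 / 2 : ℝ) ^ (i - 2) = 4 * (R * (1 / 2) ^ i) := by
        obtain ⟨k, hk⟩ : ∃ k, i = k + 2 := ⟨i - 2, by omega⟩
        rw [hk, Nat.add_sub_cancel, pow_add]; ring
      rw [hscale, not_lt] at hmin
      refine ⟨R * (1 / 2) ^ i, by positivity, ?_, hspec.le, ?_⟩
      · have : (1 / 2 : ℝ) ^ i ≤ (1 / 2) ^ 4 :=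
          pow_le_pow_of_le_one (by norm_num) (by norm_num) hi4
        nlinarith
      · have hpos := gaussMeasure_ball_pos y (show 0 < 4 * (R * (1 / 2 : ℝ) ^ i) by positivity)
        rw [← ENNReal.mul_le_mul_iff_left hpos.ne' (measure_ne_top _ _)]
        exact (enorm_ballAvg_sub_mul_le hb y _ _).trans hmin
    choose! r hr0 hr4 hrint hravg using hradius
    obtain ⟨u, hug, huc, hud, hucov⟩ := exists_countable_disjoint_ball_cover good r R hr0
      (fun y hy => by linarith [hr4 y hy, hr0 y hy])
    -- Replacing the average over B(c, R) by the one over B(x, 4r x) lowers the level by l, so the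
    -- induction hypothesis for j applies on each enlarged ball.
    have hcover : good ⊆ ⋃ x ∈ u, {y | y ∈ ball x (4 * r x) ∧
        j * l < ‖b y - ballAvg b x (4 * r x)‖ₑ} := by
      intro y hy
      obtain ⟨x, hx, hyx⟩ := Set.mem_iUnion₂.1 (hucov hy)
      refine Set.mem_biUnion hx ⟨hyx, ?_⟩
      have h1 : ((j + 1 : ℕ) : ℝ≥0∞) * l < h y := hy.1.2
      have h2 : h y ≤ ‖b y - ballAvg b x (4 * r x)‖ₑ + l := by
        calc h y = ‖(b y - ballAvg b x (4 * r x)) + (ballAvg b x (4 * r x) - ballAvg b c R)‖ₑ := by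
              simp only [hh]; congr 1; ring
          _ ≤ _ := enorm_add_le _ _
          _ ≤ _ := by gcongr; exact hravg x (hug hx)
      have h3 := h1.trans_le h2
      push_cast at h3
      rw [add_mul, one_mul] at h3
      exact (ENNReal.add_lt_add_iff_right hlt).1 h3
    have hadm : ∀ x ∈ u, IsAdmissible (1 / 2) x (4 * r x) ∧
        gaussMeasure n (ball x (4 * r x)) ≤ K * gaussMeasure n (ball x (r x)) := by
      intro x hx
      have h1 := hr0 x (hug hx)
      have h2 := hr4 x (hug hx)
      have h3 := hgeom x (hug hx).1.1
      have h4 := admScale_pos x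
      exact ⟨⟨by linarith, by linarith⟩, hKball x x _ _ (by simp; positivity) (by linarith) h1
        (by linarith) (by linarith)⟩
    -- Chebyshev over the disjoint unenlarged balls: on each of them the mean of h is at least l.
    have hsum : l * ∑' x : u, gaussMeasure n (ball (x : EuclideanSpace ℝ (Fin n)) (r x)) ≤
        ((1 + K) * K : ℝ≥0) * D * gaussMeasure n (ball c R) := by
      rw [← ENNReal.tsum_mul_left]
      calc _ ≤ ∑' x : u, ∫⁻ z in ball (x : EuclideanSpace ℝ (Fin n)) (r x), h z
            ∂(gaussMeasure n) := ENNReal.tsum_le_tsum fun x => hrint x (hug x.2)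
        _ = ∫⁻ z in ⋃ x ∈ u, ball x (r x), h z ∂(gaussMeasure n) :=
            (lintegral_biUnion huc (fun _ _ => measurableSet_ball) hud _).symm
        _ ≤ ∫⁻ z in ball c (2 * R), h z ∂(gaussMeasure n) := by
            refine lintegral_mono_set (Set.iUnion₂_subset fun x hx => ball_subset_ball' ?_)
            have := mem_ball.1 (hug hx).1.1
            linarith [hr4 x (hug hx), hr0 x (hug hx)]
        _ ≤ _ := hGint
    have hfinal : gaussMeasure n E ≤ (1 / 2) ^ j * K *
        ∑' x : u, gaussMeasure n (ball (x : EuclideanSpace ℝ (Fin n)) (r x)) := by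
      calc gaussMeasure n E ≤ gaussMeasure n (⋃ x ∈ u, {y | y ∈ ball x (4 * r x) ∧
            j * l < ‖b y - ballAvg b x (4 * r x)‖ₑ}) :=
            (measure_mono_ae hgoodE).trans (measure_mono hcover)
        _ ≤ ∑' x : u, gaussMeasure n {y | y ∈ ball (x : EuclideanSpace ℝ (Fin n)) (4 * r x) ∧
            j * l < ‖b y - ballAvg b x (4 * r x)‖ₑ} := measure_biUnion_le _ huc _
        _ ≤ ∑' x : u, (1 / 2) ^ j * K * gaussMeasure n
              (ball (x : EuclideanSpace ℝ (Fin n)) (r x)) := by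
            refine ENNReal.tsum_le_tsum fun x => ?_
            refine (ih _ _ (hadm x x.2).1).trans ?_
            rw [mul_assoc]
            gcongr
            exact (hadm x x.2).2
        _ = _ := ENNReal.tsum_mul_left
    rw [← ENNReal.mul_le_mul_iff_right hl0 hlt]
    calc l * gaussMeasure n E ≤ l * ((1 / 2) ^ j * K *
        ∑' x : u, gaussMeasure n (ball (x : EuclideanSpace ℝ (Fin n)) (r x))) := by gcongr
      _ = (1 / 2) ^ j * K *
        (l * ∑' x : u, gaussMeasure n (ball (x : EuclideanSpace ℝ (Fin n)) (r x))) := by ring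
      _ ≤ (1 / 2) ^ j * K * (((1 + K) * K : ℝ≥0) * D * gaussMeasure n (ball c R)) := by gcongr
      _ = (1 / 2) ^ j * (1 / 2) * (2 * ((K * ((1 + K) * K) : ℝ≥0) * D)) *
            gaussMeasure n (ball c R) := by
          have : (1 / 2 : ℝ≥0∞) * 2 = 1 := by
            rw [one_div]; exact ENNReal.inv_mul_cancel two_ne_zero (by finiteness)
          symm
          calc _ = (1 / 2) ^ j * (1 / 2 * 2) * ((K * ((1 + K) * K) : ℝ≥0) * D) *
                gaussMeasure n (ball c R) := by
                generalize (1 / 2 : ℝ≥0∞) = e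
                ring
            _ = _ := by rw [this]; push_cast; ring
      _ ≤ (1 / 2) ^ j * (1 / 2) * l * gaussMeasure n (ball c R) := by
          gcongr
          rw [hl, ← mul_assoc]
          gcongr
          rw [show (2 : ℝ≥0∞) = ((2 : ℝ≥0) : ℝ≥0∞) by rfl, ← ENNReal.coe_mul, hL]
          gcongr
          rw [← mul_assoc]
          exact le_self_add
      _ = _ := by rw [pow_succ]; ring

/-! ### From exponential decay of level sets to power means of the oscillation -/

lemma tsum_succ_rpow_mul_half_pow_ne_top {s : ℝ} :
    ∑' j : ℕ, ((j : ℝ≥0∞) + 1) ^ s * (1 / 2) ^ j ≠ ∞ := by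
  set k := ⌈s⌉₊
  have hsum : Summable fun j : ℕ => ((j : ℝ) + 1) ^ k * (1 / 2) ^ j := by
    have h := summable_pow_mul_geometric_of_norm_lt_one (R := ℝ) k (r := 1 / 2) (by norm_num)
    have h2 := ((summable_nat_add_iff 1).2 h).mul_left 2
    refine h2.congr fun j => ?_
    push_cast
    rw [pow_succ]; ring
  refine ne_top_of_le_ne_top hsum.tsum_ofReal_ne_top (ENNReal.tsum_le_tsum fun j => ?_)
  have e1 : ((j : ℝ≥0∞) + 1) = ENNReal.ofReal ((j : ℝ) + 1) := by
    rw [ENNReal.ofReal_add (by positivity) zero_le_one]; simp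
  have e2 : (1 / 2 : ℝ≥0∞) = ENNReal.ofReal (1 / 2) := by
    rw [ENNReal.ofReal_div_of_pos (by norm_num)]; simp
  rw [ENNReal.ofReal_mul (by positivity), ENNReal.ofReal_pow (by positivity),
    ENNReal.ofReal_pow (by positivity), ← e1, ← e2]
  gcongr
  rw [← ENNReal.rpow_natCast]
  exact ENNReal.rpow_le_rpow_of_exponent_le le_add_self (Nat.le_ceil s)

/-- A discrete layer-cake bound: the single term with j·l < t ≤ (j + 1)·l already suffices. -/
lemma rpow_le_tsum_indicator {t l : ℝ≥0∞} (ht : t ≠ ∞) (hl0 : l ≠ 0) (hl : l ≠ ∞) {s : ℝ}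
    (hs : 0 < s) :
    t ^ s ≤ ∑' j : ℕ, (if j * l < t then (((j : ℝ≥0∞) + 1) * l) ^ s else 0) := by
  rcases eq_or_ne t 0 with rfl | h0
  · simp [hs]
  have hex : ∃ j : ℕ, t ≤ j * l := by
    obtain ⟨j, hj⟩ := ENNReal.exists_nat_gt (ENNReal.div_ne_top ht hl0)
    exact ⟨j, (ENNReal.div_le_iff hl0 hl).1 hj.le⟩
  classical
  have h1 := Nat.find_spec hex
  have hpos : Nat.find hex ≠ 0 := by
    intro h; rw [h] at h1; simp at h1; exact h0 h1
  obtain ⟨k, hk⟩ := Nat.exists_eq_succ_of_ne_zero hpos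
  have h2 := Nat.find_min hex (m := k) (by omega)
  rw [not_le] at h2
  refine le_trans ?_ (ENNReal.le_tsum k)
  rw [if_pos h2]
  gcongr
  rw [hk] at h1
  exact_mod_cast h1

/-- Self-improvement of mean oscillation bounds. -/
theorem exists_oscBound_rpow (n : ℕ) (𝕜 : Type*) [RCLike 𝕜] {s : ℝ} (hs : 1 ≤ s) : ∃ C : ℝ≥0,
    0 < C ∧
    ∀ (b : EuclideanSpace ℝ (Fin n) → 𝕜), Integrable b (gaussMeasure n) → StronglyMeasurable b →
    ∀ D : ℝ≥0, 0 < D → OscBound b 1 1 D → OscBound b s (1 / 2) (C * D) := by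
  obtain ⟨L, hL, h⟩ := exists_johnNirenberg n 𝕜
  set S := ∑' j : ℕ, ((j : ℝ≥0∞) + 1) ^ s * (1 / 2) ^ j with hS
  have hSt : S ≠ ∞ := tsum_succ_rpow_mul_half_pow_ne_top
  have hs0 : 0 < s := by linarith
  refine ⟨L * (S.toNNReal + 1) ^ (1 / s), by positivity, fun b hb hbm D hD hosc c R hcR => ?_⟩
  have hl0 : (L * D : ℝ≥0∞) ≠ 0 := by simp [hL.ne', hD.ne']
  have hlt : (L * D : ℝ≥0∞) ≠ ∞ := by finiteness
  have hm : Measurable fun y => ‖b y - ballAvg b c R‖ₑ := (hbm.measurable.sub_const _).enorm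
  calc ∫⁻ y in ball c R, ‖b y - ballAvg b c R‖ₑ ^ s ∂(gaussMeasure n)
      ≤ ∫⁻ y in ball c R, ∑' j : ℕ, (if j * (L * D : ℝ≥0∞) < ‖b y - ballAvg b c R‖ₑ then
          (((j : ℝ≥0∞) + 1) * (L * D)) ^ s else 0) ∂(gaussMeasure n) :=
        lintegral_mono fun y => rpow_le_tsum_indicator (by finiteness) hl0 hlt hs0
    _ = ∑' j : ℕ, ∫⁻ y in ball c R, (if j * (L * D : ℝ≥0∞) < ‖b y - ballAvg b c R‖ₑ then
          (((j : ℝ≥0∞) + 1) * (L * D)) ^ s else 0) ∂(gaussMeasure n) := by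
        refine lintegral_tsum fun j => (Measurable.ite ?_ measurable_const
          measurable_const).aemeasurable
        exact measurableSet_lt measurable_const hm
    _ ≤ ∑' j : ℕ, (((j : ℝ≥0∞) + 1) * (L * D)) ^ s *
          ((1 / 2) ^ j * gaussMeasure n (ball c R)) := by
        refine ENNReal.tsum_le_tsum fun j => ?_
        have hms : MeasurableSet {y | j * (L * D : ℝ≥0∞) < ‖b y - ballAvg b c R‖ₑ} :=
          measurableSet_lt measurable_const hm
        have := lintegral_indicator_const (μ := (gaussMeasure n).restrict (ball c R)) hms
          ((((j : ℝ≥0∞) + 1) * (L * D)) ^ s)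
        rw [Measure.restrict_apply hms] at this
        refine (lintegral_congr fun y => ?_).trans_le (this.trans_le ?_)
        · simp [Set.indicator]
        gcongr
        refine le_trans (measure_mono ?_) (h b hb hbm D hD hosc j c R hcR)
        exact fun y hy => ⟨hy.2, hy.1⟩
    _ = S * (L * D) ^ s * gaussMeasure n (ball c R) := by
        rw [hS, ← ENNReal.tsum_mul_right, ← ENNReal.tsum_mul_right]
        refine tsum_congr fun j => ?_
        rw [ENNReal.mul_rpow_of_nonneg _ _ hs0.le]; ring
    _ ≤ ((S.toNNReal + 1 : ℝ≥0) : ℝ≥0∞) * (L * D) ^ s * gaussMeasure n (ball c R) := by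
        gcongr
        rw [ENNReal.coe_add, ENNReal.coe_toNNReal hSt]; exact le_self_add
    _ = _ := by
        congr 1
        rw [← ENNReal.coe_mul, ← ENNReal.coe_rpow_of_nonneg _ hs0.le,
          ← ENNReal.coe_rpow_of_nonneg _ hs0.le, ← ENNReal.coe_mul]
        congr 1
        rw [NNReal.mul_rpow, NNReal.mul_rpow, NNReal.mul_rpow, ← NNReal.rpow_mul,
          one_div_mul_cancel hs0.ne', NNReal.rpow_one]
        ring

end GaussBMO

namespace GaussBMO

open Metric

variable {n : ℕ} {𝕜 : Type*} [RCLike 𝕜]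

/-! ### Geometric sums over dyadic scales -/

lemma two_rpow_add (x y : ℝ) : (2 : ℝ≥0∞) ^ (x + y) = 2 ^ x * 2 ^ y :=
  ENNReal.rpow_add _ _ two_ne_zero (by finiteness)

lemma two_rpow_ne_zero (x : ℝ) : (2 : ℝ≥0∞) ^ x ≠ 0 := by simp

lemma two_rpow_ne_top (x : ℝ) : (2 : ℝ≥0∞) ^ x ≠ ∞ := by simp

lemma two_rpow_le {x y : ℝ} (h : x ≤ y) : (2 : ℝ≥0∞) ^ x ≤ 2 ^ y :=
  ENNReal.rpow_le_rpow_of_exponent_le one_le_two h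

lemma exists_eq_two_rpow {x : ℝ≥0∞} (h0 : x ≠ 0) (ht : x ≠ ∞) : ∃ t : ℝ, x = 2 ^ t := by
  refine ⟨Real.logb 2 x.toReal, ?_⟩
  have hx : 0 < x.toReal := ENNReal.toReal_pos h0 ht
  have h := Real.rpow_logb (b := 2) two_pos (by norm_num) hx
  calc x = ENNReal.ofReal x.toReal := (ENNReal.ofReal_toReal ht).symm
    _ = ENNReal.ofReal (2 ^ Real.logb 2 x.toReal) := by rw [h]
    _ = _ := by rw [← ENNReal.ofReal_rpow_of_pos two_pos]; simp

lemma tsum_int_two_rpow_ne_top {ε : ℝ} (hε : 0 < ε) :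
    ∑' i : ℤ, (2 : ℝ≥0∞) ^ (-(ε * |(i : ℝ)|)) ≠ ∞ := by
  have h1 : Summable fun k : ℕ => ((2 : ℝ) ^ (-ε)) ^ k :=
    summable_geometric_of_lt_one (by positivity)
      (Real.rpow_lt_one_of_one_lt_of_neg one_lt_two (by linarith))
  have h2 : Summable fun i : ℤ => (2 : ℝ) ^ (-(ε * |(i : ℝ)|)) := by
    refine Summable.of_nat_of_neg (h1.congr fun k => ?_) (h1.congr fun k => ?_)
    · rw [← Real.rpow_natCast, ← Real.rpow_mul two_pos.le]
      congr 1
      rw [Int.cast_natCast, abs_of_nonneg (by positivity)]; ring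
    · rw [← Real.rpow_natCast, ← Real.rpow_mul two_pos.le]
      congr 1
      rw [Int.cast_neg, abs_neg, Int.cast_natCast, abs_of_nonneg (by positivity)]; ring
  refine ne_top_of_le_ne_top h2.tsum_ofReal_ne_top (ENNReal.tsum_le_tsum fun i => le_of_eq ?_)
  rw [← ENNReal.ofReal_rpow_of_pos two_pos]; simp

/-- `∑ 2^{-ε|i|}` over the integers. -/
noncomputable def dyadicSum (ε : ℝ) : ℝ≥0∞ := ∑' i : ℤ, (2 : ℝ≥0∞) ^ (-(ε * |(i : ℝ)|))

lemma dyadicSum_ne_zero (ε : ℝ) : dyadicSum ε ≠ 0 := by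
  have := ENNReal.le_tsum (f := fun i : ℤ => (2 : ℝ≥0∞) ^ (-(ε * |(i : ℝ)|))) 0
  simp only [Int.cast_zero, abs_zero, mul_zero, neg_zero, ENNReal.rpow_zero] at this
  exact (zero_lt_one.trans_le this).ne'

lemma tsum_int_two_rpow_sub (ε : ℝ) (J : ℤ) :
    ∑' j : ℤ, (2 : ℝ≥0∞) ^ (-(ε * |(J : ℝ) - j|)) = dyadicSum ε := by
  rw [dyadicSum, ← (Equiv.subLeft J).tsum_eq]
  simp

/-- A geometric series is comparable to its largest term. It is used with ε = p - 1 in the maximal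
theorem, which is where p > 1 enters. -/
lemma tsum_two_rpow_lt_le {ε : ℝ} (hε : 0 < ε) (u : ℝ≥0∞) :
    ∑' j : ℤ, (if (2 : ℝ≥0∞) ^ (j : ℝ) < u then ((2 : ℝ≥0∞) ^ (j : ℝ)) ^ ε else 0) ≤
      dyadicSum ε * u ^ ε := by
  rcases eq_or_ne u 0 with rfl | h0
  · simp
  rcases eq_or_ne u ∞ with rfl | ht
  · rw [ENNReal.top_rpow_of_pos hε, ENNReal.mul_top (dyadicSum_ne_zero ε)]; exact le_top
  obtain ⟨J, hJ1, hJ2⟩ := ENNReal.exists_mem_Ioc_zpow h0 ht ENNReal.one_lt_two (by finiteness)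
  rw [← ENNReal.rpow_intCast] at hJ1 hJ2
  calc _ ≤ ∑' j : ℤ, (2 : ℝ≥0∞) ^ (-(ε * |(J : ℝ) - j|)) * ((2 : ℝ≥0∞) ^ (J : ℝ)) ^ ε := by
        refine ENNReal.tsum_le_tsum fun j => ?_
        split_ifs with hj
        · have hjJ : j ≤ J := by
            by_contra! hlt
            refine absurd (hj.trans_le hJ2) (not_lt.2 (two_rpow_le ?_))
            exact_mod_cast hlt
          have hjJ' : (j : ℝ) ≤ J := by exact_mod_cast hjJ
          rw [← ENNReal.rpow_mul, ← ENNReal.rpow_mul, ← two_rpow_add, abs_of_nonneg (by linarith)]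
          refine two_rpow_le (le_of_eq ?_); ring
        · exact zero_le
    _ = dyadicSum ε * ((2 : ℝ≥0∞) ^ (J : ℝ)) ^ ε := by
        rw [ENNReal.tsum_mul_right, tsum_int_two_rpow_sub]
    _ ≤ _ := by gcongr

/-- The dyadic level just below t suffices. For t = ∞ every level 2ᵏ with k ≥ 0 contributes at least
1, so the sum is infinite. -/
lemma rpow_le_tsum_two_rpow {p : ℝ} (hp : 0 < p) (t : ℝ≥0∞) :
    t ^ p ≤ ∑' j : ℤ, (if (2 : ℝ≥0∞) ^ (j : ℝ) < t then ((2 : ℝ≥0∞) ^ ((j : ℝ) + 1)) ^ p else 0) := by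
  rcases eq_or_ne t 0 with rfl | h0
  · simp [hp]
  rcases eq_or_ne t ∞ with rfl | ht
  · refine le_trans le_top ((ENNReal.tsum_const_eq_top_of_ne_zero (α := ℕ) one_ne_zero).ge.trans
      (le_trans ?_ (ENNReal.tsum_comp_le_tsum_of_injective (f := fun k : ℕ => (k : ℤ))
        Nat.cast_injective _)))
    refine ENNReal.tsum_le_tsum fun k => ?_
    rw [if_pos (two_rpow_ne_top _).lt_top, ← ENNReal.rpow_mul]
    refine ENNReal.one_le_rpow one_le_two (by positivity)
  obtain ⟨J, hJ1, hJ2⟩ := ENNReal.exists_mem_Ioc_zpow h0 ht ENNReal.one_lt_two (by finiteness)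
  rw [← ENNReal.rpow_intCast] at hJ1 hJ2
  refine le_trans ?_ (ENNReal.le_tsum J)
  rw [if_pos hJ1]
  push_cast at hJ2
  gcongr

/-- Hedberg's summation trick. -/
theorem exists_tsum_min_le {n : ℕ} (hn : 1 ≤ n) {β p q : ℝ} (hβ : 0 < β) (hp : 0 < p)
    (hpq : p < q) (h : 1 / q = 1 / p - β) : ∃ C : ℝ≥0, ∀ W M N : ℝ≥0∞, W ≠ 0 → W ≠ ∞ →
      ∑' k : ℕ, min ((W * 2 ^ (-(n * k : ℝ))) ^ β * M) ((W * 2 ^ (-(n * k : ℝ))) ^ (-(1 / q)) * N) ≤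
        C * (M ^ (p / q) * N ^ (1 - p / q)) := by
  have hq : 0 < q := hp.trans hpq
  -- The first entry of the minimum decays geometrically towards small scales and the second towards
  -- large ones; ε is the slower of the two rates.
  set ε := min β (1 / q) with hε
  have hε0 : 0 < ε := lt_min hβ (by positivity)
  have hS : 2 ^ ε * dyadicSum ε ≠ ∞ := ENNReal.mul_ne_top (two_rpow_ne_top _)
    (tsum_int_two_rpow_ne_top hε0)
  refine ⟨(2 ^ ε * dyadicSum ε).toNNReal, fun W M N hW0 hWt => ?_⟩
  rw [ENNReal.coe_toNNReal hS]
  have hS0 : 2 ^ ε * dyadicSum ε ≠ 0 := mul_ne_zero (two_rpow_ne_zero _) (dyadicSum_ne_zero _)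
  have hr1 : 0 < p / q := by positivity
  have hr2 : 0 < 1 - p / q := by rw [sub_pos, div_lt_one hq]; exact hpq
  rcases eq_or_ne M 0 with rfl | hM0
  · simp
  rcases eq_or_ne N 0 with rfl | hN0
  · simp
  rcases eq_or_ne M ∞ with rfl | hMt
  · rw [ENNReal.top_rpow_of_pos hr1, ENNReal.top_mul (by simp [hN0, hr2.not_gt, hr2]),
      ENNReal.mul_top hS0]
    exact le_top
  rcases eq_or_ne N ∞ with rfl | hNt
  · rw [ENNReal.top_rpow_of_pos hr2, ENNReal.mul_top (by simp [hM0, hr1.not_gt, hr1]),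
      ENNReal.mul_top hS0]
    exact le_top
  obtain ⟨w, rfl⟩ := exists_eq_two_rpow hW0 hWt
  obtain ⟨m, rfl⟩ := exists_eq_two_rpow hM0 hMt
  obtain ⟨v, rfl⟩ := exists_eq_two_rpow hN0 hNt
  have hn0 : (1 : ℝ) ≤ n := by exact_mod_cast hn
  have hpβ : p / q = 1 - p * β := by
    have : p / q = p * (1 / q) := by ring
    rw [this, h]; field_simp
  -- In base 2 logarithms, τ is the index at which the two entries agree: there the weight is
  -- (N/M)^p and the common value is M^{p/q} N^{1-p/q}.
  set τ : ℝ := (w - p * (v - m)) / n with hτ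
  have hterm : ∀ k : ℕ, min (((2 : ℝ≥0∞) ^ w * 2 ^ (-(n * k : ℝ))) ^ β * 2 ^ m)
      (((2 : ℝ≥0∞) ^ w * 2 ^ (-(n * k : ℝ))) ^ (-(1 / q)) * 2 ^ v) ≤
      2 ^ ε * 2 ^ (-(ε * |((⌊τ⌋ : ℤ) : ℝ) - ((k : ℤ) : ℝ)|)) *
        ((2 ^ m) ^ (p / q) * (2 ^ v) ^ (1 - p / q)) := by
    intro k
    rw [← two_rpow_add, ← ENNReal.rpow_mul, ← ENNReal.rpow_mul, ← ENNReal.rpow_mul,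
      ← ENNReal.rpow_mul, ← two_rpow_add, ← two_rpow_add, ← two_rpow_add, ← two_rpow_add,
      ← two_rpow_add]
    set d : ℝ := w - n * k - p * (v - m) with hd
    have hdabs : |d| ≥ |((⌊τ⌋ : ℤ) : ℝ) - ((k : ℤ) : ℝ)| - 1 := by
      have h1 : d = n * (τ - k) := by
        rw [hτ, hd]; field_simp; ring
      have h2 : |τ - k| ≤ |d| := by
        rw [h1, abs_mul, abs_of_nonneg (by linarith : (0 : ℝ) ≤ n)]
        exact le_mul_of_one_le_left (abs_nonneg _) hn0
      have h3 : |((⌊τ⌋ : ℤ) : ℝ) - τ| ≤ 1 := by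
        rw [abs_le]; constructor <;> linarith [Int.floor_le τ, Int.lt_floor_add_one τ]
      have h4 := abs_sub_le ((⌊τ⌋ : ℤ) : ℝ) τ ((k : ℤ) : ℝ)
      push_cast at h4 ⊢
      linarith
    have hεd : ε * |d| ≥ ε * (|((⌊τ⌋ : ℤ) : ℝ) - ((k : ℤ) : ℝ)| - 1) := by gcongr
    rcases le_or_gt d 0 with hd0 | hd0
    · refine (min_le_left _ _).trans (two_rpow_le ?_)
      have h1 : ε * |d| ≤ β * -d := by
        rw [abs_of_nonpos hd0]; gcongr
        · linarith
        · exact min_le_left _ _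
      have h2 : (w + -(n * k)) * β + m = m * (p / q) + v * (1 - p / q) + β * d := by
        rw [hpβ, hd]; ring
      linarith
    · refine (min_le_right _ _).trans (two_rpow_le ?_)
      have h1 : ε * |d| ≤ (1 / q) * d := by
        rw [abs_of_pos hd0]; gcongr
        exact min_le_right _ _
      have h2 : (w + -(n * k)) * -(1 / q) + v = m * (p / q) + v * (1 - p / q) - (1 / q) * d := by
        rw [hd]; field_simp; ring
      linarith
  calc _ ≤ ∑' k : ℕ, 2 ^ ε * 2 ^ (-(ε * |((⌊τ⌋ : ℤ) : ℝ) - ((k : ℤ) : ℝ)|)) *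
        (((2 : ℝ≥0∞) ^ m) ^ (p / q) * (2 ^ v) ^ (1 - p / q)) := ENNReal.tsum_le_tsum hterm
    _ = 2 ^ ε * (∑' k : ℕ, 2 ^ (-(ε * |((⌊τ⌋ : ℤ) : ℝ) - ((k : ℤ) : ℝ)|))) *
        (((2 : ℝ≥0∞) ^ m) ^ (p / q) * (2 ^ v) ^ (1 - p / q)) := by
        rw [ENNReal.tsum_mul_right, ENNReal.tsum_mul_left]
    _ ≤ _ := by
        gcongr
        rw [← tsum_int_two_rpow_sub ε ⌊τ⌋]
        exact ENNReal.tsum_comp_le_tsum_of_injective (f := fun k : ℕ => (k : ℤ))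
          Nat.cast_injective (fun j : ℤ => (2 : ℝ≥0∞) ^ (-(ε * |((⌊τ⌋ : ℤ) : ℝ) - (j : ℝ)|)))

/-! ### The local maximal function -/

/-- The local centred maximal function over the radii `2⁻ᵏ a < A m(x)`. -/
noncomputable def localMax (a A : ℝ) (f : EuclideanSpace ℝ (Fin n) → ℝ≥0∞)
    (x : EuclideanSpace ℝ (Fin n)) : ℝ≥0∞ :=
  ⨆ k : ℕ, if a * (1 / 2) ^ k < A * admScale x then
    (weight x (a * (1 / 2) ^ k))⁻¹ * ∫⁻ y in ball x (a * (1 / 2) ^ k), f y ∂(gaussMeasure n) else 0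

lemma measurable_lintegral_ball {F : EuclideanSpace ℝ (Fin n) → EuclideanSpace ℝ (Fin n) → ℝ≥0∞}
    (hF : Measurable (Function.uncurry F)) {r : EuclideanSpace ℝ (Fin n) → ℝ} (hr : Measurable r) :
    Measurable fun x => ∫⁻ y in ball x (r x), F x y ∂(gaussMeasure n) := by
  have hs : MeasurableSet {z : EuclideanSpace ℝ (Fin n) × EuclideanSpace ℝ (Fin n) |
      dist z.2 z.1 < r z.1} := measurableSet_lt (by fun_prop) (by fun_prop)
  have h := (hF.indicator hs).lintegral_prod_right' (ν := gaussMeasure n)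
  convert h using 2 with x
  rw [← lintegral_indicator measurableSet_ball]
  rfl

lemma measurable_localMax (a A : ℝ) {f : EuclideanSpace ℝ (Fin n) → ℝ≥0∞} (hf : Measurable f) :
    Measurable (localMax a A f) := by
  refine Measurable.iSup fun k => Measurable.ite ?_ ?_ measurable_const
  · exact measurableSet_lt measurable_const (measurable_admScale.const_mul A)
  · exact (measurable_weight _).inv.mul
      (measurable_lintegral_ball (F := fun _ y => f y) (hf.comp measurable_snd) measurable_const)

/-- The weak (1,1) bound by Vitali covering. The fourfold balls have radius up to 4A·m, hence
comparability is invoked with 4A. -/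
lemma exists_localMax_weak (n : ℕ) {a A : ℝ} (ha : 0 < a) (hA : 0 ≤ A) : ∃ C : ℝ≥0,
    ∀ (f : EuclideanSpace ℝ (Fin n) → ℝ≥0∞) (t : ℝ≥0∞),
      t * gaussMeasure n {x | t < localMax a A f x} ≤ C * ∫⁻ y, f y ∂(gaussMeasure n) := by
  obtain ⟨C, hC, h⟩ := exists_gaussMeasure_ball_comparable n (A := 4 * A) (by positivity)
  refine ⟨C * 4 ^ n, fun f t => ?_⟩
  set S := {x : EuclideanSpace ℝ (Fin n) | t < localMax a A f x} with hS
  have hr : ∀ x ∈ S, ∃ r : ℝ, 0 < r ∧ r ≤ a ∧ r ≤ A * admScale x ∧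
      t * weight x r ≤ ∫⁻ y in ball x r, f y ∂(gaussMeasure n) := by
    intro x hx
    obtain ⟨k, hk⟩ := lt_iSup_iff.1 (show t < localMax a A f x from hx)
    split_ifs at hk with hkA
    · have hpos : 0 < a * (1 / 2 : ℝ) ^ k := by positivity
      refine ⟨a * (1 / 2) ^ k, hpos, mul_le_of_le_one_right ha.le
        (pow_le_one₀ (by norm_num) (by norm_num)), hkA.le, ?_⟩
      rw [mul_comm, ← div_eq_mul_inv] at hk
      exact (ENNReal.mul_le_of_le_div hk.le)
    · exact absurd hk not_lt_zero
  choose! r hr0 hra hrA hrt using hr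
  obtain ⟨u, huS, huc, hud, hcov⟩ := exists_countable_disjoint_ball_cover S r a hr0 hra
  calc t * gaussMeasure n S ≤ t * ∑' x : u, gaussMeasure n
        (ball (x : EuclideanSpace ℝ (Fin n)) (4 * r x)) := by
        gcongr; exact (measure_mono hcov).trans (measure_biUnion_le _ huc _)
    _ ≤ t * ∑' x : u, C * 4 ^ n * weight (x : EuclideanSpace ℝ (Fin n)) (r x) := by
        gcongr with x
        have h0 := hr0 x (huS x.2)
        have hx := (h x (4 * r x) (by positivity) (by linarith [hrA x (huS x.2)])).1
        rw [weight_mul _ (by norm_num), ← mul_assoc] at hx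
        refine hx.trans (le_of_eq ?_)
        congr 2
        rw [ENNReal.ofReal_pow (by norm_num)]; simp
    _ = C * 4 ^ n * ∑' x : u, t * weight (x : EuclideanSpace ℝ (Fin n)) (r x) := by
        rw [ENNReal.tsum_mul_left, ENNReal.tsum_mul_left]; ring
    _ ≤ C * 4 ^ n * ∑' x : u, ∫⁻ y in ball (x : EuclideanSpace ℝ (Fin n)) (r x), f y
          ∂(gaussMeasure n) := by
        gcongr with x; exact hrt x (huS x.2)
    _ = C * 4 ^ n * ∫⁻ y in ⋃ x ∈ u, ball x (r x), f y ∂(gaussMeasure n) := by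
        rw [lintegral_biUnion huc (fun _ _ => measurableSet_ball) hud]
    _ ≤ C * 4 ^ n * ∫⁻ y, f y ∂(gaussMeasure n) := by
        gcongr; exact Measure.restrict_le_self
    _ = _ := by push_cast; ring

/-- The local maximal function is bounded on `L^p`, `p > 1`. -/
theorem exists_localMax_strong (n : ℕ) {a A p : ℝ} (ha : 0 < a) (hA : 0 ≤ A) (hp : 1 < p) :
    ∃ C : ℝ≥0, ∀ f : EuclideanSpace ℝ (Fin n) → ℝ≥0∞, Measurable f →
      ∫⁻ x, localMax a A f x ^ p ∂(gaussMeasure n) ≤ C * ∫⁻ x, f x ^ p ∂(gaussMeasure n) := by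
  obtain ⟨C₀, hC₀, h₀⟩ := exists_gaussMeasure_ball_comparable n hA
  obtain ⟨C₁, h₁⟩ := exists_localMax_weak n ha hA
  have hp1 : 0 < p - 1 := by linarith
  -- Chosen so that the part of f below c·t contributes at most t/2 to the maximal function.
  set c : ℝ≥0 := (2 * C₀)⁻¹ with hc
  have hc0 : 0 < c := by positivity
  set K : ℝ≥0∞ := 2 ^ p * (2 * C₁) * (dyadicSum (p - 1) * ((c : ℝ≥0∞)⁻¹) ^ (p - 1)) with hK
  have hKt : K ≠ ∞ := by
    have := tsum_int_two_rpow_ne_top hp1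
    refine ENNReal.mul_ne_top (by finiteness) (ENNReal.mul_ne_top this ?_)
    exact ENNReal.rpow_ne_top_of_nonneg hp1.le (by simp [hc0.ne'])
  refine ⟨K.toNNReal, fun f hf => ?_⟩
  rw [ENNReal.coe_toNNReal hKt]
  -- Marcinkiewicz truncation: only the part of f above c·t can push the maximal function past t,
  -- and the weak bound applies to it.
  have hcut : ∀ t : ℝ≥0∞, t ≠ ∞ → t * gaussMeasure n {x | t < localMax a A f x} ≤
      2 * C₁ * ∫⁻ y, {y | c * t < f y}.indicator f y ∂(gaussMeasure n) := by
    intro t ht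
    set g := {y | c * t < f y}.indicator f with hg
    have hgm : Measurable g := hf.indicator (measurableSet_lt measurable_const hf)
    have hfg : ∀ y, f y ≤ g y + c * t := by
      intro y
      by_cases hy : c * t < f y
      · rw [hg, Set.indicator_of_mem (by exact hy)]; exact le_self_add
      · exact (not_lt.1 hy).trans le_add_self
    have hsub : {x | t < localMax a A f x} ⊆ {x | t / 2 < localMax a A g x} := by
      intro x hx
      have hle : localMax a A f x ≤ localMax a A g x + t / 2 := by
        refine iSup_le fun k => ?_
        split_ifs with hk
        · have hpos : 0 < a * (1 / 2 : ℝ) ^ k := by positivity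
          set ρ := a * (1 / 2 : ℝ) ^ k
          have hw0 := (weight_pos x hpos).ne'
          have hwt := weight_ne_top x ρ
          calc (weight x ρ)⁻¹ * ∫⁻ y in ball x ρ, f y ∂(gaussMeasure n)
              ≤ (weight x ρ)⁻¹ * ∫⁻ y in ball x ρ, (g y + c * t) ∂(gaussMeasure n) := by
                gcongr with y; exact hfg y
            _ = (weight x ρ)⁻¹ * ∫⁻ y in ball x ρ, g y ∂(gaussMeasure n) +
                  (weight x ρ)⁻¹ * (c * t * gaussMeasure n (ball x ρ)) := by
                rw [lintegral_add_right _ measurable_const, setLIntegral_const, mul_add]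
            _ ≤ localMax a A g x + (weight x ρ)⁻¹ * (c * t * (C₀ * weight x ρ)) := by
                gcongr
                · refine le_iSup_of_le k ?_
                  rw [if_pos hk]
                · exact (h₀ x ρ hpos hk.le).1
            _ = localMax a A g x + (c * C₀ : ℝ≥0) * t * ((weight x ρ)⁻¹ * weight x ρ) := by
                push_cast; ring
            _ = _ := by
                rw [ENNReal.inv_mul_cancel hw0 hwt, mul_one]
                congr 1
                have : c * C₀ = 2⁻¹ := by rw [hc]; field_simp
                rw [this, ENNReal.coe_inv two_ne_zero, ENNReal.div_eq_inv_mul]; rfl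
        · exact zero_le
      have h2 : t / 2 + t / 2 < localMax a A g x + t / 2 := by
        rw [ENNReal.add_halves]; exact lt_of_lt_of_le hx hle
      exact (ENNReal.add_lt_add_iff_right (by finiteness)).1 h2
    calc t * gaussMeasure n {x | t < localMax a A f x}
        ≤ t * gaussMeasure n {x | t / 2 < localMax a A g x} := by gcongr
      _ = 2 * (t / 2 * gaussMeasure n {x | t / 2 < localMax a A g x}) := by
          rw [← mul_assoc, ENNReal.mul_div_cancel two_ne_zero (by finiteness)]
      _ ≤ 2 * (C₁ * ∫⁻ y, g y ∂(gaussMeasure n)) := by gcongr 2 * ?_; exact h₁ g _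
      _ = _ := by ring
  have hMm := measurable_localMax a A hf
  calc ∫⁻ x, localMax a A f x ^ p ∂(gaussMeasure n)
      ≤ ∫⁻ x, ∑' j : ℤ, (if (2 : ℝ≥0∞) ^ (j : ℝ) < localMax a A f x then
          ((2 : ℝ≥0∞) ^ ((j : ℝ) + 1)) ^ p else 0) ∂(gaussMeasure n) :=
        lintegral_mono fun x => rpow_le_tsum_two_rpow (by linarith) _
    _ = ∑' j : ℤ, ∫⁻ x, (if (2 : ℝ≥0∞) ^ (j : ℝ) < localMax a A f x then
          ((2 : ℝ≥0∞) ^ ((j : ℝ) + 1)) ^ p else 0) ∂(gaussMeasure n) := by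
        refine lintegral_tsum fun j => (Measurable.ite ?_ measurable_const
          measurable_const).aemeasurable
        exact measurableSet_lt measurable_const hMm
    _ = ∑' j : ℤ, 2 ^ p * ((2 : ℝ≥0∞) ^ (j : ℝ)) ^ (p - 1) * ((2 : ℝ≥0∞) ^ (j : ℝ) *
          gaussMeasure n {x | (2 : ℝ≥0∞) ^ (j : ℝ) < localMax a A f x}) := by
        refine tsum_congr fun j => ?_
        have hms : MeasurableSet {x | (2 : ℝ≥0∞) ^ (j : ℝ) < localMax a A f x} :=
          measurableSet_lt measurable_const hMm
        have := lintegral_indicator_const (μ := gaussMeasure n) hms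
          (((2 : ℝ≥0∞) ^ ((j : ℝ) + 1)) ^ p)
        rw [show ((2 : ℝ≥0∞) ^ ((j : ℝ) + 1)) ^ p = 2 ^ p * ((2 : ℝ≥0∞) ^ (j : ℝ)) ^ (p - 1) *
          (2 : ℝ≥0∞) ^ (j : ℝ) by
            rw [← ENNReal.rpow_mul, ← ENNReal.rpow_mul, ← two_rpow_add, ← two_rpow_add]
            congr 1; ring] at this ⊢
        rw [← mul_assoc, ← this]
        refine lintegral_congr fun x => ?_
        simp [Set.indicator]
    _ ≤ ∑' j : ℤ, 2 ^ p * ((2 : ℝ≥0∞) ^ (j : ℝ)) ^ (p - 1) * (2 * C₁ *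
          ∫⁻ y, {y | c * (2 : ℝ≥0∞) ^ (j : ℝ) < f y}.indicator f y ∂(gaussMeasure n)) := by
        exact ENNReal.tsum_le_tsum fun j => mul_le_mul_right (hcut _ (two_rpow_ne_top _)) _
    _ = ∑' j : ℤ, ∫⁻ y, 2 ^ p * (2 * C₁) * (f y * (if (2 : ℝ≥0∞) ^ (j : ℝ) < (c : ℝ≥0∞)⁻¹ * f y
          then ((2 : ℝ≥0∞) ^ (j : ℝ)) ^ (p - 1) else 0)) ∂(gaussMeasure n) := by
        refine tsum_congr fun j => ?_
        have hfin : 2 ^ p * ((2 : ℝ≥0∞) ^ (j : ℝ)) ^ (p - 1) * (2 * C₁) ≠ ∞ := by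
          rw [← ENNReal.rpow_mul]
          exact ENNReal.mul_ne_top (ENNReal.mul_ne_top (two_rpow_ne_top _) (two_rpow_ne_top _))
            (by finiteness)
        rw [← mul_assoc, ← lintegral_const_mul' _ _ hfin]
        refine lintegral_congr fun y => ?_
        have hiff : c * (2 : ℝ≥0∞) ^ (j : ℝ) < f y ↔ (2 : ℝ≥0∞) ^ (j : ℝ) < (c : ℝ≥0∞)⁻¹ * f y := by
          rw [mul_comm (c : ℝ≥0∞)⁻¹, ← div_eq_mul_inv, ENNReal.lt_div_iff_mul_lt
            (Or.inl (by simpa using hc0.ne')) (Or.inl ENNReal.coe_ne_top), mul_comm]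
        by_cases hy : c * (2 : ℝ≥0∞) ^ (j : ℝ) < f y
        · rw [Set.indicator_of_mem (by exact hy), if_pos (hiff.1 hy)]; ring
        · rw [Set.indicator_of_notMem (by exact hy), if_neg (fun h => hy (hiff.2 h))]; ring
    _ = ∫⁻ y, 2 ^ p * (2 * C₁) * (f y * ∑' j : ℤ, (if (2 : ℝ≥0∞) ^ (j : ℝ) < (c : ℝ≥0∞)⁻¹ * f y
          then ((2 : ℝ≥0∞) ^ (j : ℝ)) ^ (p - 1) else 0)) ∂(gaussMeasure n) := by
        rw [← lintegral_tsum]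
        · simp_rw [ENNReal.tsum_mul_left]
        · intro j
          refine Measurable.aemeasurable (Measurable.const_mul (hf.mul (Measurable.ite ?_
            measurable_const measurable_const)) _)
          exact measurableSet_lt measurable_const (hf.const_mul _)
    _ ≤ ∫⁻ y, 2 ^ p * (2 * C₁) * (f y * (dyadicSum (p - 1) * ((c : ℝ≥0∞)⁻¹ * f y) ^ (p - 1)))
          ∂(gaussMeasure n) := by
        gcongr with y; exact tsum_two_rpow_lt_le hp1 _
    _ = ∫⁻ y, K * f y ^ p ∂(gaussMeasure n) := by
        refine lintegral_congr fun y => ?_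
        have : f y ^ p = f y * f y ^ (p - 1) := by
          conv_rhs => rw [← ENNReal.rpow_one (f y), ← ENNReal.rpow_mul, one_mul]
          rw [← ENNReal.rpow_add_of_nonneg _ _ zero_le_one hp1.le]
          congr 1; ring
        rw [this, hK, ENNReal.mul_rpow_of_nonneg _ _ hp1.le]; ring
    _ = _ := lintegral_const_mul' _ _ hKt

end GaussBMO

namespace GaussBMO

open Metric

variable {n : ℕ} {𝕜 : Type*} [RCLike 𝕜]

/-! ### The oscillation kernel -/

/-- The kernel `∑ₖ w(x, ρₖ)^{β-1} (|b(y) - b_{B(x, δρₖ)}| + D)`, the sum being over the scales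
`ρₖ = 2⁻ᵏ a` with `|x - y| < ρₖ < A m(x)`. -/
noncomputable def oscKernel (a A δ β : ℝ) (b : EuclideanSpace ℝ (Fin n) → 𝕜) (D : ℝ≥0)
    (x y : EuclideanSpace ℝ (Fin n)) : ℝ≥0∞ :=
  ∑' k : ℕ, if dist y x < a * (1 / 2) ^ k ∧ a * (1 / 2) ^ k < A * admScale x then
    weight x (a * (1 / 2) ^ k) ^ (β - 1) *
      (‖b y - ballAvg b x (δ * (a * (1 / 2) ^ k))‖ₑ + D) else 0

lemma measurable_oscKernel (a A δ β : ℝ) {b : EuclideanSpace ℝ (Fin n) → 𝕜}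
    (hb : StronglyMeasurable b) (D : ℝ≥0) :
    Measurable (Function.uncurry (oscKernel a A δ β b D)) := by
  refine Measurable.tsum fun k => Measurable.ite ?_ ?_ measurable_const
  · have h1 : MeasurableSet {p : EuclideanSpace ℝ (Fin n) × EuclideanSpace ℝ (Fin n) |
        dist p.2 p.1 < a * (1 / 2) ^ k} := measurableSet_lt (by fun_prop) measurable_const
    have h2 : MeasurableSet {p : EuclideanSpace ℝ (Fin n) × EuclideanSpace ℝ (Fin n) |
        a * (1 / 2) ^ k < A * admScale p.1} :=
      measurableSet_lt measurable_const ((measurable_admScale.comp measurable_fst).const_mul A)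
    exact h1.inter h2
  · have h1 : Measurable fun p : EuclideanSpace ℝ (Fin n) × EuclideanSpace ℝ (Fin n) =>
        ballAvg b p.1 (δ * (a * (1 / 2) ^ k)) := (measurable_ballAvg hb _).comp measurable_fst
    have h2 : Measurable fun p : EuclideanSpace ℝ (Fin n) × EuclideanSpace ℝ (Fin n) =>
        b p.2 := hb.measurable.comp measurable_snd
    have h3 : Measurable fun p : EuclideanSpace ℝ (Fin n) × EuclideanSpace ℝ (Fin n) =>
        weight p.1 (a * (1 / 2) ^ k) := (measurable_weight _).comp measurable_fst
    exact (h3.pow_const _).mul ((h2.sub h1).enorm.add_const _)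

/-- The sum over scales is taken out of the integral, so that each scale becomes an integral over
one ball, ready for Hölder. -/
lemma lintegral_oscKernel_mul (a A δ β : ℝ) {b : EuclideanSpace ℝ (Fin n) → 𝕜}
    (hb : StronglyMeasurable b) (D : ℝ≥0) {f : EuclideanSpace ℝ (Fin n) → ℝ≥0∞}
    (hf : Measurable f) (x : EuclideanSpace ℝ (Fin n)) :
    ∫⁻ y, oscKernel a A δ β b D x y * f y ∂(gaussMeasure n) =
      ∑' k : ℕ, if a * (1 / 2) ^ k < A * admScale x then
        weight x (a * (1 / 2) ^ k) ^ (β - 1) * ∫⁻ y in ball x (a * (1 / 2) ^ k),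
          (‖b y - ballAvg b x (δ * (a * (1 / 2) ^ k))‖ₑ + D) * f y ∂(gaussMeasure n) else 0 := by
  have hm : ∀ k : ℕ, Measurable fun y =>
      (‖b y - ballAvg b x (δ * (a * (1 / 2) ^ k))‖ₑ + D) * f y := fun k =>
    ((hb.measurable.sub_const _).enorm.add_const _).mul hf
  have e : ∀ (k : ℕ) y, (if dist y x < a * (1 / 2) ^ k ∧ a * (1 / 2) ^ k < A * admScale x then
      weight x (a * (1 / 2) ^ k) ^ (β - 1) *
      (‖b y - ballAvg b x (δ * (a * (1 / 2) ^ k))‖ₑ + D) else 0) * f y =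
      (ball x (a * (1 / 2) ^ k)).indicator (fun y => (if a * (1 / 2) ^ k < A * admScale x then
        weight x (a * (1 / 2) ^ k) ^ (β - 1) else 0) *
          ((‖b y - ballAvg b x (δ * (a * (1 / 2) ^ k))‖ₑ + D) * f y)) y := by
    intro k y
    simp only [Set.indicator, mem_ball]
    generalize a * (1 / 2) ^ k = ρ
    by_cases h1 : dist y x < ρ <;> by_cases h2 : ρ < A * admScale x <;> simp [h1, h2, mul_assoc]
  simp_rw [oscKernel, ← ENNReal.tsum_mul_right, e]
  rw [lintegral_tsum fun k => (((hm k).const_mul _).indicator measurableSet_ball).aemeasurable]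
  refine tsum_congr fun k => ?_
  rw [lintegral_indicator measurableSet_ball, lintegral_const_mul _ (hm k)]
  split_ifs <;> simp

lemma OscBound.mono {b : EuclideanSpace ℝ (Fin n) → 𝕜} {s ε ε' : ℝ} {D D' : ℝ≥0} (hs : 0 ≤ s)
    (h : OscBound b s ε D) (hε : ε' ≤ ε) (hD : D ≤ D') : OscBound b s ε' D' := by
  intro c r hr
  refine (h c r ⟨hr.1, hr.2.trans ?_⟩).trans ?_
  · gcongr; exact (admScale_pos c).le
  · gcongr

/-- The power means of `|b - b_{B(x, δρ)}| + D` over `B(x, ρ)`, in terms of the weight. -/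
lemma exists_lintegral_osc_add_le (n : ℕ) (𝕜 : Type*) [RCLike 𝕜] {A δ s : ℝ} (hA : 0 ≤ A)
    (hδ : 0 < δ) (hδ1 : δ ≤ 1) (hδA : 2 * δ * A * (1 + 2 * A) ≤ 1 / 2) (hs : 1 ≤ s) : ∃ C : ℝ≥0,
    ∀ (b : EuclideanSpace ℝ (Fin n) → 𝕜), Integrable b (gaussMeasure n) → StronglyMeasurable b →
    ∀ D : ℝ≥0, 0 < D → OscBound b 1 1 D →
    ∀ (x : EuclideanSpace ℝ (Fin n)) (ρ : ℝ), 0 < ρ → ρ ≤ A * admScale x →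
      ∫⁻ y in ball x ρ, (‖b y - ballAvg b x (δ * ρ)‖ₑ + D) ^ s ∂(gaussMeasure n) ≤
        C * (D : ℝ≥0∞) ^ s * weight x ρ := by
  obtain ⟨C₁, -, h₁⟩ := exists_oscBound_rpow n 𝕜 hs
  obtain ⟨C₂, h₂⟩ := exists_lintegral_sub_ballAvg_le n 𝕜 hA hδ hδ1 hs
  obtain ⟨C₃, -, h₃⟩ := exists_gaussMeasure_ball_comparable n hA
  have hs0 : 0 ≤ s := by linarith
  -- One constant has to serve for both the first-power and the s-th power oscillation bounds.
  set M : ℝ≥0 := max 1 C₁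
  refine ⟨2 ^ (s - 1) * (C₂ * M ^ s + 1) * C₃, fun b hb hbm D hD hosc x ρ hρ hρA => ?_⟩
  have hD1 : D ≤ M * D := le_mul_of_one_le_left' (le_max_left _ _)
  have hb1 : OscBound b 1 (1 / 2) (M * D) := hosc.mono zero_le_one (by norm_num) hD1
  have hbs : OscBound b s (1 / 2) (M * D) :=
    (h₁ b hb hbm D hD hosc).mono hs0 le_rfl (by gcongr; exact le_max_right _ _)
  have h := h₂ b hb hbm (1 / 2) (M * D) (by norm_num) hδA hb1 hbs x ρ hρ hρA
  calc ∫⁻ y in ball x ρ, (‖b y - ballAvg b x (δ * ρ)‖ₑ + D) ^ s ∂(gaussMeasure n)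
      ≤ ∫⁻ y in ball x ρ, 2 ^ (s - 1) * (‖b y - ballAvg b x (δ * ρ)‖ₑ ^ s + (D : ℝ≥0∞) ^ s)
          ∂(gaussMeasure n) :=
        lintegral_mono fun y => ENNReal.rpow_add_le_mul_rpow_add_rpow _ _ hs
    _ = 2 ^ (s - 1) * ((∫⁻ y in ball x ρ, ‖b y - ballAvg b x (δ * ρ)‖ₑ ^ s ∂(gaussMeasure n)) +
          (D : ℝ≥0∞) ^ s * gaussMeasure n (ball x ρ)) := by
        rw [lintegral_const_mul' _ _ (two_rpow_ne_top _), lintegral_add_right _ measurable_const,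
          setLIntegral_const]
    _ ≤ 2 ^ (s - 1) * (C₂ * ((M * D : ℝ≥0) : ℝ≥0∞) ^ s * gaussMeasure n (ball x ρ) +
          (D : ℝ≥0∞) ^ s * gaussMeasure n (ball x ρ)) := by gcongr
    _ = 2 ^ (s - 1) * (C₂ * (M : ℝ≥0∞) ^ s + 1) * (D : ℝ≥0∞) ^ s *
          gaussMeasure n (ball x ρ) := by
        rw [ENNReal.coe_mul, ENNReal.mul_rpow_of_nonneg _ _ hs0]; ring
    _ ≤ 2 ^ (s - 1) * (C₂ * (M : ℝ≥0∞) ^ s + 1) * (D : ℝ≥0∞) ^ s * (C₃ * weight x ρ) := by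
        gcongr; exact (h₃ x ρ hρ hρA).1
    _ = _ := by
        push_cast
        rw [ENNReal.coe_rpow_of_nonneg _ hs0, ENNReal.coe_rpow_of_ne_zero two_ne_zero]
        push_cast
        ring

/-- Hölder's inequality against the oscillation over a ball. -/
lemma exists_lintegral_osc_mul_le (n : ℕ) (𝕜 : Type*) [RCLike 𝕜] {A δ s : ℝ} (hA : 0 ≤ A)
    (hδ : 0 < δ) (hδ1 : δ ≤ 1) (hδA : 2 * δ * A * (1 + 2 * A) ≤ 1 / 2) (hs : 1 < s) : ∃ C : ℝ≥0,
    ∀ (b : EuclideanSpace ℝ (Fin n) → 𝕜), Integrable b (gaussMeasure n) → StronglyMeasurable b →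
    ∀ D : ℝ≥0, 0 < D → OscBound b 1 1 D →
    ∀ f : EuclideanSpace ℝ (Fin n) → ℝ≥0∞, Measurable f →
    ∀ (x : EuclideanSpace ℝ (Fin n)) (ρ : ℝ), 0 < ρ → ρ ≤ A * admScale x →
      ∫⁻ y in ball x ρ, (‖b y - ballAvg b x (δ * ρ)‖ₑ + D) * f y ∂(gaussMeasure n) ≤
        C * D * weight x ρ ^ (1 - 1 / s) *
          (∫⁻ y in ball x ρ, f y ^ s ∂(gaussMeasure n)) ^ (1 / s) := by
  have hc := Real.HolderConjugate.conjExponent hs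
  set r := s.conjExponent
  have hr1 : 1 < r := hc.symm.lt
  have hr0 : 0 < r := by linarith
  have hrs : 1 / r = 1 - 1 / s := by
    have := hc.inv_add_inv_eq_one
    rw [one_div, one_div]; linarith
  obtain ⟨C, h⟩ := exists_lintegral_osc_add_le n 𝕜 hA hδ hδ1 hδA hr1.le
  refine ⟨C ^ (1 / r), fun b hb hbm D hD hosc f hf x ρ hρ hρA => ?_⟩
  have hm : Measurable fun y => ‖b y - ballAvg b x (δ * ρ)‖ₑ + D :=
    (hbm.measurable.sub_const _).enorm.add_const _
  have hr' : 0 ≤ 1 / r := by positivity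
  calc _ ≤ (∫⁻ y in ball x ρ, (‖b y - ballAvg b x (δ * ρ)‖ₑ + D) ^ r ∂(gaussMeasure n)) ^ (1 / r) *
        (∫⁻ y in ball x ρ, f y ^ s ∂(gaussMeasure n)) ^ (1 / s) :=
        ENNReal.lintegral_mul_le_Lp_mul_Lq _ hc.symm hm.aemeasurable hf.aemeasurable
    _ ≤ (C * (D : ℝ≥0∞) ^ r * weight x ρ) ^ (1 / r) *
        (∫⁻ y in ball x ρ, f y ^ s ∂(gaussMeasure n)) ^ (1 / s) := by
        gcongr; exact h b hb hbm D hD hosc x ρ hρ hρA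
    _ = _ := by
        rw [ENNReal.mul_rpow_of_nonneg _ _ hr', ENNReal.mul_rpow_of_nonneg _ _ hr',
          ← ENNReal.rpow_mul, mul_one_div_cancel hr0.ne', ENNReal.rpow_one, ← hrs,
          ENNReal.coe_rpow_of_nonneg _ hr']

lemma weight_mul_half_pow (x : EuclideanSpace ℝ (Fin n)) (a : ℝ) (k : ℕ) :
    weight x (a * (1 / 2) ^ k) = weight x a * 2 ^ (-(n * k : ℝ)) := by
  rw [mul_comm a, weight_mul x (by positivity), mul_comm]
  congr 1
  rw [← pow_mul, one_div, inv_pow, ENNReal.ofReal_inv_of_pos (by positivity), ENNReal.rpow_neg]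
  congr 1
  rw [ENNReal.ofReal_pow two_pos.le]
  rw [show ((n : ℝ) * k) = ((k * n : ℕ) : ℝ) by push_cast; ring, ENNReal.rpow_natCast]
  simp

/-- Hedberg's pointwise estimate for the oscillation kernel. -/
theorem exists_lintegral_oscKernel_rpow_le {n : ℕ} (hn : 1 ≤ n) (𝕜 : Type*) [RCLike 𝕜]
    {a A δ β p q : ℝ} (ha : 0 < a) (hA : 0 ≤ A) (hδ : 0 < δ) (hδ1 : δ ≤ 1)
    (hδA : 2 * δ * A * (1 + 2 * A) ≤ 1 / 2) (hβ : 0 < β) (hp : 1 < p) (hpq : p < q)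
    (h : 1 / q = 1 / p - β) : ∃ C : ℝ≥0,
    ∀ (b : EuclideanSpace ℝ (Fin n) → 𝕜), Integrable b (gaussMeasure n) → StronglyMeasurable b →
    ∀ D : ℝ≥0, 0 < D → OscBound b 1 1 D →
    ∀ f : EuclideanSpace ℝ (Fin n) → ℝ≥0∞, Measurable f →
      ∫⁻ x, (∫⁻ y, oscKernel a A δ β b D x y * f y ∂(gaussMeasure n)) ^ q ∂(gaussMeasure n) ≤
        (C * D : ℝ≥0∞) ^ q * (∫⁻ x, f x ^ p ∂(gaussMeasure n)) ^ (q / p) := by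
  have hp0 : 0 < p := by linarith
  have hq0 : 0 < q := by linarith
  -- Any exponent strictly between 1 and p would do: s > 1 for Hölder against the oscillation, s < p
  -- for the maximal theorem on L^{p/s}.
  set s : ℝ := (1 + p) / 2 with hs
  have hs1 : 1 < s := by rw [hs]; linarith
  have hs0 : 0 < s := by linarith
  have hsp : s < p := by rw [hs]; linarith
  obtain ⟨C₁, h₁⟩ := exists_lintegral_osc_mul_le n 𝕜 hA hδ hδ1 hδA hs1
  obtain ⟨C₂, h₂⟩ := exists_lintegral_osc_mul_le n 𝕜 hA hδ hδ1 hδA hp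
  obtain ⟨C₃, h₃⟩ := exists_tsum_min_le hn hβ hp0 hpq h
  obtain ⟨C₄, h₄⟩ := exists_localMax_strong n ha hA (p := p / s) ((one_lt_div hs0).2 hsp)
  set K : ℝ≥0 := max C₁ C₂ with hK
  refine ⟨K * C₃ * C₄ ^ (1 / q), fun b hb hbm D hD hosc f hf => ?_⟩
  set N : ℝ≥0∞ := (∫⁻ x, f x ^ p ∂(gaussMeasure n)) ^ (1 / p) with hN
  have hfs : Measurable fun y => f y ^ s := hf.pow_const s
  set M : EuclideanSpace ℝ (Fin n) → ℝ≥0∞ :=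
    fun x => localMax a A (fun y => f y ^ s) x ^ (1 / s) with hM
  have hMm : Measurable M := (measurable_localMax a A hfs).pow_const _
  have hpt : ∀ x, ∫⁻ y, oscKernel a A δ β b D x y * f y ∂(gaussMeasure n) ≤
      K * D * (C₃ * (M x ^ (p / q) * N ^ (1 - p / q))) := by
    intro x
    rw [lintegral_oscKernel_mul a A δ β hbm D hf x]
    refine le_trans ?_ (mul_le_mul_right
      (h₃ (weight x a) (M x) N (weight_pos x ha).ne' (weight_ne_top x a)) _)
    rw [← ENNReal.tsum_mul_left]
    refine ENNReal.tsum_le_tsum fun k => ?_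
    split_ifs with hk
    · rw [← weight_mul_half_pow]
      have hρ : 0 < a * (1 / 2 : ℝ) ^ k := by positivity
      set ρ := a * (1 / 2 : ℝ) ^ k with hρd
      have hw0 := (weight_pos x hρ).ne'
      have hwt := weight_ne_top x ρ
      -- Hölder with exponent s gives the local bound by M, and with exponent p the global bound by
      -- N; the smaller one is used at each scale.
      rcases le_total (weight x ρ ^ β * M x) (weight x ρ ^ (-(1 / q)) * N) with hmin | hmin
      · rw [min_eq_left hmin]
        calc _ ≤ weight x ρ ^ (β - 1) * (C₁ * D * weight x ρ ^ (1 - 1 / s) *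
              (∫⁻ y in ball x ρ, f y ^ s ∂(gaussMeasure n)) ^ (1 / s)) := by
              gcongr; exact h₁ b hb hbm D hD hosc f hf x ρ hρ hk.le
          _ = C₁ * D * (weight x ρ ^ β * ((weight x ρ)⁻¹ *
              ∫⁻ y in ball x ρ, f y ^ s ∂(gaussMeasure n)) ^ (1 / s)) := by
              rw [ENNReal.mul_rpow_of_nonneg _ _ (by positivity), ← ENNReal.rpow_neg_one,
                ← ENNReal.rpow_mul]
              have : weight x ρ ^ (β - 1) * weight x ρ ^ (1 - 1 / s) =
                  weight x ρ ^ β * weight x ρ ^ (-1 * (1 / s)) := by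
                rw [← ENNReal.rpow_add _ _ hw0 hwt, ← ENNReal.rpow_add _ _ hw0 hwt]
                congr 1; ring
              calc _ = C₁ * D * (weight x ρ ^ (β - 1) * weight x ρ ^ (1 - 1 / s)) *
                  (∫⁻ y in ball x ρ, f y ^ s ∂(gaussMeasure n)) ^ (1 / s) := by ring
                _ = _ := by rw [this]; ring
          _ ≤ _ := by
              gcongr
              · exact le_max_left _ _
              · simp only [hM]
                gcongr
                refine le_iSup_of_le k ?_
                rw [if_pos hk]
      · rw [min_eq_right hmin]
        calc _ ≤ weight x ρ ^ (β - 1) * (C₂ * D * weight x ρ ^ (1 - 1 / p) *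
              (∫⁻ y in ball x ρ, f y ^ p ∂(gaussMeasure n)) ^ (1 / p)) := by
              gcongr; exact h₂ b hb hbm D hD hosc f hf x ρ hρ hk.le
          _ = C₂ * D * (weight x ρ ^ (-(1 / q)) *
                (∫⁻ y in ball x ρ, f y ^ p ∂(gaussMeasure n)) ^ (1 / p)) := by
              have : weight x ρ ^ (β - 1) * weight x ρ ^ (1 - 1 / p) =
                  weight x ρ ^ (-(1 / q)) := by
                rw [← ENNReal.rpow_add _ _ hw0 hwt, h]
                congr 1; ring
              rw [← this]; ring
          _ ≤ _ := by
              rw [hN]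
              gcongr
              · exact le_max_right _ _
              · exact Measure.restrict_le_self
    · exact zero_le
  have hMp : ∫⁻ x, M x ^ p ∂(gaussMeasure n) ≤ C₄ * ∫⁻ x, f x ^ p ∂(gaussMeasure n) := by
    have h5 := h₄ (fun y => f y ^ s) hfs
    simp only [hM]
    calc _ = ∫⁻ x, localMax a A (fun y => f y ^ s) x ^ (p / s) ∂(gaussMeasure n) := by
          refine lintegral_congr fun x => ?_
          rw [← ENNReal.rpow_mul]; congr 1; ring
      _ ≤ _ := h5
      _ = _ := by
          congr 1
          refine lintegral_congr fun x => ?_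
          rw [← ENNReal.rpow_mul]; congr 1; field_simp
  have hr2 : 0 ≤ (1 - p / q) * q := by
    rw [sub_mul, div_mul_cancel₀ _ hq0.ne']; linarith
  calc _ ≤ ∫⁻ x, (K * D * (C₃ * (M x ^ (p / q) * N ^ (1 - p / q)))) ^ q ∂(gaussMeasure n) := by
        gcongr with x; exact hpt x
    _ = ∫⁻ x, (K * C₃ * D : ℝ≥0∞) ^ q * N ^ ((1 - p / q) * q) * M x ^ p ∂(gaussMeasure n) := by
        refine lintegral_congr fun x => ?_
        rw [show (K : ℝ≥0∞) * D * (C₃ * (M x ^ (p / q) * N ^ (1 - p / q))) =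
          (K * C₃ * D) * N ^ (1 - p / q) * M x ^ (p / q) by ring,
          ENNReal.mul_rpow_of_nonneg _ _ hq0.le, ENNReal.mul_rpow_of_nonneg _ _ hq0.le,
          ← ENNReal.rpow_mul N, ← ENNReal.rpow_mul (M x), div_mul_cancel₀ _ hq0.ne']
    _ = (K * C₃ * D : ℝ≥0∞) ^ q * N ^ ((1 - p / q) * q) * ∫⁻ x, M x ^ p ∂(gaussMeasure n) :=
        lintegral_const_mul _ (hMm.pow_const p)
    _ ≤ (K * C₃ * D : ℝ≥0∞) ^ q * N ^ ((1 - p / q) * q) * (C₄ * N ^ p) := by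
        gcongr
        rw [hN, ← ENNReal.rpow_mul, one_div_mul_cancel hp0.ne', ENNReal.rpow_one]
        exact hMp
    _ = (K * C₃ * D : ℝ≥0∞) ^ q * C₄ * (N ^ ((1 - p / q) * q) * N ^ p) := by ring
    _ = (K * C₃ * D : ℝ≥0∞) ^ q * C₄ * N ^ q := by
        rw [← ENNReal.rpow_add_of_nonneg _ _ hr2 hp0.le]
        congr 2; field_simp; ring
    _ = _ := by
        rw [hN, ← ENNReal.rpow_mul, show 1 / p * q = q / p by ring]
        congr 1
        push_cast
        rw [ENNReal.coe_rpow_of_nonneg _ (by positivity),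
          show (K : ℝ≥0∞) * C₃ * (C₄ : ℝ≥0∞) ^ (1 / q) * D = K * C₃ * D * (C₄ : ℝ≥0∞) ^ (1 / q) by
            ring,
          ENNReal.mul_rpow_of_nonneg _ ((C₄ : ℝ≥0∞) ^ (1 / q)) hq0.le, ← ENNReal.rpow_mul,
          one_div_mul_cancel hq0.ne', ENNReal.rpow_one]

/-! ### Duality -/

/-- Test with g = min(F, N)^{q-1}. The truncation and the finiteness of μ make the integral finite,
so its power can be cancelled; then N tends to infinity by monotone convergence. -/
lemma lintegral_rpow_le_of_forall_lintegral_mul_le {α : Type*} [MeasurableSpace α] {μ : Measure α}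
    [IsFiniteMeasure μ] {q q' : ℝ} (hq : q.HolderConjugate q') {F : α → ℝ≥0∞} (hF : Measurable F)
    {K : ℝ≥0∞} (h : ∀ g : α → ℝ≥0∞, Measurable g →
      ∫⁻ x, g x * F x ∂μ ≤ K * (∫⁻ x, g x ^ q' ∂μ) ^ (1 / q')) :
    ∫⁻ x, F x ^ q ∂μ ≤ K ^ q := by
  have hq0 : 0 < q := hq.pos
  have hq1 : 1 < q := hq.lt
  have hq'0 : 0 < q' := hq.symm.pos
  have hN : ∀ N : ℕ, ∫⁻ x, min (F x) N ^ q ∂μ ≤ K ^ q := by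
    intro N
    set I := ∫⁻ x, min (F x) N ^ q ∂μ with hI
    have hIt : I ≠ ∞ := by
      have : I ≤ ∫⁻ _, (N : ℝ≥0∞) ^ q ∂μ := lintegral_mono fun x => by gcongr; exact min_le_right _ _
      refine ne_top_of_le_ne_top ?_ this
      rw [lintegral_const]
      exact ENNReal.mul_ne_top (ENNReal.rpow_ne_top_of_nonneg hq0.le (by simp)) (measure_ne_top _ _)
    rcases eq_or_ne I 0 with h0 | h0
    · rw [h0]; exact zero_le
    have h1 := h (fun x => min (F x) N ^ (q - 1)) ((hF.min measurable_const).pow_const _)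
    have h2 : I ≤ ∫⁻ x, min (F x) N ^ (q - 1) * F x ∂μ := by
      refine lintegral_mono fun x => ?_
      calc min (F x) N ^ q = min (F x) N ^ (q - 1) * min (F x) N := by
            conv_rhs => rw [← ENNReal.rpow_one (min (F x) N), ← ENNReal.rpow_mul, one_mul]
            rw [← ENNReal.rpow_add_of_nonneg _ _ (by linarith) zero_le_one]
            congr 1; ring
        _ ≤ _ := by gcongr; exact min_le_left _ _
    have h3 : ∫⁻ x, (min (F x) N ^ (q - 1)) ^ q' ∂μ = I := by
      refine lintegral_congr fun x => ?_
      rw [← ENNReal.rpow_mul, hq.sub_one_mul_conj]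
    rw [h3] at h1
    have h4 := h2.trans h1
    have h5 : I = I ^ (1 / q) * I ^ (1 / q') := by
      rw [← ENNReal.rpow_add _ _ h0 hIt, one_div, one_div, hq.inv_add_inv_eq_one, ENNReal.rpow_one]
    have h6 : I ^ (1 / q') ≠ 0 := by simp [h0, hIt]
    have h7 : I ^ (1 / q') ≠ ∞ := ENNReal.rpow_ne_top_of_nonneg (by positivity) hIt
    have h8 : I ^ (1 / q) ≤ K := by
      rw [← ENNReal.mul_le_mul_iff_left h6 h7, ← h5]; exact h4
    calc I = (I ^ (1 / q)) ^ q := by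
          rw [← ENNReal.rpow_mul, one_div_mul_cancel hq0.ne', ENNReal.rpow_one]
      _ ≤ _ := by gcongr
  calc ∫⁻ x, F x ^ q ∂μ ≤ ∫⁻ x, ⨆ N : ℕ, min (F x) N ^ q ∂μ := by
        refine lintegral_mono fun x => ?_
        rcases eq_or_ne (F x) ∞ with ht | ht
        · simp only [ht, min_eq_right le_top]
          refine le_trans le_top (ENNReal.iSup_natCast.ge.trans (iSup_mono fun N => ?_))
          rcases Nat.eq_zero_or_pos N with rfl | hpos
          · simp
          · refine ENNReal.le_rpow_self_of_one_le (by exact_mod_cast hpos) hq1.le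
        · obtain ⟨N, hN⟩ := ENNReal.exists_nat_gt ht
          refine le_iSup_of_le N ?_
          rw [min_eq_left hN.le]
    _ = ⨆ N : ℕ, ∫⁻ x, min (F x) N ^ q ∂μ := by
        refine lintegral_iSup (fun N => (hF.min measurable_const).pow_const _) fun N N' hNN' x => ?_
        dsimp only
        gcongr
    _ ≤ _ := iSup_le hN

/-- Pair with g, move the kernel onto g by Tonelli, and apply Hölder. -/
lemma lintegral_transpose_rpow_le {α : Type*} [MeasurableSpace α] {μ : Measure α}
    [IsFiniteMeasure μ] {p p' q q' : ℝ} (hp : p.HolderConjugate p') (hq : q.HolderConjugate q')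
    {k : α → α → ℝ≥0∞} (hk : Measurable (Function.uncurry k)) {B : ℝ≥0∞}
    (h : ∀ g : α → ℝ≥0∞, Measurable g →
      ∫⁻ x, (∫⁻ y, k x y * g y ∂μ) ^ p' ∂μ ≤ B ^ p' * (∫⁻ x, g x ^ q' ∂μ) ^ (p' / q'))
    {f : α → ℝ≥0∞} (hf : Measurable f) :
    ∫⁻ x, (∫⁻ y, k y x * f y ∂μ) ^ q ∂μ ≤ B ^ q * (∫⁻ x, f x ^ p ∂μ) ^ (q / p) := by
  have hp0 := hp.pos
  have hp'0 := hp.symm.pos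
  have hq0 := hq.pos
  have hks : Measurable (Function.uncurry fun x y => k y x) := hk.comp measurable_swap
  have hT : Measurable fun x => ∫⁻ y, k y x * f y ∂μ :=
    (hks.mul (hf.comp measurable_snd)).lintegral_prod_right'
  have key := lintegral_rpow_le_of_forall_lintegral_mul_le (μ := μ) hq hT
    (K := B * (∫⁻ x, f x ^ p ∂μ) ^ (1 / p)) ?_
  · refine key.trans (le_of_eq ?_)
    rw [ENNReal.mul_rpow_of_nonneg _ _ hq0.le, ← ENNReal.rpow_mul]
    congr 2; ring
  intro g hg
  have hTg : Measurable fun x => ∫⁻ y, k x y * g y ∂μ :=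
    (hk.mul (hg.comp measurable_snd)).lintegral_prod_right'
  calc ∫⁻ x, g x * ∫⁻ y, k y x * f y ∂μ ∂μ = ∫⁻ x, ∫⁻ y, g x * (k y x * f y) ∂μ ∂μ := by
        refine lintegral_congr fun x => (lintegral_const_mul _ ?_).symm
        exact (hks.of_uncurry_left (x := x)).mul hf
    _ = ∫⁻ y, ∫⁻ x, g x * (k y x * f y) ∂μ ∂μ :=
        lintegral_lintegral_swap (((hg.comp measurable_fst).mul
          (hks.mul (hf.comp measurable_snd))).aemeasurable)
    _ = ∫⁻ y, f y * ∫⁻ x, k y x * g x ∂μ ∂μ := by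
        refine lintegral_congr fun y => ?_
        refine (lintegral_congr fun x => ?_).trans
          (lintegral_const_mul _ ((hk.of_uncurry_left (x := y)).mul hg))
        ring
    _ ≤ (∫⁻ x, f x ^ p ∂μ) ^ (1 / p) * (∫⁻ x, (∫⁻ y, k x y * g y ∂μ) ^ p' ∂μ) ^ (1 / p') :=
        ENNReal.lintegral_mul_le_Lp_mul_Lq μ hp hf.aemeasurable hTg.aemeasurable
    _ ≤ (∫⁻ x, f x ^ p ∂μ) ^ (1 / p) * (B ^ p' * (∫⁻ x, g x ^ q' ∂μ) ^ (p' / q')) ^ (1 / p') := by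
        gcongr; exact h g hg
    _ = _ := by
        rw [ENNReal.mul_rpow_of_nonneg _ _ (by positivity), ← ENNReal.rpow_mul, ← ENNReal.rpow_mul,
          mul_one_div_cancel hp'0.ne', ENNReal.rpow_one,
          show p' / q' * (1 / p') = 1 / q' by field_simp]
        ring

end GaussBMO

namespace GaussBMO

open Metric

variable {n : ℕ} {𝕜 : Type*} [RCLike 𝕜]

/-! ### The sublinear commutator -/

/-- A nonpositive power reverses inequalities; this carries comparisons of weights over to the
kernels. -/
lemma rpow_sub_one_le_of_le_mul {β : ℝ} (hβ : β ≤ 1) {u v : ℝ≥0∞} {c : ℝ≥0} (hc : 0 < c)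
    (h : u ≤ c * v) : v ^ (β - 1) ≤ (c : ℝ≥0∞) ^ (1 - β) * u ^ (β - 1) := by
  have hβ' : 0 ≤ 1 - β := by linarith
  have h1 : u ^ (1 - β) ≤ (c : ℝ≥0∞) ^ (1 - β) * v ^ (1 - β) := by
    rw [← ENNReal.mul_rpow_of_nonneg _ _ hβ']; gcongr
  have hc0 : (c : ℝ≥0∞) ^ (1 - β) ≠ 0 := by simp [hc.ne']
  have hct : (c : ℝ≥0∞) ^ (1 - β) ≠ ∞ := ENNReal.rpow_ne_top_of_nonneg hβ' ENNReal.coe_ne_top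
  rw [show β - 1 = -(1 - β) by ring, ENNReal.rpow_neg, ENNReal.rpow_neg, ← div_eq_mul_inv]
  rw [ENNReal.le_div_iff_mul_le (Or.inr hc0) (Or.inr hct), mul_comm, ← div_eq_mul_inv]
  exact ENNReal.div_le_of_le_mul h1

lemma exists_half_pow_scale {a t : ℝ} (ha : 0 < a) (ht0 : 0 < t) (hta : t < a) :
    ∃ k : ℕ, t < a * (1 / 2) ^ k ∧ a * (1 / 2) ^ k ≤ 2 * t := by
  have hex : ∃ k : ℕ, a * (1 / 2 : ℝ) ^ k ≤ t := by
    obtain ⟨k, hk⟩ := exists_pow_lt_of_lt_one (div_pos ht0 ha) (by norm_num : (1 / 2 : ℝ) < 1)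
    refine ⟨k, ?_⟩
    rw [lt_div_iff₀ ha] at hk; linarith
  classical
  have h1 := Nat.find_spec hex
  have hpos : Nat.find hex ≠ 0 := by
    intro h; rw [h] at h1; simp at h1; linarith
  obtain ⟨k, hk⟩ := Nat.exists_eq_succ_of_ne_zero hpos
  have h2 := Nat.find_min hex (m := k) (by omega)
  refine ⟨k, not_le.1 h2, ?_⟩
  rw [hk, Nat.succ_eq_add_one, pow_succ] at h1
  linarith

/-- Pointwise domination of the commutator kernel by the oscillation kernel and its transpose. -/
lemma exists_commKernel_le (n : ℕ) (𝕜 : Type*) [RCLike 𝕜] {a δ β : ℝ} (ha : 0 < a) (hδ : 0 < δ)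
    (hδA : 2 * δ * (2 * a * (1 + a)) * (1 + 2 * a * (1 + a)) ≤ 1) (hβ : β ≤ 1) : ∃ C : ℝ≥0,
    ∀ (b : EuclideanSpace ℝ (Fin n) → 𝕜), Integrable b (gaussMeasure n) →
    ∀ D : ℝ≥0, OscBound b 1 1 D →
    ∀ x y : EuclideanSpace ℝ (Fin n), dist y x < a * admScale x →
      ‖b x - b y‖ₑ / gaussMeasure n (ball x ‖x - y‖) ^ (1 - β) ≤
        C * (oscKernel a (2 * a * (1 + a)) δ β b D x y +
          oscKernel a (2 * a * (1 + a)) δ β b D y x) := by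
  -- The scale satisfies ρ ≤ 2|x - y| < 2a·m(x) ≤ 2a(1 + a)·m(y), so it is allowed in the kernel
  -- centred at either point.
  set A := 2 * a * (1 + a) with hA
  have hA0 : 0 < A := by positivity
  obtain ⟨C₁, h₁⟩ := exists_enorm_ballAvg_sub_le_chain n 𝕜 hA0.le hδ
  obtain ⟨C₂, hC₂, h₂⟩ := exists_gaussMeasure_ball_comparable n ha.le
  set e : ℝ≥0 := (Real.exp (2 * a + a ^ 2)).toNNReal with he
  have he0 : 0 < e := by rw [he, Real.toNNReal_pos]; positivity
  have hβ' : 0 ≤ 1 - β := by linarith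
  set c : ℝ≥0 := C₂ * 2 ^ n with hc
  have hc0 : 0 < c := by positivity
  refine ⟨c ^ (1 - β) * (1 + C₁) * (1 + e ^ (1 - β)), fun b hb D hosc x y hxy => ?_⟩
  rcases eq_or_ne x y with rfl | hne
  · simp
  have ht0 : 0 < dist x y := dist_pos.2 hne
  rw [dist_comm] at hxy
  have hmx := admScale_pos x
  obtain ⟨k, hk1, hk2⟩ := exists_half_pow_scale ha ht0
    (hxy.trans_le (mul_le_of_le_one_right ha.le (admScale_le_one x)))
  set ρ := a * (1 / 2 : ℝ) ^ k with hρ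
  have hρ0 : 0 < ρ := by positivity
  have hmy : admScale x ≤ (1 + a) * admScale y := admScale_le_mul_of_dist_le ha.le hxy.le
  have hρx : ρ < A * admScale x := by
    calc ρ < 2 * a * 1 * admScale x := by linarith
      _ ≤ _ := by rw [hA]; gcongr; linarith
  have hρy : ρ < A * admScale y := by
    calc ρ < 2 * (a * admScale x) := by linarith
      _ ≤ 2 * (a * ((1 + a) * admScale y)) := by gcongr
      _ = _ := by rw [hA]; ring
  have hV : weight x ρ ≤ c * gaussMeasure n (ball x ‖x - y‖) := by
    rw [← dist_eq_norm]
    calc weight x ρ ≤ weight x (2 * dist x y) := weight_mono x hρ0.le hk2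
      _ = ENNReal.ofReal (2 ^ n) * weight x (dist x y) := weight_mul x zero_le_two _
      _ ≤ ENNReal.ofReal (2 ^ n) * (C₂ * gaussMeasure n (ball x (dist x y))) := by
          gcongr; exact (h₂ x _ ht0 hxy.le).2
      _ = _ := by
          rw [ENNReal.ofReal_pow zero_le_two, hc]
          push_cast
          rw [ENNReal.ofReal_ofNat]; ring
  have hw : weight y ρ ≤ e * weight x ρ := weight_le_mul_weight' ha.le hxy.le hρ0.le
  have hV' := rpow_sub_one_le_of_le_mul hβ hc0 hV
  have hw' := rpow_sub_one_le_of_le_mul hβ he0 hw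
  have hch : ‖ballAvg b x (δ * ρ) - ballAvg b y (δ * ρ)‖ₑ ≤ C₁ * D :=
    h₁ b hb 1 D le_rfl hδA hosc x y ρ hρ0 hρx.le hk1.le
  set X := ‖b y - ballAvg b x (δ * ρ)‖ₑ with hX
  set Y := ‖b x - ballAvg b y (δ * ρ)‖ₑ with hY
  have hosc' : ‖b x - b y‖ₑ ≤ (1 + C₁) * ((X + D) + (Y + D)) := by
    -- Each value is paired with the average around the other point. In the last step nonnegative
    -- terms are added only so that the sum factors.
    calc ‖b x - b y‖ₑ = ‖(b x - ballAvg b y (δ * ρ)) - (b y - ballAvg b x (δ * ρ)) -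
          (ballAvg b x (δ * ρ) - ballAvg b y (δ * ρ))‖ₑ := by congr 1; ring
      _ ≤ ‖(b x - ballAvg b y (δ * ρ)) - (b y - ballAvg b x (δ * ρ))‖ₑ +
          ‖ballAvg b x (δ * ρ) - ballAvg b y (δ * ρ)‖ₑ := enorm_sub_le
      _ ≤ (Y + X) + C₁ * D := add_le_add enorm_sub_le hch
      _ ≤ (1 + C₁) * ((X + D) + (Y + D)) := by
          calc _ ≤ (Y + X) + C₁ * D + (2 * D + C₁ * (X + Y) + C₁ * D) := le_self_add
            _ = _ := by ring
  have hx : weight x ρ ^ (β - 1) * (X + D) ≤ oscKernel a A δ β b D x y := by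
    refine le_trans ?_ (ENNReal.le_tsum k)
    rw [if_pos ⟨by rw [dist_comm]; exact hk1, hρx⟩]
  have hy : weight y ρ ^ (β - 1) * (Y + D) ≤ oscKernel a A δ β b D y x := by
    refine le_trans ?_ (ENNReal.le_tsum k)
    rw [if_pos ⟨hk1, hρy⟩]
  rw [div_eq_mul_inv, ← ENNReal.rpow_neg, neg_sub]
  calc _ ≤ (1 + C₁) * ((X + D) + (Y + D)) * ((c : ℝ≥0∞) ^ (1 - β) * weight x ρ ^ (β - 1)) := by
        gcongr
    _ = (c : ℝ≥0∞) ^ (1 - β) * (1 + C₁) * (weight x ρ ^ (β - 1) * (X + D) +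
          weight x ρ ^ (β - 1) * (Y + D)) := by ring
    _ ≤ (c : ℝ≥0∞) ^ (1 - β) * (1 + C₁) * (weight x ρ ^ (β - 1) * (X + D) +
          (e : ℝ≥0∞) ^ (1 - β) * weight y ρ ^ (β - 1) * (Y + D)) := by gcongr
    _ ≤ (c : ℝ≥0∞) ^ (1 - β) * (1 + C₁) * (weight x ρ ^ (β - 1) * (X + D) +
          (e : ℝ≥0∞) ^ (1 - β) * weight y ρ ^ (β - 1) * (Y + D) +
          ((e : ℝ≥0∞) ^ (1 - β) * (weight x ρ ^ (β - 1) * (X + D)) +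
            weight y ρ ^ (β - 1) * (Y + D))) := mul_le_mul_right le_self_add _
    _ = (c : ℝ≥0∞) ^ (1 - β) * (1 + C₁) * (1 + (e : ℝ≥0∞) ^ (1 - β)) *
          (weight x ρ ^ (β - 1) * (X + D) + weight y ρ ^ (β - 1) * (Y + D)) := by ring
    _ ≤ (c : ℝ≥0∞) ^ (1 - β) * (1 + C₁) * (1 + (e : ℝ≥0∞) ^ (1 - β)) *
          (oscKernel a A δ β b D x y + oscKernel a A δ β b D y x) := by gcongr
    _ = _ := by
        push_cast
        rw [ENNReal.coe_rpow_of_nonneg _ hβ', ENNReal.coe_rpow_of_nonneg _ hβ']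

lemma sublinComm_congr {a β : ℝ} {b b' f f' : EuclideanSpace ℝ (Fin n) → 𝕜}
    (hb : b =ᵐ[gaussMeasure n] b') (hf : f =ᵐ[gaussMeasure n] f') :
    sublinComm a β b f =ᵐ[gaussMeasure n] sublinComm a β b' f' := by
  filter_upwards [hb] with x hx
  refine lintegral_congr_ae (ae_restrict_of_ae ?_)
  filter_upwards [hb, hf] with y hby hfy
  rw [hx, hby, hfy]

lemma measurable_sublinComm {a β : ℝ} {b f : EuclideanSpace ℝ (Fin n) → 𝕜}
    (hb : StronglyMeasurable b) (hf : StronglyMeasurable f) : Measurable (sublinComm a β b f) := by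
  have hV : Measurable fun p : EuclideanSpace ℝ (Fin n) × EuclideanSpace ℝ (Fin n) =>
      gaussMeasure n (ball p.1 ‖p.1 - p.2‖) := by
    have hs : MeasurableSet {z : (EuclideanSpace ℝ (Fin n) × EuclideanSpace ℝ (Fin n)) ×
        EuclideanSpace ℝ (Fin n) | dist z.2 z.1.1 < ‖z.1.1 - z.1.2‖} :=
      measurableSet_lt (by fun_prop) (by fun_prop)
    exact measurable_measure_prodMk_left hs
  refine measurable_lintegral_ball (F := fun x y =>
    ‖b x - b y‖ₑ * ‖f y‖ₑ / gaussMeasure n (ball x ‖x - y‖) ^ (1 - β)) ?_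
    (measurable_admScale.const_mul a)
  have h1 : Measurable fun p : EuclideanSpace ℝ (Fin n) × EuclideanSpace ℝ (Fin n) => b p.1 :=
    hb.measurable.comp measurable_fst
  have h2 : Measurable fun p : EuclideanSpace ℝ (Fin n) × EuclideanSpace ℝ (Fin n) => b p.2 :=
    hb.measurable.comp measurable_snd
  have h3 : Measurable fun p : EuclideanSpace ℝ (Fin n) × EuclideanSpace ℝ (Fin n) => f p.2 :=
    hf.measurable.comp measurable_snd
  exact ((h1.sub h2).enorm.mul h3.enorm).div (hV.pow_const _)

lemma aemeasurable_sublinComm {a β : ℝ} {b f : EuclideanSpace ℝ (Fin n) → 𝕜}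
    (hb : AEStronglyMeasurable b (gaussMeasure n)) (hf : AEStronglyMeasurable f (gaussMeasure n)) :
    AEMeasurable (sublinComm a β b f) (gaussMeasure n) :=
  ⟨_, measurable_sublinComm hb.stronglyMeasurable_mk hf.stronglyMeasurable_mk,
    sublinComm_congr hb.ae_eq_mk hf.ae_eq_mk⟩

lemma bmoSeminorm_congr {b b' : EuclideanSpace ℝ (Fin n) → 𝕜} (h : b =ᵐ[gaussMeasure n] b') :
    bmoSeminorm b = bmoSeminorm b' := by
  unfold bmoSeminorm
  refine iSup_congr fun c => iSup_congr fun r => iSup_congr fun _ => ?_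
  have havg : ⨍ y in ball c r, b y ∂(gaussMeasure n) = ⨍ y in ball c r, b' y ∂(gaussMeasure n) := by
    rw [setAverage_eq, setAverage_eq, setIntegral_congr_ae measurableSet_ball
      (h.mono fun y hy _ => hy)]
  congr 1
  refine lintegral_congr_ae (ae_restrict_of_ae ?_)
  filter_upwards [h] with y hy
  rw [hy, havg]

/-- The `L^p → L^q` bound for the sublinear commutator, with an upper bound `D` for `‖b‖_*`. -/
theorem exists_lintegral_sublinComm_rpow_le {n : ℕ} (hn : 1 ≤ n) (𝕜 : Type*) [RCLike 𝕜]
    {a β p q : ℝ} (ha : 0 < a) (hβ : 0 < β) (hβ1 : β < 1) (hp : 1 < p) (hpq : p < q)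
    (h : 1 / q = 1 / p - β) : ∃ C : ℝ≥0,
    ∀ (b : EuclideanSpace ℝ (Fin n) → 𝕜), Integrable b (gaussMeasure n) →
    ∀ D : ℝ≥0, 0 < D → bmoSeminorm b ≤ D →
    ∀ f : EuclideanSpace ℝ (Fin n) → 𝕜, AEStronglyMeasurable f (gaussMeasure n) →
      ∫⁻ x, sublinComm a β b f x ^ q ∂(gaussMeasure n) ≤
        (C * D : ℝ≥0∞) ^ q * (∫⁻ x, ‖f x‖ₑ ^ p ∂(gaussMeasure n)) ^ (q / p) := by
  set A := 2 * a * (1 + a) with hA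
  have hA0 : 0 < A := by positivity
  -- Small enough that radii δρ with ρ ≤ A·m stay in 𝓑_{1/2} even at nearby centres, the range in
  -- which John–Nirenberg is available.
  set δ : ℝ := 1 / (4 * (1 + 2 * A) ^ 2) with hδ
  have hδ0 : 0 < δ := by positivity
  have hδ1 : δ ≤ 1 := by
    rw [hδ, div_le_one (by positivity)]; nlinarith
  have hδA : 2 * δ * A * (1 + 2 * A) ≤ 1 / 2 := by
    have : 2 * δ * A * (1 + 2 * A) = A / (2 * (1 + 2 * A)) := by rw [hδ]; field_simp; ring
    rw [this, div_le_div_iff₀ (by positivity) two_pos]; linarith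
  have hδA' : 2 * δ * A * (1 + A) ≤ 1 := by
    have : 2 * δ * A * (1 + A) ≤ 2 * δ * A * (1 + 2 * A) := by gcongr; linarith
    linarith
  have hq1 : 1 < q := hp.trans hpq
  have hq0 : 0 < q := by linarith
  have hcp := Real.HolderConjugate.conjExponent hp
  have hcq := Real.HolderConjugate.conjExponent hq1
  set p' := p.conjExponent
  set q' := q.conjExponent
  have hp' : 1 / p' = 1 - 1 / p := by
    have := hcp.inv_add_inv_eq_one; rw [one_div, one_div]; linarith
  have hq' : 1 / q' = 1 - 1 / q := by
    have := hcq.inv_add_inv_eq_one; rw [one_div, one_div]; linarith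
  have hpq' : q' < p' := by
    rw [← one_div_lt_one_div hcp.symm.pos hcq.symm.pos, hp', hq', h]
    linarith
  obtain ⟨C₁, h₁⟩ := exists_lintegral_oscKernel_rpow_le hn 𝕜 ha hA0.le hδ0 hδ1 hδA hβ hp hpq h
  -- The same estimate from L^{q'} to L^{p'}, to be transposed; the relation between the exponents
  -- is self-dual with the same β.
  obtain ⟨C₂, h₂⟩ := exists_lintegral_oscKernel_rpow_le hn 𝕜 ha hA0.le hδ0 hδ1 hδA hβ
    hcq.symm.lt hpq' (by rw [hp', hq', h]; ring)
  obtain ⟨C₃, h₃⟩ := exists_commKernel_le n 𝕜 ha hδ0 hδA' hβ1.le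
  set M : ℝ≥0 := max C₁ C₂ with hM
  refine ⟨C₃ * (2 * M), ?_⟩
  intro b hb D hD hbD f hf
  have hfin : ∀ (b : EuclideanSpace ℝ (Fin n) → 𝕜), Integrable b (gaussMeasure n) →
      StronglyMeasurable b → bmoSeminorm b ≤ D →
      ∀ f : EuclideanSpace ℝ (Fin n) → 𝕜, StronglyMeasurable f →
      ∫⁻ x, sublinComm a β b f x ^ q ∂(gaussMeasure n) ≤
        ((C₃ * (2 * M) : ℝ≥0) * D : ℝ≥0∞) ^ q *
          (∫⁻ x, ‖f x‖ₑ ^ p ∂(gaussMeasure n)) ^ (q / p) := by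
    clear! b f
    intro b hb hbm hbD f hf
    have hosc := oscBound_one_of_bmoSeminorm_le hbD
    have hfm : Measurable fun y => ‖f y‖ₑ := hf.enorm
    have hk := measurable_oscKernel a A δ β hbm D
    set T₁ : EuclideanSpace ℝ (Fin n) → ℝ≥0∞ :=
      fun x => ∫⁻ y, oscKernel a A δ β b D x y * ‖f y‖ₑ ∂(gaussMeasure n) with hT₁
    set T₂ : EuclideanSpace ℝ (Fin n) → ℝ≥0∞ :=
      fun x => ∫⁻ y, oscKernel a A δ β b D y x * ‖f y‖ₑ ∂(gaussMeasure n) with hT₂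
    have hT₁m : Measurable T₁ := (hk.mul (hfm.comp measurable_snd)).lintegral_prod_right'
    set F := (∫⁻ x, ‖f x‖ₑ ^ p ∂(gaussMeasure n)) ^ (q / p) with hF
    have hb1 : ∫⁻ x, T₁ x ^ q ∂(gaussMeasure n) ≤ (M * D : ℝ≥0∞) ^ q * F := by
      refine (h₁ b hb hbm D hD hosc _ hfm).trans ?_
      gcongr; exact le_max_left _ _
    have hb2 : ∫⁻ x, T₂ x ^ q ∂(gaussMeasure n) ≤ (M * D : ℝ≥0∞) ^ q * F := by
      refine (lintegral_transpose_rpow_le hcp hcq hk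
        (fun g hg => h₂ b hb hbm D hD hosc g hg) hfm).trans ?_
      gcongr; exact le_max_right _ _
    have hpt : ∀ x, sublinComm a β b f x ≤ C₃ * (T₁ x + T₂ x) := by
      intro x
      calc sublinComm a β b f x
          ≤ ∫⁻ y in ball x (a * admScale x), C₃ * (oscKernel a A δ β b D x y * ‖f y‖ₑ +
              oscKernel a A δ β b D y x * ‖f y‖ₑ) ∂(gaussMeasure n) := by
            refine setLIntegral_mono' measurableSet_ball fun y hy => ?_
            calc _ = ‖b x - b y‖ₑ / gaussMeasure n (ball x ‖x - y‖) ^ (1 - β) * ‖f y‖ₑ := by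
                  rw [div_eq_mul_inv, div_eq_mul_inv]; ring
              _ ≤ C₃ * (oscKernel a A δ β b D x y + oscKernel a A δ β b D y x) * ‖f y‖ₑ := by
                  gcongr; exact h₃ b hb D hosc x y (mem_ball.1 hy)
              _ = _ := by ring
        _ ≤ ∫⁻ y, C₃ * (oscKernel a A δ β b D x y * ‖f y‖ₑ +
              oscKernel a A δ β b D y x * ‖f y‖ₑ) ∂(gaussMeasure n) := setLIntegral_le_lintegral _ _
        _ = _ := by
            rw [lintegral_const_mul' _ _ ENNReal.coe_ne_top,
              lintegral_add_left (f := fun y => oscKernel a A δ β b D x y * ‖f y‖ₑ)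
                ((hk.of_uncurry_left (x := x)).mul hfm)]
    calc ∫⁻ x, sublinComm a β b f x ^ q ∂(gaussMeasure n)
        ≤ ∫⁻ x, (C₃ : ℝ≥0∞) ^ q * (2 ^ (q - 1) * (T₁ x ^ q + T₂ x ^ q)) ∂(gaussMeasure n) := by
          refine lintegral_mono fun x => ?_
          calc _ ≤ (C₃ * (T₁ x + T₂ x)) ^ q := by gcongr; exact hpt x
            _ = (C₃ : ℝ≥0∞) ^ q * (T₁ x + T₂ x) ^ q := ENNReal.mul_rpow_of_nonneg _ _ hq0.le
            _ ≤ _ := by gcongr; exact ENNReal.rpow_add_le_mul_rpow_add_rpow _ _ hq1.le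
      _ = (C₃ : ℝ≥0∞) ^ q * (2 ^ (q - 1) * (∫⁻ x, T₁ x ^ q ∂(gaussMeasure n) +
            ∫⁻ x, T₂ x ^ q ∂(gaussMeasure n))) := by
          rw [lintegral_const_mul' _ _ (ENNReal.rpow_ne_top_of_nonneg hq0.le ENNReal.coe_ne_top),
            lintegral_const_mul' _ _ (two_rpow_ne_top _),
            lintegral_add_left (hT₁m.pow_const q)]
      _ ≤ (C₃ : ℝ≥0∞) ^ q * (2 ^ (q - 1) * ((M * D : ℝ≥0∞) ^ q * F +
            (M * D : ℝ≥0∞) ^ q * F)) := by gcongr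
      _ = (C₃ : ℝ≥0∞) ^ q * (2 ^ (q - 1) * 2 ^ (1 : ℝ)) * (M * D : ℝ≥0∞) ^ q * F := by
          rw [ENNReal.rpow_one]; ring
      _ = _ := by
          rw [← two_rpow_add, sub_add_cancel, ← ENNReal.mul_rpow_of_nonneg _ _ hq0.le,
            ← ENNReal.mul_rpow_of_nonneg _ _ hq0.le]
          congr 2
          push_cast; ring
  have e1 := hb.1.ae_eq_mk
  have e2 := hf.ae_eq_mk
  have := hfin (hb.1.mk b) (hb.congr e1) hb.1.stronglyMeasurable_mk
    (by rwa [← bmoSeminorm_congr e1]) (hf.mk f) hf.stronglyMeasurable_mk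
  have e3 : ∫⁻ x, sublinComm a β b f x ^ q ∂(gaussMeasure n) =
      ∫⁻ x, sublinComm a β (hb.1.mk b) (hf.mk f) x ^ q ∂(gaussMeasure n) :=
    lintegral_congr_ae ((sublinComm_congr (a := a) (β := β) e1 e2).mono fun x hx => by simp only [hx])
  have e4 : ∫⁻ x, ‖f x‖ₑ ^ p ∂(gaussMeasure n) = ∫⁻ x, ‖hf.mk f x‖ₑ ^ p ∂(gaussMeasure n) :=
    lintegral_congr_ae (e2.mono fun x hx => by simp only [← hx])
  rw [e3, e4]
  exact this

end GaussBMO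

namespace GaussBMO

open Metric

variable {n : ℕ} {𝕜 : Type*} [RCLike 𝕜]

/-- The `L^p → L^q` bound for the sublinear commutator. -/
theorem exists_eLpNorm_sublinComm_le {n : ℕ} (hn : 1 ≤ n) (𝕜 : Type*) [RCLike 𝕜]
    {a β p q : ℝ} (ha : 0 < a) (hβ : 0 < β) (hβ1 : β < 1) (hp : 1 < p) (hpq : p < q)
    (h : 1 / q = 1 / p - β) : ∃ C : ℝ≥0,
    ∀ (b : EuclideanSpace ℝ (Fin n) → 𝕜), IsBMO b →
    ∀ f : EuclideanSpace ℝ (Fin n) → 𝕜, MemLp f (ENNReal.ofReal p) (gaussMeasure n) →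
      eLpNorm (sublinComm a β b f) (ENNReal.ofReal q) (gaussMeasure n) ≤
        C * bmoSeminorm b * eLpNorm f (ENNReal.ofReal p) (gaussMeasure n) := by
  obtain ⟨C, hC⟩ := exists_lintegral_sublinComm_rpow_le hn 𝕜 ha hβ hβ1 hp hpq h
  have hp0 : 0 < p := by linarith
  have hq0 : 0 < q := by linarith
  refine ⟨C, fun b hb f hf => ?_⟩
  have hF := hf.2.ne
  obtain ⟨N, hN⟩ : ∃ N : ℝ≥0, (N : ℝ≥0∞) = bmoSeminorm b := ⟨_, ENNReal.coe_toNNReal hb.2.ne⟩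
  have e1 : eLpNorm (sublinComm a β b f) (ENNReal.ofReal q) (gaussMeasure n) =
      (∫⁻ x, sublinComm a β b f x ^ q ∂(gaussMeasure n)) ^ (1 / q) := by
    rw [eLpNorm_eq_lintegral_rpow_enorm_toReal (by simpa using hq0) (by simp)]
    simp [ENNReal.toReal_ofReal hq0.le]
  have e2 : eLpNorm f (ENNReal.ofReal p) (gaussMeasure n) =
      (∫⁻ x, ‖f x‖ₑ ^ p ∂(gaussMeasure n)) ^ (1 / p) := by
    rw [eLpNorm_eq_lintegral_rpow_enorm_toReal (by simpa using hp0) (by simp)]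
    simp [ENNReal.toReal_ofReal hp0.le]
  have key : ∀ D : ℝ≥0, 0 < D → N ≤ D →
      eLpNorm (sublinComm a β b f) (ENNReal.ofReal q) (gaussMeasure n) ≤
        C * D * eLpNorm f (ENNReal.ofReal p) (gaussMeasure n) := by
    intro D hD hND
    have h1 := hC b hb.1 D hD (by rw [← hN]; exact_mod_cast hND) f hf.1
    rw [e1, e2]
    calc _ ≤ ((C * D : ℝ≥0∞) ^ q * (∫⁻ x, ‖f x‖ₑ ^ p ∂(gaussMeasure n)) ^ (q / p)) ^ (1 / q) := by
          gcongr
      _ = _ := by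
          rw [ENNReal.mul_rpow_of_nonneg _ _ (by positivity), ← ENNReal.rpow_mul,
            ← ENNReal.rpow_mul, mul_one_div_cancel hq0.ne', ENNReal.rpow_one,
            show q / p * (1 / q) = 1 / p by field_simp]
  obtain ⟨F, hF'⟩ : ∃ F : ℝ≥0, (F : ℝ≥0∞) = eLpNorm f (ENNReal.ofReal p) (gaussMeasure n) :=
    ⟨_, ENNReal.coe_toNNReal hF⟩
  rw [← hF'] at key ⊢
  rw [← hN]
  -- The estimate needs D > 0, whereas ‖b‖_* may vanish; D is taken slightly larger than ‖b‖_* and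
  -- decreased to it.
  refine ENNReal.le_of_forall_pos_le_add fun ε hε _ => ?_
  refine (key (N + ε / (C * F + 1)) (by positivity) le_self_add).trans ?_
  norm_cast
  rw [mul_add, add_mul]
  gcongr
  calc C * (ε / (C * F + 1)) * F = ε * ((C * F) / (C * F + 1)) := by
        rw [mul_div_assoc']; rw [div_mul_eq_mul_div, mul_div_assoc']; congr 1; ring
    _ ≤ ε * 1 := by
        gcongr
        exact div_le_one_of_le₀ le_self_add zero_le
    _ = ε := mul_one ε

lemma sublinComm_add_le (a β : ℝ) {b f g : EuclideanSpace ℝ (Fin n) → 𝕜}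
    (hb : AEStronglyMeasurable b (gaussMeasure n)) (hf : AEStronglyMeasurable f (gaussMeasure n))
    (x : EuclideanSpace ℝ (Fin n)) :
    sublinComm a β b (f + g) x ≤ sublinComm a β b f x + sublinComm a β b g x := by
  have hm : AEMeasurable (fun y => ‖b x - b y‖ₑ * ‖f y‖ₑ /
      gaussMeasure n (ball x ‖x - y‖) ^ (1 - β)) (gaussMeasure n) := by
    have hV : Measurable fun y => gaussMeasure n (ball x ‖x - y‖) := by
      have hs : MeasurableSet {z : EuclideanSpace ℝ (Fin n) × EuclideanSpace ℝ (Fin n) |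
          dist z.2 x < ‖x - z.1‖} := measurableSet_lt (by fun_prop) (by fun_prop)
      exact measurable_measure_prodMk_left hs
    exact ((aestronglyMeasurable_const.sub hb).enorm.mul hf.enorm).div
      (hV.pow_const _).aemeasurable
  unfold sublinComm
  rw [← lintegral_add_left' hm.restrict]
  refine lintegral_mono fun y => ?_
  rw [← ENNReal.add_div, ← mul_add, Pi.add_apply]
  gcongr
  exact enorm_add_le _ _

lemma sublinComm_const_smul (a β : ℝ) (b f : EuclideanSpace ℝ (Fin n) → 𝕜) (c : 𝕜)
    (x : EuclideanSpace ℝ (Fin n)) :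
    sublinComm a β b (c • f) x = ‖c‖ₑ * sublinComm a β b f x := by
  unfold sublinComm
  rw [← lintegral_const_mul' _ _ enorm_ne_top]
  refine lintegral_congr fun y => ?_
  rw [Pi.smul_apply, smul_eq_mul, enorm_mul, div_eq_mul_inv, div_eq_mul_inv]
  ring

/-! ### The extension to `L^p` -/

section Extension

variable {p q : ℝ≥0∞} [Fact (1 ≤ q)]

/-- Subadditivity gives Tf - Tg ≤ T(f - g), and homogeneity with c = -1 makes the right side
symmetric in f and g, so |Tf - Tg| ≤ T(f - g). -/
lemma IsSublinear.norm_sub_le {T : Lp 𝕜 p (gaussMeasure n) → Lp ℝ q (gaussMeasure n)}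
    (hT : IsSublinear T) {K : ℝ} (hK : ∀ f, ‖T f‖ ≤ K * ‖f‖) (f g : Lp 𝕜 p (gaussMeasure n)) :
    ‖T f - T g‖ ≤ K * ‖f - g‖ := by
  have hsub : ∀ f g, T f - T g ≤ T (f - g) := by
    intro f g
    have := hT.add_le (f - g) g
    rw [sub_add_cancel] at this
    exact sub_le_iff_le_add.2 this
  have hneg : T (g - f) = T (f - g) := by
    have := hT.smul (-1) (f - g)
    simpa using this
  refine le_trans (norm_le_norm_of_abs_le_abs ?_) (hK (f - g))
  rw [abs_of_nonneg (hT.nonneg (f - g))]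
  refine abs_le'.2 ⟨hsub f g, ?_⟩
  rw [neg_sub, ← hneg]
  exact hsub g f

lemma IsSublinear.continuous [Fact (1 ≤ p)] {T : Lp 𝕜 p (gaussMeasure n) → Lp ℝ q (gaussMeasure n)}
    (hT : IsSublinear T) {K : ℝ} (hK : ∀ f, ‖T f‖ ≤ K * ‖f‖) : Continuous T := by
  have : LipschitzWith K.toNNReal T := by
    refine LipschitzWith.of_dist_le_mul fun f g => ?_
    rw [dist_eq_norm, dist_eq_norm]
    exact (hT.norm_sub_le hK f g).trans (by gcongr; exact Real.le_coe_toNNReal K)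
  exact this.continuous

/-- Already the continuous functions with compact support are dense, since p is finite. -/
lemma dense_isLcInfty [Fact (1 ≤ p)] (hp : p ≠ ∞) : Dense {g : Lp 𝕜 p (gaussMeasure n) |
    ∃ f : EuclideanSpace ℝ (Fin n) → 𝕜, IsLcInfty f ∧ g =ᵐ[gaussMeasure n] f} := by
  refine Metric.dense_iff.2 fun g r hr => ?_
  obtain ⟨f, hfc, hfg, hfcont, hfp⟩ := (Lp.memLp g).exists_hasCompactSupport_eLpNorm_sub_le hp
    (ε := ENNReal.ofReal (r / 2)) (by simpa using hr)
  refine ⟨hfp.toLp f, ?_, f, ⟨hfcont.memLp_top_of_hasCompactSupport hfc _, hfc⟩, hfp.coeFn_toLp⟩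
  rw [mem_ball, dist_comm, Lp.dist_def]
  have : eLpNorm (⇑g - ⇑(hfp.toLp f)) p (gaussMeasure n) ≤ ENNReal.ofReal (r / 2) := by
    refine le_trans (le_of_eq (eLpNorm_congr_ae ?_)) hfg
    filter_upwards [hfp.coeFn_toLp] with x hx
    simp [hx]
  calc _ ≤ (ENNReal.ofReal (r / 2)).toReal := ENNReal.toReal_mono (by simp) this
    _ = r / 2 := ENNReal.toReal_ofReal (by linarith)
    _ < r := by linarith

lemma ExtendsSublinComm.eq_of_continuous [Fact (1 ≤ p)] (hp : p ≠ ∞) {a β : ℝ}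
    {b : EuclideanSpace ℝ (Fin n) → 𝕜}
    {T T' : Lp 𝕜 p (gaussMeasure n) → Lp ℝ q (gaussMeasure n)}
    (hT : ExtendsSublinComm a β b T) (hT' : ExtendsSublinComm a β b T') (hc : Continuous T)
    (hc' : Continuous T') : T' = T := by
  refine hc'.ext_on (dense_isLcInfty hp) hc ?_
  rintro g ⟨f, hf, hgf⟩
  exact Lp.ext ((hT' g f hf hgf).trans (hT g f hf hgf).symm)

/-- An `L^p → L^q` estimate for the sublinear commutator gives its extension to `L^p`. -/
theorem exists_extension_sublinComm {a β : ℝ} {b : EuclideanSpace ℝ (Fin n) → 𝕜} (hb : IsBMO b)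
    (hq : q ≠ ∞) {C : ℝ≥0}
    (h : ∀ f : EuclideanSpace ℝ (Fin n) → 𝕜, MemLp f p (gaussMeasure n) →
      eLpNorm (sublinComm a β b f) q (gaussMeasure n) ≤
        C * bmoSeminorm b * eLpNorm f p (gaussMeasure n)) :
    ∃ T : Lp 𝕜 p (gaussMeasure n) → Lp ℝ q (gaussMeasure n),
      ExtendsSublinComm a β b T ∧ IsSublinear T ∧
        ∀ f, ‖T f‖ ≤ C * (bmoSeminorm b).toReal * ‖f‖ := by
  have hq0 : q ≠ 0 := (zero_lt_one.trans_le (Fact.out : 1 ≤ q)).ne'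
  have hbm := hb.1.1
  have hfin : ∀ f : Lp 𝕜 p (gaussMeasure n),
      C * bmoSeminorm b * eLpNorm f p (gaussMeasure n) ≠ ∞ := fun f =>
    ENNReal.mul_ne_top (ENNReal.mul_ne_top ENNReal.coe_ne_top hb.2.ne) (Lp.eLpNorm_ne_top f)
  have hle : ∀ f : Lp 𝕜 p (gaussMeasure n),
      eLpNorm (fun x => (sublinComm a β b f x).toReal) q (gaussMeasure n) ≤
        C * bmoSeminorm b * eLpNorm f p (gaussMeasure n) := fun f => by
    refine le_trans (eLpNorm_mono_enorm fun x => ?_) (h f (Lp.memLp f))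
    rw [Real.enorm_of_nonneg ENNReal.toReal_nonneg, enorm_eq_self]
    exact ENNReal.ofReal_toReal_le
  have hmem : ∀ f : Lp 𝕜 p (gaussMeasure n),
      MemLp (fun x => (sublinComm a β b f x).toReal) q (gaussMeasure n) := fun f =>
    ⟨(aemeasurable_sublinComm hbm (Lp.aestronglyMeasurable f)).ennreal_toReal.aestronglyMeasurable,
      (hle f).trans_lt (hfin f).lt_top⟩
  -- Finiteness almost everywhere is what lets the pointwise inequality in `ℝ≥0∞` survive `toReal`,
  -- whose value at ∞ is 0.
  have haefin : ∀ f : Lp 𝕜 p (gaussMeasure n),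
      ∀ᵐ x ∂(gaussMeasure n), sublinComm a β b f x ≠ ∞ := by
    intro f
    have h1 : eLpNorm (sublinComm a β b f) q (gaussMeasure n) < ∞ :=
      (h f (Lp.memLp f)).trans_lt (hfin f).lt_top
    have h2 := lintegral_rpow_enorm_lt_top_of_eLpNorm_lt_top hq0 hq h1
    have hqr : 0 < q.toReal := ENNReal.toReal_pos hq0 hq
    filter_upwards [ae_lt_top' ((aemeasurable_sublinComm hbm
      (Lp.aestronglyMeasurable f)).enorm.pow_const _) h2.ne] with x hx
    rw [enorm_eq_self] at hx
    intro h0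
    rw [h0, ENNReal.top_rpow_of_pos hqr] at hx
    exact lt_irrefl _ hx
  refine ⟨fun f => (hmem f).toLp _, ?_, ⟨?_, ?_, ?_⟩, ?_⟩
  · intro g f hf hgf
    refine (hmem g).coeFn_toLp.trans ?_
    filter_upwards [sublinComm_congr (a := a) (β := β) (Filter.EventuallyEq.refl _ b) hgf] with x hx
    rw [hx]
  · intro f
    rw [← Lp.coeFn_nonneg]
    filter_upwards [(hmem f).coeFn_toLp] with x hx
    rw [hx]
    exact ENNReal.toReal_nonneg
  · intro f g
    rw [← Lp.coeFn_le]
    filter_upwards [(hmem (f + g)).coeFn_toLp, (hmem f).coeFn_toLp, (hmem g).coeFn_toLp,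
      Lp.coeFn_add ((hmem f).toLp _) ((hmem g).toLp _), haefin f, haefin g,
      sublinComm_congr (a := a) (β := β) (Filter.EventuallyEq.refl _ b) (Lp.coeFn_add f g)]
      with x h1 h2 h3 h4 h5 h6 h7
    rw [h1, h4, Pi.add_apply, h2, h3, h7, ← ENNReal.toReal_add h5 h6]
    exact ENNReal.toReal_mono (ENNReal.add_ne_top.2 ⟨h5, h6⟩)
      (sublinComm_add_le a β hbm (Lp.aestronglyMeasurable f) x)
  · intro c f
    refine Lp.ext ?_
    filter_upwards [(hmem (c • f)).coeFn_toLp, (hmem f).coeFn_toLp,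
      Lp.coeFn_smul ‖c‖ ((hmem f).toLp _),
      sublinComm_congr (a := a) (β := β) (Filter.EventuallyEq.refl _ b) (Lp.coeFn_smul c f)]
      with x h1 h2 h3 h4
    rw [h1, h3, Pi.smul_apply, h2, h4, sublinComm_const_smul, ENNReal.toReal_mul, toReal_enorm,
      smul_eq_mul]
  · intro f
    rw [Lp.norm_toLp, Lp.norm_def]
    refine (ENNReal.toReal_mono (hfin f) (hle f)).trans (le_of_eq ?_)
    rw [ENNReal.toReal_mul, ENNReal.toReal_mul, ENNReal.coe_toReal]

end Extension

lemma IsLcInfty.memLp {f : EuclideanSpace ℝ (Fin n) → 𝕜} (hf : IsLcInfty f) (p : ℝ≥0∞) :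
    MemLp f p (gaussMeasure n) :=
  hf.1.mono_exponent le_top

end GaussBMO

namespace GaussBMO

open Metric

variable {n : ℕ} {𝕜 : Type*} [RCLike 𝕜]

/-! ### Lower bounds for the commutator of the local fractional integral -/

/-- The median is the infimum of the t with ν{h ≤ t} at least half the total mass. Continuity of ν
from above gives the first inequality, from below the second. -/
lemma exists_median {α : Type*} [MeasurableSpace α] (ν : Measure α) [IsFiniteMeasure ν]
    {h : α → ℝ} (hh : Measurable h) :
    ∃ m : ℝ, ν Set.univ ≤ 2 * ν {x | h x ≤ m} ∧ ν Set.univ ≤ 2 * ν {x | m ≤ h x} := by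
  rcases eq_or_ne (ν Set.univ) 0 with h0 | h0
  · exact ⟨0, by rw [h0]; exact zero_le, by rw [h0]; exact zero_le⟩
  set T := ν Set.univ with hT
  have hTt : T ≠ ∞ := measure_ne_top _ _
  have hhalf : T / 2 < T := ENNReal.half_lt_self h0 hTt
  have hhalf0 : 0 < T / 2 := ENNReal.half_pos h0
  set S : Set ℝ := {t | T ≤ 2 * ν {x | h x ≤ t}} with hS
  have hle : ∀ X : ℝ≥0∞, T ≤ 2 * X ↔ T / 2 ≤ X := fun X => by
    rw [ENNReal.div_le_iff two_ne_zero (by simp), mul_comm]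
  have hmono : ∀ s t : ℝ, s ≤ t → s ∈ S → t ∈ S := fun s t hst hs =>
    le_trans (show T ≤ _ from hs) (by gcongr)
  have hne : S.Nonempty := by
    have hU : (⋃ k : ℕ, {x | h x ≤ k}) = Set.univ := by
      refine Set.eq_univ_of_forall fun x => Set.mem_iUnion.2 ?_
      obtain ⟨k, hk⟩ := exists_nat_ge (h x)
      exact ⟨k, hk⟩
    have hm : Monotone fun k : ℕ => {x | h x ≤ k} := fun k l hkl x hx =>
      le_trans (show h x ≤ k from hx) (by exact_mod_cast hkl)
    have hsup := hm.measure_iUnion (μ := ν)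
    rw [hU] at hsup
    rw [← hT] at hsup
    rw [hsup] at hhalf
    obtain ⟨k, hk⟩ := lt_iSup_iff.1 hhalf
    refine ⟨k, (hle _).2 ?_⟩
    rw [hsup]; exact hk.le
  have hbdd : BddBelow S := by
    have hI : (⋂ k : ℕ, {x | h x ≤ -(k : ℝ)}) = ∅ := by
      refine Set.eq_empty_of_forall_notMem fun x hx => ?_
      obtain ⟨k, hk⟩ := exists_nat_gt (-h x)
      have : h x ≤ -(k : ℝ) := Set.mem_iInter.1 hx k
      linarith
    have hm : Antitone fun k : ℕ => {x | h x ≤ -(k : ℝ)} := fun k l hkl x hx => by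
      have h1 : h x ≤ -(l : ℝ) := hx
      have h2 : (k : ℝ) ≤ l := by exact_mod_cast hkl
      exact h1.trans (by linarith)
    have hinf := hm.measure_iInter (μ := ν)
      (fun k => (measurableSet_le hh measurable_const).nullMeasurableSet)
      ⟨0, measure_ne_top _ _⟩
    rw [hI, measure_empty] at hinf
    rw [hinf] at hhalf0
    obtain ⟨k, hk⟩ := iInf_lt_iff.1 hhalf0
    refine ⟨-(k : ℝ), fun t ht => ?_⟩
    by_contra! hlt
    exact absurd ((hle _).1 (hmono t _ hlt.le ht)) (not_le.2 hk)
  set m := sInf S with hm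
  have habove : ∀ t, m < t → t ∈ S := fun t ht => by
    obtain ⟨s, hs, hst⟩ := (csInf_lt_iff hbdd hne).1 ht
    exact hmono s t hst.le hs
  refine ⟨m, ?_, ?_⟩
  · have hI : {x | h x ≤ m} = ⋂ k : ℕ, {x | h x ≤ m + 1 / ((k : ℝ) + 1)} := by
      ext x
      simp only [Set.mem_ofPred_eq, Set.mem_iInter]
      refine ⟨fun hx k => hx.trans (le_add_of_nonneg_right (by positivity)), fun hx => ?_⟩
      refine le_of_forall_pos_le_add fun ε hε => ?_
      obtain ⟨k, hk⟩ := exists_nat_one_div_lt hε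
      exact (hx k).trans (by linarith)
    have hanti : Antitone fun k : ℕ => {x | h x ≤ m + 1 / ((k : ℝ) + 1)} := fun k l hkl x hx => by
      have h1 : h x ≤ m + 1 / ((l : ℝ) + 1) := hx
      have h2 : 1 / ((l : ℝ) + 1) ≤ 1 / ((k : ℝ) + 1) := Nat.one_div_le_one_div hkl
      exact h1.trans (by linarith)
    rw [hle, hI, hanti.measure_iInter
      (fun k => (measurableSet_le hh measurable_const).nullMeasurableSet) ⟨0, measure_ne_top _ _⟩]
    exact le_iInf fun k => (hle _).1 (habove _ (lt_add_of_pos_right m Nat.one_div_pos_of_nat))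
  · have hU : {x | h x < m} = ⋃ k : ℕ, {x | h x ≤ m - 1 / ((k : ℝ) + 1)} := by
      ext x
      simp only [Set.mem_ofPred_eq, Set.mem_iUnion]
      refine ⟨fun hx => ?_, fun ⟨k, hk⟩ => hk.trans_lt (sub_lt_self m Nat.one_div_pos_of_nat)⟩
      obtain ⟨k, hk⟩ := exists_nat_one_div_lt (sub_pos.2 hx)
      exact ⟨k, by linarith⟩
    have hmon : Monotone fun k : ℕ => {x | h x ≤ m - 1 / ((k : ℝ) + 1)} := fun k l hkl x hx => by
      have h1 : h x ≤ m - 1 / ((k : ℝ) + 1) := hx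
      have h2 : 1 / ((l : ℝ) + 1) ≤ 1 / ((k : ℝ) + 1) := Nat.one_div_le_one_div hkl
      exact h1.trans (by linarith)
    have hlow : ν {x | h x < m} ≤ T / 2 := by
      rw [hU, hmon.measure_iUnion]
      refine iSup_le fun k => ?_
      by_contra! hlt
      have : m - 1 / ((k : ℝ) + 1) ∈ S := (hle _).2 hlt.le
      have h1 := csInf_le hbdd this
      have h2 : 0 < 1 / ((k : ℝ) + 1) := Nat.one_div_pos_of_nat
      linarith
    have hsplit : T ≤ ν {x | h x < m} + ν {x | m ≤ h x} := by
      refine le_trans (measure_mono fun x _ => ?_) (measure_union_le _ _)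
      exact lt_or_ge (h x) m
    rw [hle]
    have h1 : T / 2 + T / 2 ≤ T / 2 + ν {x | m ≤ h x} := by
      rw [ENNReal.add_halves]; exact hsplit.trans (by gcongr)
    exact (ENNReal.add_le_add_iff_left (by finiteness)).1 h1

lemma fracComm_congr {a β : ℝ} {b b' : EuclideanSpace ℝ (Fin n) → 𝕜}
    (h : b =ᵐ[gaussMeasure n] b') (f : EuclideanSpace ℝ (Fin n) → 𝕜) :
    fracComm a β b f =ᵐ[gaussMeasure n] fracComm a β b' f := by
  filter_upwards [h] with x hx
  unfold fracComm
  rw [hx]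
  congr 1
  refine integral_congr_ae (ae_restrict_of_ae ?_)
  filter_upwards [h] with y hy
  rw [hy]

lemma fracInt_const_mul (a β : ℝ) (c : 𝕜) (f : EuclideanSpace ℝ (Fin n) → 𝕜)
    (x : EuclideanSpace ℝ (Fin n)) :
    fracInt a β (fun y => c * f y) x = c * fracInt a β f x := by
  unfold fracInt
  rw [← integral_const_mul]
  refine integral_congr_ae (Filter.Eventually.of_forall fun y => ?_)
  simp only [mul_smul_comm]

lemma fracComm_const_mul (a β : ℝ) (b : EuclideanSpace ℝ (Fin n) → 𝕜) (c : 𝕜)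
    (f : EuclideanSpace ℝ (Fin n) → 𝕜) :
    fracComm a β b (fun y => c * f y) = c • fracComm a β b f := by
  funext x
  have h : (fun y => b y * (c * f y)) = fun y => c * (b y * f y) := by funext y; ring
  simp only [fracComm, Pi.smul_apply, smul_eq_mul]
  rw [fracInt_const_mul, h, fracInt_const_mul]
  ring

/-- By homogeneity; the operator norm is a supremum over the unit sphere, so f must have nonzero
norm to be rescaled. -/
lemma eLpNorm_fracComm_le (a β : ℝ) (p q : ℝ≥0∞) (b : EuclideanSpace ℝ (Fin n) → 𝕜)
    {f : EuclideanSpace ℝ (Fin n) → 𝕜} (hf : IsLcInfty f)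
    (h0 : eLpNorm f p (gaussMeasure n) ≠ 0) :
    eLpNorm (fracComm a β b f) q (gaussMeasure n) ≤
      fracCommNorm a β p q b * eLpNorm f p (gaussMeasure n) := by
  set N := eLpNorm f p (gaussMeasure n) with hN
  have hNt : N ≠ ∞ := (hf.memLp p).2.ne
  have hNr : 0 < N.toReal := ENNReal.toReal_pos h0 hNt
  set c : 𝕜 := ((N.toReal⁻¹ : ℝ) : 𝕜) with hc
  have hce : ‖c‖ₑ = N⁻¹ := by
    rw [hc, ← ofReal_norm, RCLike.norm_ofReal, abs_of_pos (by positivity),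
      ENNReal.ofReal_inv_of_pos hNr, ENNReal.ofReal_toReal hNt]
  have hg : IsLcInfty (fun y => c * f y) :=
    ⟨hf.1.const_mul c, hf.2.mul_left (f := fun _ => c)⟩
  have hg1 : eLpNorm (fun y => c * f y) p (gaussMeasure n) = 1 := by
    change eLpNorm (c • f) p (gaussMeasure n) = 1
    rw [eLpNorm_const_smul, hce]
    exact ENNReal.inv_mul_cancel h0 hNt
  have h1 : eLpNorm (fracComm a β b fun y => c * f y) q (gaussMeasure n) ≤
      fracCommNorm a β p q b :=
    le_iSup_of_le (f := fun f : EuclideanSpace ℝ (Fin n) → 𝕜 => ⨆ (_ : IsLcInfty f)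
      (_ : eLpNorm f p (gaussMeasure n) = 1), eLpNorm (fracComm a β b f) q (gaussMeasure n))
      (fun y => c * f y) (le_iSup₂_of_le hg hg1 le_rfl)
  rw [fracComm_const_mul, eLpNorm_const_smul, hce, mul_comm, ← div_eq_mul_inv] at h1
  exact (ENNReal.div_le_iff h0 hNt).1 h1

/-- The commutator applied to the indicator of a set at positive distance from `x`. -/
lemma fracComm_indicator {a β : ℝ} (hβ : β < 1) {b : EuclideanSpace ℝ (Fin n) → 𝕜}
    (hb : Integrable b (gaussMeasure n)) {F : Set (EuclideanSpace ℝ (Fin n))}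
    (hF : MeasurableSet F) {x : EuclideanSpace ℝ (Fin n)} (hFx : F ⊆ ball x (a * admScale x))
    {r : ℝ} (hr : 0 < r) (hrF : ∀ y ∈ F, r ≤ ‖x - y‖) :
    IntegrableOn (fun y => ((Real.exp (-‖x‖ ^ 2) * ‖x - y‖ ^ n) ^ (1 - β))⁻¹ • (b x - b y)) F
        (gaussMeasure n) ∧
      fracComm a β b (F.indicator 1) x =
        ∫ y in F, ((Real.exp (-‖x‖ ^ 2) * ‖x - y‖ ^ n) ^ (1 - β))⁻¹ • (b x - b y)
          ∂(gaussMeasure n) := by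
  set k : EuclideanSpace ℝ (Fin n) → ℝ :=
    fun y => ((Real.exp (-‖x‖ ^ 2) * ‖x - y‖ ^ n) ^ (1 - β))⁻¹ with hk
  have hkm : Measurable k := by
    refine Measurable.inv (Measurable.pow_const ?_ _)
    fun_prop
  -- Away from the singularity the kernel is bounded, so both Bochner integrals converge and may be
  -- subtracted.
  have hkb : ∀ y ∈ F, ‖k y‖ ≤ ((Real.exp (-‖x‖ ^ 2) * r ^ n) ^ (1 - β))⁻¹ := by
    intro y hy
    have h1 := hrF y hy
    have h2 : 0 < ‖x - y‖ := hr.trans_le h1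
    rw [Real.norm_of_nonneg (by positivity)]
    have h3 : 0 ≤ 1 - β := by linarith
    simp only [hk]
    gcongr
  have hint : ∀ g : EuclideanSpace ℝ (Fin n) → 𝕜, Integrable g (gaussMeasure n) →
      IntegrableOn (fun y => k y • g y) F (gaussMeasure n) := by
    intro g hg
    refine Integrable.mono' (hg.integrableOn.norm.const_mul
      ((Real.exp (-‖x‖ ^ 2) * r ^ n) ^ (1 - β))⁻¹) ?_ ?_
    · exact hkm.aestronglyMeasurable.smul hg.1.restrict
    · filter_upwards [ae_restrict_mem hF] with y hy
      rw [norm_smul]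
      gcongr
      exact hkb y hy
  have hI : ∀ g : EuclideanSpace ℝ (Fin n) → 𝕜,
      fracInt a β (fun y => g y * F.indicator 1 y) x = ∫ y in F, k y • g y ∂(gaussMeasure n) := by
    intro g
    have : ∀ y, k y • (g y * F.indicator 1 y) = F.indicator (fun y => k y • g y) y := by
      intro y
      by_cases hy : y ∈ F <;> simp [hy]
    simp only [fracInt]
    rw [integral_congr_ae (Filter.Eventually.of_forall this), setIntegral_indicator hF,
      Set.inter_eq_self_of_subset_right hFx]
  have h1 := hint (fun _ => b x) (integrable_const _)
  have h2 := hint b hb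
  refine ⟨(h1.sub h2).congr (Filter.Eventually.of_forall fun y => ?_), ?_⟩
  · simp only [Pi.sub_apply, smul_sub, hk]
  · rw [fracComm, ← fracInt_const_mul, hI, hI, ← integral_sub h1 h2]
    refine integral_congr_ae (Filter.Eventually.of_forall fun y => ?_)
    simp only [smul_sub, hk]

end GaussBMO

namespace GaussBMO

open Metric

variable {n : ℕ} {𝕜 : Type*} [RCLike 𝕜]

/-! ### Boundedness of the commutator implies bounded mean oscillation -/

/-- When L(b x) > m, every y in F gives L(b x - b y) ≥ L(b x) - m > 0, so there is no cancellation,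
and the kernel is at least its value at distance R. -/
lemma ofReal_sub_mul_le_enorm_fracComm_indicator {a β : ℝ} (hβ : β < 1)
    {b : EuclideanSpace ℝ (Fin n) → 𝕜} (hb : Integrable b (gaussMeasure n)) {L : 𝕜 →L[ℝ] ℝ}
    (hL : ∀ z, ‖L z‖ ≤ ‖z‖) {F : Set (EuclideanSpace ℝ (Fin n))} (hF : MeasurableSet F)
    {x : EuclideanSpace ℝ (Fin n)} (hFx : F ⊆ ball x (a * admScale x)) {r R : ℝ} (hr : 0 < r)
    (hR : 0 < R) (hrF : ∀ y ∈ F, r ≤ ‖x - y‖) (hRF : ∀ y ∈ F, ‖x - y‖ ≤ R) {m : ℝ}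
    (hm : ∀ y ∈ F, L (b y) ≤ m) :
    ENNReal.ofReal (L (b x) - m) * (weight x R ^ (β - 1) * gaussMeasure n F) ≤
      ‖fracComm a β b (F.indicator 1) x‖ₑ := by
  rcases le_or_gt (L (b x) - m) 0 with h0 | h0
  · rw [ENNReal.ofReal_of_nonpos h0, zero_mul]; exact zero_le
  obtain ⟨hint, heq⟩ := fracComm_indicator hβ hb hF hFx hr hrF
  have hβ' : 0 ≤ 1 - β := by linarith
  set κ : ℝ := ((Real.exp (-‖x‖ ^ 2) * R ^ n) ^ (1 - β))⁻¹ with hκ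
  have hκ0 : 0 ≤ κ := by positivity
  have hw : weight x R ^ (β - 1) = ENNReal.ofReal κ := by
    have h1 : 0 < Real.exp (-‖x‖ ^ 2) * R ^ n := by positivity
    rw [weight, ENNReal.ofReal_rpow_of_pos h1, hκ, ← Real.rpow_neg h1.le, neg_sub]
  have hlow : κ * (L (b x) - m) * (gaussMeasure n).real F ≤
      L (fracComm a β b (F.indicator 1) x) := by
    rw [heq, ← L.integral_comp_comm hint]
    have h1 : κ * (L (b x) - m) * (gaussMeasure n).real F =
        ∫ _ in F, κ * (L (b x) - m) ∂(gaussMeasure n) := by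
      rw [setIntegral_const, smul_eq_mul, mul_comm]
    rw [h1]
    refine setIntegral_mono_on (integrable_const _) (L.integrable_comp hint) hF fun y hy => ?_
    have h2 : 0 < ‖x - y‖ := hr.trans_le (hrF y hy)
    have h3 : κ ≤ ((Real.exp (-‖x‖ ^ 2) * ‖x - y‖ ^ n) ^ (1 - β))⁻¹ := by
      rw [hκ]
      have := hRF y hy
      gcongr
    rw [map_smul, map_sub, smul_eq_mul]
    refine mul_le_mul h3 (by linarith [hm y hy]) h0.le (by positivity)
  calc _ = ENNReal.ofReal (κ * (L (b x) - m) * (gaussMeasure n).real F) := by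
        rw [ENNReal.ofReal_mul (by positivity), ENNReal.ofReal_mul hκ0, hw, Measure.real,
          ENNReal.ofReal_toReal (measure_ne_top _ _)]
        ring
    _ ≤ ENNReal.ofReal ‖fracComm a β b (F.indicator 1) x‖ :=
        ENNReal.ofReal_le_ofReal (hlow.trans ((le_abs_self _).trans (hL _)))
    _ = _ := ofReal_norm _

lemma isLcInfty_indicator_one {F : Set (EuclideanSpace ℝ (Fin n))} (hF : MeasurableSet F)
    {c : EuclideanSpace ℝ (Fin n)} {r : ℝ} (hFc : F ⊆ ball c r) :
    IsLcInfty (F.indicator (1 : EuclideanSpace ℝ (Fin n) → 𝕜)) := by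
  refine ⟨memLp_indicator_const ∞ hF 1 (Or.inr (measure_ne_top _ _)), ?_⟩
  refine HasCompactSupport.intro (isCompact_closedBall c r) fun x hx => ?_
  exact Set.indicator_of_notMem (fun h => hx (ball_subset_closedBall (hFc h))) _

/-- The `L¹` form of the `L^q` bound for the commutator of an indicator function. -/
lemma lintegral_enorm_fracComm_indicator_le {a β p q : ℝ} (hp : 1 < p) (hq : 1 < q)
    {b : EuclideanSpace ℝ (Fin n) → 𝕜}
    (hb : FracCommBounded a β (ENNReal.ofReal p) (ENNReal.ofReal q) b)
    {F : Set (EuclideanSpace ℝ (Fin n))} (hF : MeasurableSet F) (hF0 : gaussMeasure n F ≠ 0)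
    {c' : EuclideanSpace ℝ (Fin n)} {r : ℝ} (hFc : F ⊆ ball c' r)
    (B : Set (EuclideanSpace ℝ (Fin n))) :
    ∫⁻ x in B, ‖fracComm a β b (F.indicator 1) x‖ₑ ∂(gaussMeasure n) ≤
      fracCommNorm a β (ENNReal.ofReal p) (ENNReal.ofReal q) b *
        gaussMeasure n F ^ (1 / p) * gaussMeasure n B ^ (1 - 1 / q) := by
  have hf := isLcInfty_indicator_one (𝕜 := 𝕜) hF hFc
  obtain ⟨K, hK⟩ := hb
  obtain ⟨hmem, -⟩ := hK _ hf
  have hN : eLpNorm (F.indicator (1 : EuclideanSpace ℝ (Fin n) → 𝕜)) (ENNReal.ofReal p)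
      (gaussMeasure n) = gaussMeasure n F ^ (1 / p) := by
    have h1 := eLpNorm_indicator_const (μ := gaussMeasure n) (c := (1 : 𝕜)) hF
      (p := ENNReal.ofReal p) (by simp; linarith) (by simp)
    rw [enorm_one, one_mul, ENNReal.toReal_ofReal (by linarith)] at h1
    exact h1
  have hN0 : gaussMeasure n F ^ (1 / p) ≠ 0 :=
    (ENNReal.rpow_pos (pos_iff_ne_zero.2 hF0) (measure_ne_top _ _)).ne'
  have h1 := eLpNorm_fracComm_le a β (ENNReal.ofReal p) (ENNReal.ofReal q) b hf (hN ▸ hN0)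
  have h2 := eLpNorm_le_eLpNorm_mul_rpow_measure_univ (μ := (gaussMeasure n).restrict B)
    (p := 1) (q := ENNReal.ofReal q) (by simpa using hq.le) hmem.1.restrict
  rw [eLpNorm_one_eq_lintegral_enorm, Measure.restrict_apply_univ,
    ENNReal.toReal_ofReal (by linarith), ENNReal.toReal_one, div_one] at h2
  refine h2.trans ?_
  gcongr
  exact (eLpNorm_mono_measure _ Measure.restrict_le_self).trans (h1.trans_eq (by rw [hN]))

/-- For x in B(c, r) and y in B(c', r) one has r ≤ |x - y| < 5r, and m(c) ≤ 2m(x). The bounds 1/10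
and a/10 then place 5r below m(x) and below a·m(x). Integrating the pointwise lower bound and using
the L^q estimate, the powers of the measure of the ball combine to the first power because 1/q = 1/p
- β. -/
lemma exists_lintegral_ofReal_sub_le (n : ℕ) (𝕜 : Type*) [RCLike 𝕜] {a β p q : ℝ} (ha : 0 < a)
    (hβ1 : β < 1) (hp : 1 < p) (hq : 1 < q) (h : 1 / q = 1 / p - β) :
    ∃ C : ℝ≥0, ∀ b : EuclideanSpace ℝ (Fin n) → 𝕜, Integrable b (gaussMeasure n) →
      FracCommBounded a β (ENNReal.ofReal p) (ENNReal.ofReal q) b →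
      ∀ L : 𝕜 →L[ℝ] ℝ, (∀ z, ‖L z‖ ≤ ‖z‖) → ∀ (c c' : EuclideanSpace ℝ (Fin n)) (r : ℝ),
      IsAdmissible (min (1 / 10) (a / 10)) c r → dist c c' = 3 * r →
      ∀ F ⊆ ball c' r, MeasurableSet F → gaussMeasure n (ball c' r) ≤ 2 * gaussMeasure n F →
      ∀ m : ℝ, (∀ y ∈ F, L (b y) ≤ m) →
        ∫⁻ x in ball c r, ENNReal.ofReal (L (b x) - m) ∂(gaussMeasure n) ≤
          C * fracCommNorm a β (ENNReal.ofReal p) (ENNReal.ofReal q) b *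
            gaussMeasure n (ball c r) := by
  obtain ⟨C₁, hC₁, hcomp⟩ := exists_gaussMeasure_ball_comparable n (A := 1) zero_le_one
  obtain ⟨C₂, hC₂, hball⟩ := exists_gaussMeasure_ball_le n (A := 1) (t := 5) zero_le_one
    (by norm_num)
  have hβ' : 0 ≤ 1 - β := by linarith
  have hp' : 0 ≤ 1 - 1 / p := by
    have : 1 / p ≤ 1 := by rw [div_le_one (by linarith)]; exact hp.le
    linarith
  refine ⟨(2 * C₂) ^ (1 - 1 / p) * (C₁ * C₂) ^ (1 - β), ?_⟩
  intro b hb hbd L hL c c' r hcr hcc F hFc hF hF2 m hm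
  obtain ⟨hr, hrc⟩ := hcr
  have hmc := admScale_pos c
  have hr1 : r ≤ 1 / 10 * admScale c := hrc.trans (by gcongr; exact min_le_left _ _)
  have hr2 : r ≤ a / 10 * admScale c := hrc.trans (by gcongr; exact min_le_right _ _)
  set γ := gaussMeasure n
  set G := fracCommNorm a β (ENNReal.ofReal p) (ENNReal.ofReal q) b
  set U := γ (ball c r) with hU
  set W := γ F with hW
  have hU0 : U ≠ 0 := (gaussMeasure_ball_pos c hr).ne'
  have hUt : U ≠ ∞ := measure_ne_top _ _
  have hUW : U ≤ (2 * C₂ : ℝ≥0) * W := by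
    have hc' : admScale c ≤ (1 + 1) * admScale c' :=
      admScale_le_mul_of_dist_le zero_le_one (by linarith)
    calc U ≤ C₂ * γ (ball c' r) :=
          hball c c' r r (by linarith) (by linarith) hr (by linarith) (by linarith)
      _ ≤ C₂ * (2 * W) := by gcongr
      _ = _ := by push_cast; ring
  have hW0 : W ≠ 0 := by
    rintro h0
    rw [h0, mul_zero] at hUW
    exact hU0 (le_antisymm hUW zero_le)
  have hWt : W ≠ ∞ := measure_ne_top _ _
  have hpt : ∀ x ∈ ball c r, ENNReal.ofReal (L (b x) - m) * (U ^ (β - 1) * W) ≤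
      ((C₁ * C₂ : ℝ≥0) : ℝ≥0∞) ^ (1 - β) * ‖fracComm a β b (F.indicator 1) x‖ₑ := by
    intro x hx
    have hxc : dist x c < r := hx
    have hmx : admScale c ≤ (1 + 1) * admScale x :=
      admScale_le_mul_of_dist_le zero_le_one (by rw [dist_comm]; linarith)
    have hmx0 := admScale_pos x
    have hup : ∀ y ∈ F, ‖x - y‖ < 5 * r := fun y hy => by
      have h1 : dist y c' < r := hFc hy
      rw [← dist_eq_norm]
      have := dist_triangle4 x c c' y
      rw [dist_comm c' y] at this
      linarith
    have hlo : ∀ y ∈ F, r ≤ ‖x - y‖ := fun y hy => by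
      have h1 : dist y c' < r := hFc hy
      rw [← dist_eq_norm]
      have := dist_triangle4 c x y c'
      rw [dist_comm c x] at this
      linarith
    have hFx : F ⊆ ball x (a * admScale x) := fun y hy => by
      rw [mem_ball, dist_comm, dist_eq_norm]
      refine (hup y hy).trans_le ?_
      have : a / 10 * admScale c ≤ a / 10 * ((1 + 1) * admScale x) := by gcongr
      linarith
    have hkey := ofReal_sub_mul_le_enorm_fracComm_indicator hβ1 hb hL hF hFx hr
      (R := 5 * r) (by positivity) hlo (fun y hy => (hup y hy).le) hm
    have hwU : weight x (5 * r) ≤ ((C₁ * C₂ : ℝ≥0) : ℝ≥0∞) * U := by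
      calc weight x (5 * r) ≤ C₁ * γ (ball x (5 * r)) :=
            (hcomp x (5 * r) (by positivity) (by linarith)).2
        _ ≤ C₁ * (C₂ * U) := by
            gcongr
            exact hball x c (5 * r) r (by linarith) (by linarith) hr (by linarith) le_rfl
        _ = _ := by push_cast; ring
    have hUp := rpow_sub_one_le_of_le_mul hβ1.le (by positivity) hwU
    calc _ ≤ ENNReal.ofReal (L (b x) - m) *
          (((C₁ * C₂ : ℝ≥0) : ℝ≥0∞) ^ (1 - β) * weight x (5 * r) ^ (β - 1) * W) := by gcongr
      _ = ((C₁ * C₂ : ℝ≥0) : ℝ≥0∞) ^ (1 - β) * (ENNReal.ofReal (L (b x) - m) *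
          (weight x (5 * r) ^ (β - 1) * W)) := by ring
      _ ≤ _ := by gcongr
  set X := ∫⁻ x in ball c r, ENNReal.ofReal (L (b x) - m) ∂γ with hX
  have hUβ : U ^ (β - 1) ≠ ∞ := ENNReal.rpow_ne_top_of_ne_zero hU0 hUt
  have hint : X * (U ^ (β - 1) * W) ≤ ((C₁ * C₂ : ℝ≥0) : ℝ≥0∞) ^ (1 - β) *
      (G * W ^ (1 / p) * U ^ (1 - 1 / q)) := by
    calc X * (U ^ (β - 1) * W) =
          ∫⁻ x in ball c r, ENNReal.ofReal (L (b x) - m) * (U ^ (β - 1) * W) ∂γ :=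
          (lintegral_mul_const' _ _ (ENNReal.mul_ne_top hUβ hWt)).symm
      _ ≤ ∫⁻ x in ball c r, ((C₁ * C₂ : ℝ≥0) : ℝ≥0∞) ^ (1 - β) *
          ‖fracComm a β b (F.indicator 1) x‖ₑ ∂γ := setLIntegral_mono' measurableSet_ball hpt
      _ = ((C₁ * C₂ : ℝ≥0) : ℝ≥0∞) ^ (1 - β) *
          ∫⁻ x in ball c r, ‖fracComm a β b (F.indicator 1) x‖ₑ ∂γ :=
          lintegral_const_mul' _ _ (ENNReal.rpow_ne_top_of_nonneg hβ' ENNReal.coe_ne_top)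
      _ ≤ _ := by
          gcongr
          exact lintegral_enorm_fracComm_indicator_le hp hq hbd hF hW0 hFc _
  -- The exponent is negative, so a lower bound for γ(F), here half of the second ball, is what is
  -- needed.
  have hWp : W ^ (1 / p - 1) ≤ ((2 * C₂ : ℝ≥0) : ℝ≥0∞) ^ (1 - 1 / p) * U ^ (1 / p - 1) :=
    rpow_sub_one_le_of_le_mul (by linarith) (by positivity) hUW
  calc X = X * (U ^ (β - 1) * W) * (U ^ (1 - β) * W ^ (-1 : ℝ)) := by
        have h1 : U ^ (β - 1) * U ^ (1 - β) = 1 := by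
          rw [← ENNReal.rpow_add _ _ hU0 hUt, sub_add_sub_cancel, sub_self, ENNReal.rpow_zero]
        have h2 : W * W ^ (-1 : ℝ) = 1 := by
          rw [ENNReal.rpow_neg_one, ENNReal.mul_inv_cancel hW0 hWt]
        calc X = X * ((U ^ (β - 1) * U ^ (1 - β)) * (W * W ^ (-1 : ℝ))) := by
              rw [h1, h2, one_mul, mul_one]
          _ = _ := by ring
    _ ≤ ((C₁ * C₂ : ℝ≥0) : ℝ≥0∞) ^ (1 - β) * (G * W ^ (1 / p) * U ^ (1 - 1 / q)) *
        (U ^ (1 - β) * W ^ (-1 : ℝ)) := by gcongr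
    _ = ((C₁ * C₂ : ℝ≥0) : ℝ≥0∞) ^ (1 - β) * G * W ^ (1 / p - 1) *
        (U ^ (1 - 1 / q) * U ^ (1 - β)) := by
        rw [sub_eq_add_neg (1 / p), ENNReal.rpow_add _ _ hW0 hWt]; ring
    _ ≤ ((C₁ * C₂ : ℝ≥0) : ℝ≥0∞) ^ (1 - β) * G *
        (((2 * C₂ : ℝ≥0) : ℝ≥0∞) ^ (1 - 1 / p) * U ^ (1 / p - 1)) *
        (U ^ (1 - 1 / q) * U ^ (1 - β)) := by gcongr
    _ = ((2 * C₂ : ℝ≥0) : ℝ≥0∞) ^ (1 - 1 / p) * ((C₁ * C₂ : ℝ≥0) : ℝ≥0∞) ^ (1 - β) * G *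
        (U ^ (1 / p - 1) * (U ^ (1 - 1 / q) * U ^ (1 - β))) := by ring
    _ = _ := by
        rw [← ENNReal.rpow_add _ _ hU0 hUt, ← ENNReal.rpow_add _ _ hU0 hUt, h,
          show 1 / p - 1 + (1 - (1 / p - β) + (1 - β)) = 1 by ring, ENNReal.rpow_one,
          ENNReal.coe_mul (_ ^ _), ENNReal.coe_rpow_of_nonneg _ hp',
          ENNReal.coe_rpow_of_nonneg _ hβ']

/-- The two halves of the second ball cut off by the median, used with L and -L, control the excess
and the deficit. Real and imaginary parts are treated separately, and κ is assembled from their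
medians. -/
lemma exists_lintegral_enorm_sub_le (hn : 1 ≤ n) (𝕜 : Type*) [RCLike 𝕜] {a β p q : ℝ}
    (ha : 0 < a) (hβ1 : β < 1) (hp : 1 < p) (hq : 1 < q) (h : 1 / q = 1 / p - β) :
    ∃ C : ℝ≥0, ∀ b : EuclideanSpace ℝ (Fin n) → 𝕜, Integrable b (gaussMeasure n) →
      StronglyMeasurable b → FracCommBounded a β (ENNReal.ofReal p) (ENNReal.ofReal q) b →
      ∀ (c : EuclideanSpace ℝ (Fin n)) (r : ℝ), IsAdmissible (min (1 / 10) (a / 10)) c r →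
      ∃ κ : 𝕜, ∫⁻ x in ball c r, ‖b x - κ‖ₑ ∂(gaussMeasure n) ≤
          C * fracCommNorm a β (ENNReal.ofReal p) (ENNReal.ofReal q) b *
            gaussMeasure n (ball c r) := by
  obtain ⟨C, hC⟩ := exists_lintegral_ofReal_sub_le n 𝕜 ha hβ1 hp hq h
  refine ⟨4 * C, fun b hb hbm hbd c r hcr => ?_⟩
  set γ := gaussMeasure n
  set G := fracCommNorm a β (ENNReal.ofReal p) (ENNReal.ofReal q) b
  set e : EuclideanSpace ℝ (Fin n) := EuclideanSpace.single ⟨0, hn⟩ 1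
  have he : ‖e‖ = 1 := by simp [e]
  set c' := c + (3 * r) • e
  have hcc : dist c c' = 3 * r := by
    rw [dist_eq_norm, sub_add_cancel_left, norm_neg, norm_smul, he, mul_one,
      Real.norm_of_nonneg (by linarith [hcr.1])]
  have key : ∀ L : 𝕜 →L[ℝ] ℝ, (∀ z, ‖L z‖ ≤ ‖z‖) →
      ∃ m : ℝ, ∫⁻ x in ball c r, ‖L (b x) - m‖ₑ ∂γ ≤ 2 * C * G * γ (ball c r) := by
    intro L hL
    have hLm : Measurable fun x => L (b x) := (L.continuous.comp_stronglyMeasurable hbm).measurable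
    obtain ⟨m, hm1, hm2⟩ := exists_median (γ.restrict (ball c' r)) hLm
    rw [Measure.restrict_apply_univ, Measure.restrict_apply
      (measurableSet_le hLm measurable_const)] at hm1
    rw [Measure.restrict_apply_univ, Measure.restrict_apply
      (measurableSet_le measurable_const hLm)] at hm2
    have h1 := hC b hb hbd L hL c c' r hcr hcc _ Set.inter_subset_right
      ((measurableSet_le hLm measurable_const).inter measurableSet_ball) hm1 m fun y hy => hy.1
    have h2 := hC b hb hbd (-L) (fun z => by simpa using hL z) c c' r hcr hcc _
      Set.inter_subset_right ((measurableSet_le measurable_const hLm).inter measurableSet_ball)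
      hm2 (-m) fun y hy => neg_le_neg hy.1
    refine ⟨m, ?_⟩
    calc ∫⁻ x in ball c r, ‖L (b x) - m‖ₑ ∂γ ≤
          ∫⁻ x in ball c r, (ENNReal.ofReal (L (b x) - m) +
            ENNReal.ofReal ((-L) (b x) - -m)) ∂γ := by
          refine lintegral_mono fun x => ?_
          rw [← ofReal_norm, Real.norm_eq_abs, _root_.neg_apply]
          rcases le_total 0 (L (b x) - m) with h0 | h0
          · rw [abs_of_nonneg h0]; exact le_self_add
          · rw [abs_of_nonpos h0, neg_sub_neg, neg_sub]; exact le_add_self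
      _ = ∫⁻ x in ball c r, ENNReal.ofReal (L (b x) - m) ∂γ +
          ∫⁻ x in ball c r, ENNReal.ofReal ((-L) (b x) - -m) ∂γ :=
          lintegral_add_left (hLm.sub_const m).ennreal_ofReal _
      _ ≤ C * G * γ (ball c r) + C * G * γ (ball c r) := add_le_add h1 h2
      _ = _ := by ring
  obtain ⟨m₁, h₁⟩ := key RCLike.reCLM fun z => RCLike.norm_re_le_norm z
  obtain ⟨m₂, h₂⟩ := key RCLike.imCLM fun z => RCLike.norm_im_le_norm z
  -- Only an inequality: over ℝ the element `RCLike.I` is 0.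
  have hI : ‖(RCLike.I : 𝕜)‖ₑ ≤ 1 := by
    rw [← ofReal_norm, ENNReal.ofReal_le_one]
    rcases eq_or_ne (RCLike.I : 𝕜) 0 with h0 | h0
    · rw [h0, norm_zero]; exact zero_le_one
    · exact (RCLike.norm_I_of_ne_zero h0).le
  refine ⟨(m₁ : 𝕜) + m₂ * RCLike.I, ?_⟩
  have hre : Measurable fun x => ‖RCLike.reCLM (b x) - m₁‖ₑ :=
    ((RCLike.reCLM.continuous.comp_stronglyMeasurable hbm).measurable.sub_const m₁).enorm
  calc ∫⁻ x in ball c r, ‖b x - ((m₁ : 𝕜) + m₂ * RCLike.I)‖ₑ ∂γ ≤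
        ∫⁻ x in ball c r, (‖RCLike.reCLM (b x) - m₁‖ₑ + ‖RCLike.imCLM (b x) - m₂‖ₑ) ∂γ := by
        refine lintegral_mono fun x => ?_
        have hb' : b x - ((m₁ : 𝕜) + m₂ * RCLike.I) =
            ((RCLike.re (b x) - m₁ : ℝ) : 𝕜) + ((RCLike.im (b x) - m₂ : ℝ) : 𝕜) * RCLike.I := by
          conv_lhs => rw [← RCLike.re_add_im (b x)]
          push_cast
          ring
        rw [hb']
        refine (enorm_add_le _ _).trans (add_le_add ?_ ?_)
        · rw [← ofReal_norm, RCLike.norm_ofReal, ← Real.norm_eq_abs, ofReal_norm]; rfl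
        · rw [enorm_mul]
          refine (mul_le_of_le_one_right' hI).trans ?_
          rw [← ofReal_norm, RCLike.norm_ofReal, ← Real.norm_eq_abs, ofReal_norm]; rfl
    _ = ∫⁻ x in ball c r, ‖RCLike.reCLM (b x) - m₁‖ₑ ∂γ +
        ∫⁻ x in ball c r, ‖RCLike.imCLM (b x) - m₂‖ₑ ∂γ := lintegral_add_left hre _
    _ ≤ 2 * C * G * γ (ball c r) + 2 * C * G * γ (ball c r) := add_le_add h₁ h₂
    _ = _ := by push_cast; ring

/-- The mean is optimal up to a factor 2, so any comparison constant may be used to bound the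
oscillation. -/
lemma lintegral_enorm_sub_ballAvg_le {b : EuclideanSpace ℝ (Fin n) → 𝕜}
    (hb : Integrable b (gaussMeasure n)) (c : EuclideanSpace ℝ (Fin n)) (r : ℝ) (κ : 𝕜) :
    ∫⁻ x in ball c r, ‖b x - ballAvg b c r‖ₑ ∂(gaussMeasure n) ≤
      2 * ∫⁻ x in ball c r, ‖b x - κ‖ₑ ∂(gaussMeasure n) := by
  calc _ ≤ ∫⁻ x in ball c r, (‖b x - κ‖ₑ + ‖ballAvg b c r - κ‖ₑ) ∂(gaussMeasure n) := by
        refine lintegral_mono fun x => ?_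
        rw [← sub_sub_sub_cancel_right (b x) (ballAvg b c r) κ]
        exact enorm_sub_le
    _ = ∫⁻ x in ball c r, ‖b x - κ‖ₑ ∂(gaussMeasure n) +
        ‖ballAvg b c r - κ‖ₑ * gaussMeasure n (ball c r) := by
        rw [lintegral_add_right _ measurable_const, setLIntegral_const]
    _ ≤ _ := by rw [two_mul]; gcongr; exact enorm_ballAvg_sub_mul_le hb c r κ

/-- If the commutator of the local fractional integral with `b` is bounded from `L^p` to `L^q`,
then `b` has bounded mean oscillation. -/
theorem exists_bmoSeminorm_le (hn : 1 ≤ n) (𝕜 : Type*) [RCLike 𝕜] {a β p q : ℝ} (ha : 0 < a)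
    (hβ1 : β < 1) (hp : 1 < p) (hq : 1 < q) (h : 1 / q = 1 / p - β) :
    ∃ C : ℝ≥0, ∀ b : EuclideanSpace ℝ (Fin n) → 𝕜, Integrable b (gaussMeasure n) →
      FracCommBounded a β (ENNReal.ofReal p) (ENNReal.ofReal q) b →
      IsBMO b ∧
        bmoSeminorm b ≤ C * fracCommNorm a β (ENNReal.ofReal p) (ENNReal.ofReal q) b := by
  obtain ⟨C₁, h₁⟩ := exists_lintegral_enorm_sub_le hn 𝕜 ha hβ1 hp hq h
  set δ := min (1 / 10) (a / 10)
  have hδ : 0 < δ := by positivity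
  have hδ1 : δ ≤ 1 := (min_le_left _ _).trans (by norm_num)
  -- With A = 1 the condition on scales reads 2(δ/6)·3 ≤ δ. The power s = 1 suffices, so
  -- John–Nirenberg is not needed here.
  obtain ⟨C₂, h₂⟩ := exists_lintegral_sub_ballAvg_le n 𝕜 (A := 1) (δ := δ / 6) (s := 1)
    zero_le_one (by positivity) (by linarith) le_rfl
  refine ⟨2 * (C₂ * (2 * C₁)), fun b hb hbd => ?_⟩
  wlog hbm : StronglyMeasurable b generalizing b
  · have hae := hb.1.ae_eq_mk
    have hN : fracCommNorm a β (ENNReal.ofReal p) (ENNReal.ofReal q) b =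
        fracCommNorm a β (ENNReal.ofReal p) (ENNReal.ofReal q) (hb.1.mk b) := by
      unfold fracCommNorm
      exact iSup_congr fun f => iSup_congr fun _ => iSup_congr fun _ =>
        eLpNorm_congr_ae (fracComm_congr hae f)
    have hbd' : FracCommBounded a β (ENNReal.ofReal p) (ENNReal.ofReal q) (hb.1.mk b) := by
      obtain ⟨K, hK⟩ := hbd
      refine ⟨K, fun f hf => ?_⟩
      rw [← memLp_congr_ae (fracComm_congr hae f), ← eLpNorm_congr_ae (fracComm_congr hae f)]
      exact hK f hf
    have := this _ (hb.congr hae) hbd' hb.1.stronglyMeasurable_mk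
    rw [hN]
    unfold IsBMO at this ⊢
    rw [bmoSeminorm_congr hae]
    exact ⟨⟨hb, this.1.2⟩, this.2⟩
  have hGt : fracCommNorm a β (ENNReal.ofReal p) (ENNReal.ofReal q) b ≠ ∞ := by
    obtain ⟨K, hK⟩ := hbd
    refine ne_top_of_le_ne_top (b := (K : ℝ≥0∞)) ENNReal.coe_ne_top ?_
    refine iSup_le fun f => iSup₂_le fun hf hf1 => ?_
    simpa [hf1] using (hK f hf).2
  lift fracCommNorm a β (ENNReal.ofReal p) (ENNReal.ofReal q) b to ℝ≥0 using hGt with G hG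
  have hosc : OscBound b 1 δ (2 * C₁ * G) := by
    intro c r hcr
    obtain ⟨κ, hκ⟩ := h₁ b hb hbm hbd c r hcr
    rw [← hG] at hκ
    simp only [ENNReal.rpow_one]
    calc _ ≤ 2 * ∫⁻ x in ball c r, ‖b x - κ‖ₑ ∂(gaussMeasure n) :=
          lintegral_enorm_sub_ballAvg_le hb c r κ
      _ ≤ 2 * (C₁ * G * gaussMeasure n (ball c r)) := by gcongr
      _ = _ := by push_cast; ring
  have hle : bmoSeminorm b ≤ ((2 * (C₂ * (2 * C₁)) : ℝ≥0) : ℝ≥0∞) * G := by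
    refine iSup_le fun c => iSup₂_le fun r hcr => ?_
    have h3 := h₂ b hb hbm δ (2 * C₁ * G) hδ1 (by linarith) hosc hosc c r hcr.1 hcr.2
    simp only [ENNReal.rpow_one] at h3
    have h4 := (lintegral_enorm_sub_ballAvg_le hb c r _).trans (mul_le_mul_right h3 2)
    rw [mul_comm, ← div_eq_mul_inv, ENNReal.div_le_iff (gaussMeasure_ball_pos c hcr.1).ne'
      (measure_ne_top _ _)]
    refine h4.trans_eq ?_
    push_cast
    ring
  exact ⟨⟨hb, hle.trans_lt (by finiteness)⟩, hle⟩

end GaussBMO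

/-! ### The theorem: both directions with a common constant -/

theorem theorem1p1 {𝕜 : Type*} [RCLike 𝕜] (n : ℕ) (hn : 1 ≤ n) (a β p q : ℝ) (ha : 0 < a)
    (hβ0 : 0 < β) (hβ1 : β < 1) (hp : 1 < p) (hpq : p < q) (hβ : 1 / q = 1 / p - β)
    -- the next two facts follow from `hp` and `hpq`; they only provide the topology of `Lp`
    [Fact (1 ≤ ENNReal.ofReal p)] [Fact (1 ≤ ENNReal.ofReal q)] :
    ∃ C : ℝ≥0, 0 < C ∧
      (∀ b : EuclideanSpace ℝ (Fin n) → 𝕜, GaussBMO.IsBMO b →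
        (∀ f : EuclideanSpace ℝ (Fin n) → 𝕜, GaussBMO.IsLcInfty f →
          AEMeasurable (GaussBMO.sublinComm a β b f) (GaussBMO.gaussMeasure n) ∧
          eLpNorm (GaussBMO.sublinComm a β b f) (ENNReal.ofReal q) (GaussBMO.gaussMeasure n) ≤
            C * GaussBMO.bmoSeminorm b *
              eLpNorm f (ENNReal.ofReal p) (GaussBMO.gaussMeasure n)) ∧
        ∃ T : Lp 𝕜 (ENNReal.ofReal p) (GaussBMO.gaussMeasure n) →
            Lp ℝ (ENNReal.ofReal q) (GaussBMO.gaussMeasure n),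
          GaussBMO.ExtendsSublinComm a β b T ∧
          GaussBMO.IsSublinear T ∧
          Continuous T ∧
          (∀ f, ‖T f‖ ≤ C * (GaussBMO.bmoSeminorm b).toReal * ‖f‖) ∧
          (∀ T' : Lp 𝕜 (ENNReal.ofReal p) (GaussBMO.gaussMeasure n) →
              Lp ℝ (ENNReal.ofReal q) (GaussBMO.gaussMeasure n),
            GaussBMO.ExtendsSublinComm a β b T' → GaussBMO.IsSublinear T' →
            (∃ K : ℝ, ∀ f, ‖T' f‖ ≤ K * ‖f‖) → T' = T) ∧
          (∀ T' : Lp 𝕜 (ENNReal.ofReal p) (GaussBMO.gaussMeasure n) →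
              Lp ℝ (ENNReal.ofReal q) (GaussBMO.gaussMeasure n),
            GaussBMO.ExtendsSublinComm a β b T' → Continuous T' → T' = T)) ∧
      (∀ b : EuclideanSpace ℝ (Fin n) → 𝕜,
        Integrable b (GaussBMO.gaussMeasure n) →
        GaussBMO.FracCommBounded a β (ENNReal.ofReal p) (ENNReal.ofReal q) b →
        GaussBMO.IsBMO b ∧
        GaussBMO.bmoNorm b ≤ eLpNorm b 1 (GaussBMO.gaussMeasure n) +
          C * GaussBMO.fracCommNorm a β (ENNReal.ofReal p) (ENNReal.ofReal q) b) := by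
  have hq : 1 < q := hp.trans hpq
  obtain ⟨C₁, h₁⟩ := GaussBMO.exists_eLpNorm_sublinComm_le hn 𝕜 ha hβ0 hβ1 hp hpq hβ
  obtain ⟨C₂, h₂⟩ := GaussBMO.exists_bmoSeminorm_le hn 𝕜 ha hβ1 hp hq hβ
  refine ⟨C₁ + C₂ + 1, by positivity, fun b hb => ?_, fun b hb hbd => ?_⟩
  · have hC : ∀ f : EuclideanSpace ℝ (Fin n) → 𝕜,
        MemLp f (ENNReal.ofReal p) (GaussBMO.gaussMeasure n) →
        eLpNorm (GaussBMO.sublinComm a β b f) (ENNReal.ofReal q) (GaussBMO.gaussMeasure n) ≤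
          (C₁ + C₂ + 1 : ℝ≥0) * GaussBMO.bmoSeminorm b *
            eLpNorm f (ENNReal.ofReal p) (GaussBMO.gaussMeasure n) := fun f hf => by
      refine (h₁ b hb f hf).trans ?_
      gcongr
      rw [add_assoc]
      exact le_self_add
    refine ⟨fun f hf => ⟨GaussBMO.aemeasurable_sublinComm hb.1.1 hf.1.1, hC f (hf.memLp _)⟩, ?_⟩
    obtain ⟨T, hT, hTs, hTb⟩ := GaussBMO.exists_extension_sublinComm hb ENNReal.ofReal_ne_top hC
    have hTc := hTs.continuous hTb
    exact ⟨T, hT, hTs, hTc, hTb,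
      fun T' hT' hTs' ⟨K, hK⟩ =>
        hT.eq_of_continuous ENNReal.ofReal_ne_top hT' hTc (hTs'.continuous hK),
      fun T' hT' hTc' => hT.eq_of_continuous ENNReal.ofReal_ne_top hT' hTc hTc'⟩
  · obtain ⟨hbmo, hle⟩ := h₂ b hb hbd
    refine ⟨hbmo, ?_⟩
    rw [GaussBMO.bmoNorm, add_comm]
    gcongr
    refine hle.trans ?_
    gcongr
    rw [add_right_comm]
    exact le_add_self
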